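/- Let $M$ be a smooth 3-manifold with a coorientable contact sub-Riemannian structure $(D,g)$, and let $\omega$ be the contact form with $D=\ker\omega$, normalized so that $d\omega|_D$ is the area form of $g$ (for one of the two orientations of $D$). Let $S\subset M$ be a smooth embedded surface, let $C(S)=\{q\in S: T_qS=D_q\}$ be its set of characteristic points, and let $\widehat X$ be a smooth unit vector field on $S\setminus C(S)$ tangent to $D\cap TS$ (it exists globally if $S$ is orientable). Let $\mathcal P=d\omega\wedge\omega$ be the Popp volume and let $\mu=\mathcal P(N,\cdot,\cdot)$ be the surface measure on $S\setminus C(S)$, where $N\in D$ is the unit vector orthogonal to $D\cap TS$, unique up to sign. The leaves of the characteristic foliation of $S\setminus C(S)$ are the maximal integral curves of the line field $D\cap TS$. Let $p\in C(S)$, let $X_1,X_2$ be a smooth orthonormal frame of $D$ near $p$, and let $u$ be a smooth function near $p$ with $du\neq0$ and $S=\{u=0\}$ near $p$. Write $\operatorname{Hess}u(p)(X_i,X_j)=X_iX_ju(p)$, let $J$ be the operator on $D_p$ with $g(v,Jw)=d\omega(v,w)$, and let $\operatorname{Hess}u(p)\circ J$ denote the endomorphism $B$ of $D_p=T_pS$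 with $g(Bv,w)=\operatorname{Hess}u(p)(v,Jw)$; it is, up to sign, the linearization at $p$ of the characteristic vector field $(X_2u)X_1-(X_1u)X_2$. Let $u$ be normalized by a constant factor so that the two eigenvalues of $B$ have sum $1$. Assume that $p$ is non-degenerate, that is, $\widehat K_p:=-1+\det\operatorname{Hess}u(p)/([X_1,X_2]u(p))^2\neq-1$. Let $\ell$ be a leaf that has $p$ as an endpoint, with an arc-length parametrization $\gamma:(0,a)\to\ell$, $0<a\le\infty$, such that $\gamma(s)\to p$ as $s\to0^+$. Orient $\widehat X$ along $\ell$ so that $\gamma'=\widehat X\circ\gamma$, and put $b(s)=(\operatorname{div}_\mu\widehat X)(\gamma(s))$, so that the Laplacian of the leaf is $\Delta_\ell=\partial_s^2+b\,\partial_s$, and let $$L_\ell=-\partial_s^2+V,\qquad V=\tfrac12b'+\tfrac14b^2,$$ be the operator on $L^2((0,a),ds)$ unitarily equivalent to $-\Delta_\ell$. Call $L_\ell$ essentially self-adjoint at $p$ if it is in the limit point case at $s=0$, that is, if not all solutions of $L_\ell\varphi=0$ are square integrable near $s=0$. Then $L_\ell$ is essentially self-adjoint at $p$ if and only if all eigenvalues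 of $\operatorname{Hess}u(p)\circ J$ are real and there is $\lambda\in[-1,1/3]$ such that $\ell$ enters $p$ tangentially to the $\lambda$-eigenspace of $\operatorname{Hess}u(p)\circ J$, that is, such that $\gamma'(s)$ converges as $s\to0^+$ to a vector $w\in T_pS$, $w\ne0$, with $\operatorname{Hess}u(p)\circ J\,w=\lambda w$. -/

import Mathlib

open Set Filter Topology MeasureTheory Manifold
open scoped ContDiff

noncomputable section

namespace ContactSR

section OneForms

variable {M : Type*} [TopologicalSpace M] [ChartedSpace (EuclideanSpace ℝ (Fin 3)) M]
  [IsManifold (𝓡 3) ∞ M]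

/-- The expression in the chart centred at `c` of a one-form `α` on `M`. -/
def formInChart (α : (q : M) → TangentSpace (𝓡 3) q →L[ℝ] ℝ) (c : M)
    (x : EuclideanSpace ℝ (Fin 3)) : EuclideanSpace ℝ (Fin 3) →L[ℝ] ℝ :=
  (α ((extChartAt (𝓡 3) c).symm x)).comp
    (mfderiv 𝓘(ℝ, EuclideanSpace ℝ (Fin 3)) (𝓡 3) (extChartAt (𝓡 3) c).symm x)

/-- A one-form is smooth if its expression in every chart is smooth. -/
def IsSmoothOneForm (α : (q : M) → TangentSpace (𝓡 3) q →L[ℝ] ℝ) : Prop :=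
  ∀ c : M, ContDiffOn ℝ ∞ (formInChart α c) (extChartAt (𝓡 3) c).target

/-- The exterior derivative `dα_q(v, w) = ∂_v (α w) - ∂_w (α v)`, computed in the chart at `q`. -/
def extDerivOneForm (α : (q : M) → TangentSpace (𝓡 3) q →L[ℝ] ℝ) (q : M)
    (v w : TangentSpace (𝓡 3) q) : ℝ :=
  let D := fderiv ℝ (formInChart α q) (extChartAt (𝓡 3) q q)
  let φ := mfderiv (𝓡 3) 𝓘(ℝ, EuclideanSpace ℝ (Fin 3)) (extChartAt (𝓡 3) q) q
  D (φ v) (φ w) - D (φ w) (φ v)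

/-- A vector field is smooth on the set `U`. -/
def IsSmoothFieldOn (X : (q : M) → TangentSpace (𝓡 3) q) (U : Set M) : Prop :=
  ContMDiffOn (𝓡 3) (𝓡 3).tangent ∞ (fun q => (⟨q, X q⟩ : TangentBundle (𝓡 3) M)) U

/-- The derivative `X f` of a function `f` along a vector field `X`. -/
def fieldDeriv (X : (q : M) → TangentSpace (𝓡 3) q) (f : M → ℝ) (q : M) : ℝ :=
  mfderiv (𝓡 3) 𝓘(ℝ, ℝ) f q (X q)

end OneForms

/-- A coorientable contact sub-Riemannian structure on a 3-manifold. The distribution is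
`D = ker α`, `g` is the metric on it, and `α` is the contact form normalized so that the restriction
of `dα` to `D` is, up to orientation, the area form of `g`; with `α ≠ 0` this contains the contact
condition `α ∧ dα ≠ 0`. -/
structure ContactSubRiemannian (M : Type*) [TopologicalSpace M]
    [ChartedSpace (EuclideanSpace ℝ (Fin 3)) M] [IsManifold (𝓡 3) ∞ M] where
  /-- the normalized contact form -/
  α : (q : M) → TangentSpace (𝓡 3) q →L[ℝ] ℝ
  smooth_form : IsSmoothOneForm α
  form_ne_zero : ∀ q, α q ≠ 0
  /-- the metric on the distribution -/
  g : (q : M) → LinearMap.BilinForm ℝ (α q).ker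
  g_symm : ∀ q v w, g q v w = g q w v
  g_pos : ∀ q v, v ≠ 0 → 0 < g q v v
  /-- the metric is smooth: there are smooth orthonormal frames around every point -/
  exists_frame : ∀ q₀ : M, ∃ U : Set M, IsOpen U ∧ q₀ ∈ U ∧
    ∃ X : Fin 2 → (q : M) → (α q).ker,
      (∀ i, IsSmoothFieldOn (fun q => (X i q : TangentSpace (𝓡 3) q)) U) ∧
      ∀ q ∈ U, ∀ i j, g q (X i q) (X j q) = if i = j then 1 else 0
  normalized : ∀ q (v w : (α q).ker), g q v v = 1 → g q w w = 1 → g q v w = 0 →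
    |extDerivOneForm α q v w| = 1

variable {M : Type*} [TopologicalSpace M] [ChartedSpace (EuclideanSpace ℝ (Fin 3)) M]
  [IsManifold (𝓡 3) ∞ M]
  {S : Type*} [TopologicalSpace S] [ChartedSpace (EuclideanSpace ℝ (Fin 2)) S]
  [IsManifold (𝓡 2) ∞ S]

namespace ContactSubRiemannian

variable (C : ContactSubRiemannian M)

/-- The contact distribution at `q`. -/
abbrev D (q : M) : Submodule ℝ (TangentSpace (𝓡 3) q) := (C.α q).ker

/-- The exterior derivative of the contact form. -/
def dα (q : M) (v w : TangentSpace (𝓡 3) q) : ℝ := extDerivOneForm C.α q v w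

/-- The Popp volume form `dα ∧ α`. -/
def popp (q : M) (v₁ v₂ v₃ : TangentSpace (𝓡 3) q) : ℝ :=
  C.dα q v₁ v₂ * C.α q v₃ + C.dα q v₂ v₃ * C.α q v₁ + C.dα q v₃ v₁ * C.α q v₂

/-- The Popp volume takes the value `1` on a positively oriented orthonormal frame of the
distribution followed by the Reeb vector. -/
theorem popp_eq_one (q : M) (v₁ v₂ : C.D q) (h : C.dα q v₁ v₂ = 1)
    (v₀ : TangentSpace (𝓡 3) q) (h₀ : C.α q v₀ = 1) : C.popp q v₁ v₂ v₀ = 1 := by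
  have h1 : C.α q v₁ = 0 := v₁.2
  have h2 : C.α q v₂ = 0 := v₂.2
  simp [popp, h, h₀, h1, h2]

/-- `X` is a smooth orthonormal frame of the distribution on the open set `U`. -/
structure IsOrthonormalFrameOn (X : Fin 2 → (q : M) → C.D q) (U : Set M) : Prop where
  smooth : ∀ i, IsSmoothFieldOn (fun q => (X i q : TangentSpace (𝓡 3) q)) U
  orthonormal : ∀ q ∈ U, ∀ i j, C.g q (X i q) (X j q) = if i = j then 1 else 0

/-! ### Surfaces -/

/-- The characteristic set `C(S)`: the points `q` of the surface with `T_q S = D_q`. -/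
def charSet (ι : S → M) : Set S :=
  {q | LinearMap.range (mfderiv (𝓡 2) (𝓡 3) ι q).toLinearMap = C.D (ι q)}

/-- The characteristic direction `D_q ∩ T_q S`, as a subspace of `T_q S`. -/
def charDir (ι : S → M) (q : S) : Submodule ℝ (TangentSpace (𝓡 2) q) :=
  (C.D (ι q)).comap (mfderiv (𝓡 2) (𝓡 3) ι q).toLinearMap

/-- The push-forward to `D` of a vector in the characteristic direction. -/
def pushD (ι : S → M) (q : S) (v : C.charDir ι q) : C.D (ι q) :=
  ⟨mfderiv (𝓡 2) (𝓡 3) ι q v, v.2⟩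

/-- `Xh` is a unitary characteristic vector field: on `S \ C(S)` it is smooth, of unit length, and
tangent to `D ∩ TS` (hence spans it). -/
structure IsUnitCharField (ι : S → M) (Xh : (q : S) → TangentSpace (𝓡 2) q) : Prop where
  smooth : ContMDiffOn (𝓡 2) (𝓡 2).tangent ∞
    (fun q => (⟨q, Xh q⟩ : TangentBundle (𝓡 2) S)) (C.charSet ι)ᶜ
  unit : ∀ q ∉ C.charSet ι, ∃ h : Xh q ∈ C.charDir ι q,
    C.g (ι q) (C.pushD ι q ⟨Xh q, h⟩) (C.pushD ι q ⟨Xh q, h⟩) = 1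

/-- `N` is a horizontal unit normal to `S`: on `S \ C(S)` it is a unit vector of `D` that is
orthogonal to `D ∩ TS`. This determines each `N q` up to sign. -/
def IsHorizontalUnitNormal (ι : S → M) (N : (q : S) → C.D (ι q)) : Prop :=
  ∀ q ∉ C.charSet ι, C.g (ι q) (N q) (N q) = 1 ∧
    ∀ v : C.charDir ι q, C.g (ι q) (N q) (C.pushD ι q v) = 0

/-- The density `|μ|` on `S \ C(S)` of the surface form `μ = P(N, ·, ·)`. It does not depend on the
sign of `N`. -/
def surfaceDensity (ι : S → M) (N : (q : S) → C.D (ι q)) (q : S)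
    (v w : TangentSpace (𝓡 2) q) : ℝ :=
  |C.popp (ι q) (N q) (mfderiv (𝓡 2) (𝓡 3) ι q v) (mfderiv (𝓡 2) (𝓡 3) ι q w)|

end ContactSubRiemannian

/-- The divergence at `q` of a vector field `X` on a surface with respect to a density `m`: in the
coordinates `x` at `q`, if `m = ρ dx` and `X = ∑ aᵢ ∂ᵢ`, it is `ρ⁻¹ ∑ ∂ᵢ(ρ aᵢ)`. -/
def divergence (m : (q : S) → TangentSpace (𝓡 2) q → TangentSpace (𝓡 2) q → ℝ)
    (X : (q : S) → TangentSpace (𝓡 2) q) (q : S) : ℝ :=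
  let ψ := (extChartAt (𝓡 2) q).symm
  let e : Fin 2 → EuclideanSpace ℝ (Fin 2) := fun i => EuclideanSpace.single i 1
  let ρ : EuclideanSpace ℝ (Fin 2) → ℝ := fun x =>
    m (ψ x) (mfderiv 𝓘(ℝ, EuclideanSpace ℝ (Fin 2)) (𝓡 2) ψ x (e 0))
      (mfderiv 𝓘(ℝ, EuclideanSpace ℝ (Fin 2)) (𝓡 2) ψ x (e 1))
  let a : EuclideanSpace ℝ (Fin 2) → EuclideanSpace ℝ (Fin 2) := fun x =>
    mfderiv (𝓡 2) 𝓘(ℝ, EuclideanSpace ℝ (Fin 2)) (extChartAt (𝓡 2) q) (ψ x) (X (ψ x))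
  let x₀ := extChartAt (𝓡 2) q q
  (ρ x₀)⁻¹ * ∑ i, fderiv ℝ (fun x => ρ x * a x i) x₀ (e i)

namespace ContactSubRiemannian

variable (C : ContactSubRiemannian M)

/-! ### Leaves of the characteristic foliation -/

/-- The leaf through `q`: all points that are joined to `q` by a curve in `S \ C(S)` tangent to the
characteristic direction. -/
def leafThrough (ι : S → M) (q : S) : Set S :=
  {q' | ∃ c : ℝ → S, c 0 = q ∧ c 1 = q' ∧ ∀ t ∈ Icc (0 : ℝ) 1, c t ∉ C.charSet ι ∧
    ∃ v ∈ C.charDir ι (c t), HasMFDerivWithinAt 𝓘(ℝ, ℝ) (𝓡 2) c (Icc (0 : ℝ) 1) t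
      ((1 : ℝ →L[ℝ] ℝ).smulRight v)}

/-- `ℓ` is a leaf of the characteristic foliation of `S \ C(S)`. -/
def IsLeaf (ι : S → M) (ℓ : Set S) : Prop :=
  ∃ q ∉ C.charSet ι, ℓ = C.leafThrough ι q

end ContactSubRiemannian

/-- The open interval `(0, a)`, where `0 < a ≤ ∞`. -/
def openInterval (a : EReal) : Set ℝ := {s | 0 < s ∧ (s : EReal) < a}

namespace ContactSubRiemannian

variable (C : ContactSubRiemannian M)

/-- `γ : (0, a) → ℓ` is an arc-length parametrization of the leaf `ℓ`, starting from the endpoint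
`p`, with velocity `ε Xh`, where `ε = ±1` and `Xh` is a unitary characteristic field. -/
structure IsArcLength (ι : S → M) (Xh : (q : S) → TangentSpace (𝓡 2) q) (ε : ℝ) (ℓ : Set S)
    (p : S) (a : EReal) (γ : ℝ → S) : Prop where
  leaf : C.IsLeaf ι ℓ
  pos : 0 < a
  bijOn : BijOn γ (openInterval a) ℓ
  sign : ε = 1 ∨ ε = -1
  velocity : IsMIntegralCurveOn γ (fun q => ε • Xh q) (openInterval a)
  start : Tendsto γ (𝓝[>] 0) (𝓝 p)

/-- The coefficient `b` of `Δ_ℓ = ∂_s² + b ∂_s` in the arc-length parameter: the value at `γ s` of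
the divergence of the unit field `ε Xh`, whose integral curve is `γ`. -/
def driftCoeff (ι : S → M) (N : (q : S) → C.D (ι q)) (Xh : (q : S) → TangentSpace (𝓡 2) q)
    (ε : ℝ) (γ : ℝ → S) (s : ℝ) : ℝ :=
  divergence (C.surfaceDensity ι N) (fun q => ε • Xh q) (γ s)

end ContactSubRiemannian

/-! ### Schrödinger operators on an interval -/

/-- The potential `V = b' / 2 + b² / 4` of the operator `-∂_s² + V` that is unitarily equivalent to
`-(∂_s² + b ∂_s)`. -/
def potential (b : ℝ → ℝ) (s : ℝ) : ℝ := deriv b s / 2 + b s ^ 2 / 4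

/-- `φ` solves `-φ'' + V φ = 0` on `(0, a)`. -/
def IsSolution (a : EReal) (V : ℝ → ℝ) (φ : ℝ → ℂ) : Prop :=
  ∃ φ' : ℝ → ℂ, ∀ s ∈ openInterval a,
    HasDerivAt φ (φ' s) s ∧ HasDerivAt φ' ((V s : ℂ) * φ s) s

/-- `-∂_s² + V` on `(0, a)` is in the limit circle case at `0`: all solutions of
`-φ'' + V φ = 0` are square integrable at `0`. -/
def LimitCircleAtZero (a : EReal) (V : ℝ → ℝ) : Prop :=
  ∀ φ : ℝ → ℂ, IsSolution a V φ →
    ∃ c ∈ openInterval a, MemLp φ 2 (volume.restrict (Ioo 0 c))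

/-- `-∂_s² + V` on `(0, a)` is essentially self-adjoint at the endpoint `0`: it is in the limit
point case there. -/
def EssSelfAdjointAtZero (a : EReal) (V : ℝ → ℝ) : Prop := ¬ LimitCircleAtZero a V

/-! ### The Hessian at a characteristic point -/

/-- `u` is a smooth function on the open set `U`, with `du ≠ 0`, whose zero locus is `S ∩ U`. -/
structure IsLocalDefiningFun (ι : S → M) (U : Set M) (u : M → ℝ) : Prop where
  smooth : ContMDiffOn (𝓡 3) 𝓘(ℝ, ℝ) ∞ u U
  du_ne_zero : ∀ q ∈ U, mfderiv (𝓡 3) 𝓘(ℝ, ℝ) u q ≠ 0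
  zero_iff : ∀ q ∈ U, u q = 0 ↔ q ∈ range ι

/-- All complex eigenvalues of the real matrix `B` are real. -/
def AllEigenvaluesReal (B : Matrix (Fin 2) (Fin 2) ℝ) : Prop :=
  ∀ z : ℂ, Module.End.HasEigenvalue (Matrix.toLin' (B.map ((↑) : ℝ → ℂ))) z → z.im = 0

namespace ContactSubRiemannian

variable (C : ContactSubRiemannian M)

/-- The matrix `(X_i X_j u)(q)` of the horizontal Hessian in the frame `X`. -/
def hess (X : Fin 2 → (q : M) → C.D q) (u : M → ℝ) (q : M) : Matrix (Fin 2) (Fin 2) ℝ :=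
  Matrix.of fun i j => fieldDeriv (fun q => (X i q : TangentSpace (𝓡 3) q))
    (fieldDeriv (fun q => (X j q : TangentSpace (𝓡 3) q)) u) q

/-- The matrix in the frame `X` of the operator `J` on `D_q` with `g(v, J w) = dα(v, w)`. -/
def jMatrix (X : Fin 2 → (q : M) → C.D q) (q : M) : Matrix (Fin 2) (Fin 2) ℝ :=
  Matrix.of fun i j => C.dα q (X i q) (X j q)

/-- The matrix in the frame `X` of `Hess u(q) ∘ J`, that is, of the endomorphism `B` of `D_q` with
`g(B v, w) = Hess u(q)(v, J w)`. At a characteristic point `p` this is the linearization at `p` of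
the characteristic field `±((X₂u) X₁ - (X₁u) X₂)`. -/
def hessJ (X : Fin 2 → (q : M) → C.D q) (u : M → ℝ) (q : M) : Matrix (Fin 2) (Fin 2) ℝ :=
  (C.hess X u q * C.jMatrix X q).transpose

/-- The curvature `K̂ = -1 + det Hess u / ([X₁, X₂] u)²` of a characteristic point. -/
def charCurvature (X : Fin 2 → (q : M) → C.D q) (u : M → ℝ) (q : M) : ℝ :=
  -1 + (C.hess X u q).det /
    (fieldDeriv (VectorField.mlieBracket (𝓡 3) (fun q => (X 0 q : TangentSpace (𝓡 3) q))
      (fun q => (X 1 q : TangentSpace (𝓡 3) q))) u q) ^ 2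

/-- The leaf with arc-length parametrization `γ`, of velocity `ε Xh`, enters `p` tangentially to the
`lam`-eigenspace of `Hess u(p) ∘ J`: the velocity converges, as `s → 0`, to a nonzero tangent vector
at `p` whose coordinates in the frame `X` form an eigenvector. -/
def EntersTangentTo (ι : S → M) (Xh : (q : S) → TangentSpace (𝓡 2) q) (ε : ℝ) (γ : ℝ → S) (p : S)
    (X : Fin 2 → (q : M) → C.D q) (u : M → ℝ) (lam : ℝ) : Prop :=
  ∃ (w : TangentSpace (𝓡 2) p) (c : Fin 2 → ℝ),
    Tendsto (fun s => (⟨γ s, ε • Xh (γ s)⟩ : TangentBundle (𝓡 2) S)) (𝓝[>] 0)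
      (𝓝 (⟨p, w⟩ : TangentBundle (𝓡 2) S)) ∧
    mfderiv (𝓡 2) (𝓡 3) ι p w = ∑ i, c i • (X i (ι p) : TangentSpace (𝓡 3) (ι p)) ∧
    Module.End.HasEigenvector (Matrix.toLin' (C.hessJ X u (ι p))) lam c

end ContactSubRiemannian

end ContactSR

end

namespace ContactSR

/-! ### Schrödinger operators with a potential of the form `b' / 2 + b² / 4` -/

/-! Everything is read off from the pull-back `A` of the contact form to the surface, written in a
chart at `p`. It vanishes exactly at the characteristic points, and elsewhere its kernel is the
characteristic direction. Contracting the density `|μ|` with the unit characteristic field gives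
`±A`, so the divergence of that field is `dA(X, W) / A(W)` for any transverse `W`. At `p` the
differential of `u` is a multiple `c` of the contact form, and this gives `Hess u(p) = -c DA(p)` on
`T_p S = D_p`. Hence, up to a factor, `B = Hess u(p) ∘ J` is the linear part of the field spanning
`ker A`.

In coordinates `z` at `p` adapted to the orthonormal frame, a leaf therefore satisfies `z' = k (B z
+ O(‖z‖²))` with speed tending to `1`. Because the trace of `B` is `1`, the same factor governs the
drift: `b = k (1 + O(‖z‖))`. Non-degeneracy means that `B` is invertible, so `|k| ‖z‖` stays between
two positive constants and `b = k + O(1)` (`isSingularCurve_of_form`, `bounds`).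

If the velocity converges to an eigenvector of eigenvalue `λ ≠ 1/2`, then `z` is asymptotic to `s
w`, and the logarithm of the component of `z` along that eigenline has derivative `λ k + O(1)`. So a
primitive `G` of `b` is `β log s + O(1)` with `β = 1/λ` (`log_asymptotics`). The equation `φ'' = V
φ` has the solutions `exp (G/2)` and `exp (G/2) ∫ exp (-G)`. The first has square of size `s ^ β`;
for `β > 1` the second has square of size `s ^ (2 - β)`. All solutions are square integrable exactly
for `-1 < β < 3`, so the limit point case is `1/λ ≤ -1` or `1/λ ≥ 3`, that is `λ ∈ [-1, 1/3]`, the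
value `0` being excluded by invertibility.

It remains to see that no other leaf is in the limit point case. If `det B < 1/4`, the eigenvalues
are real and distinct; cones around the eigenlines can be crossed in one direction only, and this
forces the leaf to be tangent to an eigenline at `p` (`approaches_eigenline`). If `det B ≥ 1/4`, the
eigenvalues are nonreal or both equal to `1/2`; an adapted quadratic form shows that `exp G` lies
between multiples of `s ^ (11/5)` and `s ^ (9/5)`, which is enough for the limit circle case
(`rough_asymptotics`). -/

theorem isOpen_openInterval (a : EReal) : IsOpen (openInterval a) :=
  (isOpen_lt continuous_const continuous_id).inter
    (isOpen_lt continuous_coe_real_ereal continuous_const)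

theorem ordConnected_openInterval (a : EReal) : (openInterval a).OrdConnected :=
  ⟨fun _ hx _ hy _ hz => ⟨hx.1.trans_le hz.1, (EReal.coe_le_coe_iff.2 hz.2).trans_lt hy.2⟩⟩

theorem Ioo_subset_openInterval {a : EReal} {c : ℝ} (hc : c ∈ openInterval a) :
    Ioo 0 c ⊆ openInterval a :=
  fun _ hs => ⟨hs.1, (EReal.coe_lt_coe_iff.2 hs.2).trans hc.2⟩

theorem openInterval_nonempty {a : EReal} (ha : 0 < a) : (openInterval a).Nonempty := by
  obtain ⟨c, h1, h2⟩ := EReal.lt_iff_exists_real_btwn.1 ha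
  exact ⟨c, by exact_mod_cast h1, h2⟩

theorem openInterval_mem_nhdsGT {a : EReal} (ha : 0 < a) : openInterval a ∈ 𝓝[>] (0 : ℝ) := by
  obtain ⟨c, hc⟩ := openInterval_nonempty ha
  exact mem_of_superset (Ioo_mem_nhdsGT hc.1) (Ioo_subset_openInterval hc)

/-- An eventual property at `0⁺` holds on some `(0, δ)` with `δ` arbitrarily small. -/
theorem exists_Ioo_of_eventually {P : ℝ → Prop} (h : ∀ᶠ s in 𝓝[>] (0 : ℝ), P s) :
    ∃ δ > 0, ∀ s ∈ Ioo 0 δ, P s := by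
  obtain ⟨δ, h0, h1⟩ := mem_nhdsGT_iff_exists_Ioo_subset.1 h
  exact ⟨δ, h0, h1⟩

theorem exists_primitive {a : EReal} {f : ℝ → ℝ} (hf : ContinuousOn f (openInterval a)) :
    ∃ G : ℝ → ℝ, ∀ s ∈ openInterval a, HasDerivAt G (f s) s := by
  rcases (openInterval a).eq_empty_or_nonempty with h | ⟨c, hc⟩
  · exact ⟨0, by simp [h]⟩
  refine ⟨fun s => ∫ t in c..s, f t, fun s hs => ?_⟩
  have hsub : uIcc c s ⊆ openInterval a := (ordConnected_openInterval a).uIcc_subset hc hs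
  refine intervalIntegral.integral_hasDerivAt_right ((hf.mono hsub).intervalIntegrable) ?_
    (hf.continuousAt ((isOpen_openInterval a).mem_nhds hs))
  exact hf.stronglyMeasurableAtFilter (isOpen_openInterval a) s hs

section Solutions

variable {a : EReal} {b G H : ℝ → ℝ}

/-- The operator factors as `-∂² + V = -(∂ + b/2)(∂ - b/2)`, and `exp (G/2)` is killed by the right
factor. It corresponds to the constant function under the unitary equivalence with the Laplacian of
the leaf. -/
theorem isSolution_exp (hb : ∀ s ∈ openInterval a, DifferentiableAt ℝ b s)
    (hG : ∀ s ∈ openInterval a, HasDerivAt G (b s) s) :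
    IsSolution a (potential b) (fun s => (Real.exp (G s / 2) : ℂ)) := by
  refine ⟨fun s => ((b s / 2 * Real.exp (G s / 2) : ℝ) : ℂ), fun s hs => ?_⟩
  have h1 : HasDerivAt (fun s => Real.exp (G s / 2)) (b s / 2 * Real.exp (G s / 2)) s := by
    simpa [mul_comm] using ((hG s hs).div_const 2).exp
  refine ⟨h1.ofReal_comp, ?_⟩
  have h2 := (((hb s hs).hasDerivAt.div_const 2).mul h1).ofReal_comp
  refine h2.congr_deriv ?_
  rw [← Complex.ofReal_mul, potential]
  congr 1
  ring

/-- The second solution corresponds to the non-constant harmonic function `H` of the leaf: `H' = exp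
(-G)` solves `H'' + b H' = 0`. -/
theorem isSolution_exp_mul (hb : ∀ s ∈ openInterval a, DifferentiableAt ℝ b s)
    (hG : ∀ s ∈ openInterval a, HasDerivAt G (b s) s)
    (hH : ∀ s ∈ openInterval a, HasDerivAt H (Real.exp (-G s)) s) :
    IsSolution a (potential b) (fun s => ((Real.exp (G s / 2) * H s : ℝ) : ℂ)) := by
  refine ⟨fun s => ((b s / 2 * (Real.exp (G s / 2) * H s) + Real.exp (-(G s / 2)) : ℝ) : ℂ),
    fun s hs => ?_⟩
  have h1 : HasDerivAt (fun s => Real.exp (G s / 2)) (b s / 2 * Real.exp (G s / 2)) s := by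
    simpa [mul_comm] using ((hG s hs).div_const 2).exp
  have h2 : HasDerivAt (fun s => Real.exp (-(G s / 2)))
      (-(b s / 2) * Real.exp (-(G s / 2))) s := by
    simpa [mul_comm] using ((hG s hs).div_const 2).neg.exp
  have he : Real.exp (G s / 2) * Real.exp (-G s) = Real.exp (-(G s / 2)) := by
    rw [← Real.exp_add]; congr 1; ring
  have h3 : HasDerivAt (fun s => Real.exp (G s / 2) * H s)
      (b s / 2 * (Real.exp (G s / 2) * H s) + Real.exp (-(G s / 2))) s :=
    (h1.mul (hH s hs)).congr_deriv (by rw [he]; ring)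
  refine ⟨h3.ofReal_comp, ?_⟩
  have h4 := ((((hb s hs).hasDerivAt.div_const 2).mul h3).add h2).ofReal_comp
  refine h4.congr_deriv ?_
  rw [← Complex.ofReal_mul, potential]
  congr 1
  ring

/-- Reduction of order: every solution is a combination of the two explicit ones. -/
theorem IsSolution.eq_combination {φ : ℝ → ℂ} (hφ : IsSolution a (potential b) φ)
    (hb : ∀ s ∈ openInterval a, DifferentiableAt ℝ b s)
    (hG : ∀ s ∈ openInterval a, HasDerivAt G (b s) s)
    (hH : ∀ s ∈ openInterval a, HasDerivAt H (Real.exp (-G s)) s) :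
    ∃ A B : ℂ, ∀ s ∈ openInterval a, φ s = (Real.exp (G s / 2) : ℂ) * (A + B * H s) := by
  obtain ⟨φ', h⟩ := hφ
  have hconst : ∀ f : ℝ → ℂ, (∀ s ∈ openInterval a, HasDerivAt f 0 s) →
      ∃ c, ∀ s ∈ openInterval a, f s = c := by
    intro f hf
    obtain ⟨c, hc⟩ := (isOpen_openInterval a).exists_is_const_of_deriv_eq_zero
      (ordConnected_openInterval a).isPreconnected
      (fun s hs => (hf s hs).differentiableAt.differentiableWithinAt)
      (fun s hs => (hf s hs).deriv)
    exact ⟨c, fun s hs => hc s hs⟩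
  have h1 : ∀ s ∈ openInterval a,
      HasDerivAt (fun s => ((Real.exp (G s / 2) : ℝ) : ℂ))
        ((b s / 2 * Real.exp (G s / 2) : ℝ) : ℂ) s := fun s hs => by
    have : HasDerivAt (fun s => Real.exp (G s / 2)) (b s / 2 * Real.exp (G s / 2)) s := by
      simpa [mul_comm] using ((hG s hs).div_const 2).exp
    exact this.ofReal_comp
  have h1' : ∀ s ∈ openInterval a,
      HasDerivAt (fun s => ((Real.exp (-(G s / 2)) : ℝ) : ℂ))
        ((-(b s / 2) * Real.exp (-(G s / 2)) : ℝ) : ℂ) s := fun s hs => by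
    have : HasDerivAt (fun s => Real.exp (-(G s / 2)))
        (-(b s / 2) * Real.exp (-(G s / 2))) s := by
      simpa [mul_comm] using ((hG s hs).div_const 2).neg.exp
    exact this.ofReal_comp
  have hb' : ∀ s ∈ openInterval a, HasDerivAt (fun s => ((b s / 2 : ℝ) : ℂ))
      ((deriv b s / 2 : ℝ) : ℂ) s := fun s hs =>
    ((hb s hs).hasDerivAt.div_const 2).ofReal_comp
  -- `W` is the Wronskian of `exp (G/2)` and `φ`.
  obtain ⟨W, hW⟩ := hconst
    (fun s => (φ' s - ((b s / 2 : ℝ) : ℂ) * φ s) * ((Real.exp (G s / 2) : ℝ) : ℂ)) (by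
      intro s hs
      refine (((h s hs).2.sub ((hb' s hs).mul (h s hs).1)).mul (h1 s hs)).congr_deriv ?_
      simp only [potential, Pi.sub_apply, Pi.mul_apply]
      push_cast
      ring)
  have hee : ∀ s, ((Real.exp (G s / 2) : ℝ) : ℂ) * ((Real.exp (-(G s / 2)) : ℝ) : ℂ) = 1 := by
    intro s
    rw [← Complex.ofReal_mul, ← Real.exp_add, add_neg_cancel, Real.exp_zero, Complex.ofReal_one]
  have hee' : ∀ s, ((Real.exp (-G s) : ℝ) : ℂ)
      = ((Real.exp (-(G s / 2)) : ℝ) : ℂ) * ((Real.exp (-(G s / 2)) : ℝ) : ℂ) := by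
    intro s
    rw [← Complex.ofReal_mul, ← Real.exp_add]
    congr 2; ring
  -- The quotient of `φ` by `exp (G/2)` has derivative `W exp (-G) = W H'`.
  obtain ⟨A, hA⟩ := hconst
    (fun s => φ s * ((Real.exp (-(G s / 2)) : ℝ) : ℂ) - W * (H s : ℂ)) (by
      intro s hs
      refine (((h s hs).1.mul (h1' s hs)).sub ((hH s hs).ofReal_comp.const_mul W)).congr_deriv ?_
      rw [hee', ← hW s hs]
      have := hee s
      push_cast at this ⊢
      linear_combination (-(φ' s - (b s : ℂ) / 2 * φ s)
        * Complex.exp (-((G s : ℂ) / 2))) * this)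
  refine ⟨A, W, fun s hs => ?_⟩
  have h2 := hA s hs
  rw [← h2]
  linear_combination (-φ s) * hee s

end Solutions

/-! ### Square integrability at `0` -/

theorem not_memLp_of_rpow_le {φ : ℝ → ℂ} {r c δ c' : ℝ} (hr : r ≤ -1) (hc : 0 < c) (hδ : 0 < δ)
    (hc' : 0 < c') (h : ∀ s ∈ Ioo 0 δ, c * s ^ r ≤ ‖φ s‖ ^ 2) :
    ¬ MemLp φ 2 (volume.restrict (Ioo 0 c')) := by
  intro hφ
  have h1 : IntegrableOn (fun s => ‖φ s‖ ^ 2) (Ioo 0 c') :=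
    (memLp_two_iff_integrable_sq_norm hφ.1).1 hφ
  set η := min δ c'
  have hη : 0 < η := lt_min hδ hc'
  have h2 : IntegrableOn (fun s => ‖φ s‖ ^ 2) (Ioo 0 η) :=
    h1.mono_set (Ioo_subset_Ioo_right (min_le_right _ _))
  have h3 : IntegrableOn (fun s : ℝ => c * s ^ r) (Ioo 0 η) := by
    refine Integrable.mono' h2 ?_ ?_
    · refine ContinuousOn.aestronglyMeasurable ?_ measurableSet_Ioo
      exact continuousOn_const.mul
        (continuousOn_id.rpow_const fun x hx => Or.inl (ne_of_gt hx.1))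
    · refine (ae_restrict_iff' measurableSet_Ioo).2 (Eventually.of_forall fun s hs => ?_)
      rw [Real.norm_of_nonneg (mul_nonneg hc.le (Real.rpow_nonneg hs.1.le _))]
      exact h s ⟨hs.1, hs.2.trans_le (min_le_left _ _)⟩
  have h4 : IntegrableOn (fun s : ℝ => s ^ r) (Ioo 0 η) := by
    have := h3.const_mul c⁻¹
    simpa only [inv_mul_cancel_left₀ hc.ne', IntegrableOn] using this
  have := (intervalIntegral.integrableOn_Ioo_rpow_iff hη).1 h4
  linarith

theorem memLp_of_le_rpow {φ : ℝ → ℂ} {r c δ : ℝ} (hr : -1 < r) (hδ : 0 < δ)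
    (hφ : ContinuousOn φ (Ioo 0 δ)) (h : ∀ s ∈ Ioo 0 δ, ‖φ s‖ ^ 2 ≤ c * s ^ r) :
    MemLp φ 2 (volume.restrict (Ioo 0 δ)) := by
  have hm := hφ.aestronglyMeasurable measurableSet_Ioo (μ := volume)
  rw [memLp_two_iff_integrable_sq_norm hm]
  have h4 : IntegrableOn (fun s : ℝ => c * s ^ r) (Ioo 0 δ) :=
    ((intervalIntegral.integrableOn_Ioo_rpow_iff hδ).2 hr).const_mul c
  refine Integrable.mono' h4 (hm.norm.pow 2) ?_
  refine (ae_restrict_iff' measurableSet_Ioo).2 (Eventually.of_forall fun s hs => ?_)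
  rw [Real.norm_of_nonneg (by positivity)]
  exact h s hs

section Criteria

variable {a : EReal} {b G : ℝ → ℝ}

theorem exp_log_mul_add {s : ℝ} (hs : 0 < s) (β C : ℝ) :
    Real.exp (β * Real.log s + C) = Real.exp C * s ^ β := by
  rw [Real.exp_add, Real.rpow_def_of_pos hs, mul_comm β, mul_comm]

/-- The solution `exp (G/2)` alone fails to be square integrable, since its square dominates a
multiple of `s ^ β`. No upper bound on `G` is needed. -/
theorem essSelfAdjointAtZero_of_le_neg_one
    (hb : ∀ s ∈ openInterval a, DifferentiableAt ℝ b s)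
    (hG : ∀ s ∈ openInterval a, HasDerivAt G (b s) s) {β C : ℝ} (hβ : β ≤ -1)
    (hlow : ∀ᶠ s in 𝓝[>] (0 : ℝ), β * Real.log s - C ≤ G s) :
    EssSelfAdjointAtZero a (potential b) := by
  intro h
  obtain ⟨c, hc, hL⟩ := h _ (isSolution_exp hb hG)
  obtain ⟨δ, hδ, hlow⟩ := exists_Ioo_of_eventually hlow
  refine not_memLp_of_rpow_le hβ (Real.exp_pos (-C)) hδ hc.1 (fun s hs => ?_) hL
  rw [Complex.norm_real, Real.norm_of_nonneg (Real.exp_pos _).le, ← Real.exp_nat_mul,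
    ← exp_log_mul_add hs.1]
  refine Real.exp_le_exp.2 ?_
  have := hlow s hs
  push_cast
  linarith

/-- Here the second solution fails. The upper bound on `G` makes `H` tend to `-∞` at least as fast
as `s ^ (1 - β)`; with the lower bound, the square of `exp (G/2) H` dominates `s ^ β s ^ (2 - 2β) =
s ^ (2 - β)`, and `2 - β ≤ -1`. -/
theorem essSelfAdjointAtZero_of_three_le (ha : 0 < a)
    (hb : ∀ s ∈ openInterval a, DifferentiableAt ℝ b s)
    (hG : ∀ s ∈ openInterval a, HasDerivAt G (b s) s) {β C : ℝ} (hβ : 3 ≤ β)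
    (hlow : ∀ᶠ s in 𝓝[>] (0 : ℝ), β * Real.log s - C ≤ G s)
    (hup : ∀ᶠ s in 𝓝[>] (0 : ℝ), G s ≤ β * Real.log s + C) :
    EssSelfAdjointAtZero a (potential b) := by
  intro h
  obtain ⟨H, hH⟩ := exists_primitive (a := a) (f := fun s => Real.exp (-G s))
    (fun s hs => ((hG s hs).neg.exp).continuousAt.continuousWithinAt)
  obtain ⟨c, hc, hL⟩ := h _ (isSolution_exp_mul hb hG hH)
  obtain ⟨δ, hδ, hall⟩ := exists_Ioo_of_eventually
    ((hlow.and hup).and (openInterval_mem_nhdsGT ha))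
  -- Chosen so that the derivative of `e s ^ (1 - β)` is exactly minus the lower bound `exp (-C) s ^
  -- (-β)` for `H'`.
  set e : ℝ := Real.exp (-C) / (β - 1) with he
  have hβ1 : 0 < β - 1 := by linarith
  have he0 : 0 < e := div_pos (Real.exp_pos _) hβ1
  have hmono : MonotoneOn (fun s => H s + e * s ^ (1 - β)) (Ioo 0 δ) := by
    have hd : ∀ s ∈ Ioo 0 δ, HasDerivAt (fun s => H s + e * s ^ (1 - β))
        (Real.exp (-G s) + e * ((1 - β) * s ^ (1 - β - 1))) s := fun s hs =>
      (hH s (hall s hs).2).add ((Real.hasDerivAt_rpow_const (Or.inl hs.1.ne')).const_mul e)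
    refine monotoneOn_of_deriv_nonneg (convex_Ioo 0 δ)
      (fun s hs => (hd s hs).continuousAt.continuousWithinAt) ?_ ?_
    · rw [interior_Ioo]; exact fun s hs => (hd s hs).differentiableAt.differentiableWithinAt
    · rw [interior_Ioo]
      intro s hs
      rw [(hd s hs).deriv]
      have h1 : Real.exp (-C) * s ^ (-β) ≤ Real.exp (-G s) := by
        rw [← exp_log_mul_add hs.1]
        exact Real.exp_le_exp.2 (by linarith [(hall s hs).1.2])
      have h2 : e * ((1 - β) * s ^ (1 - β - 1)) = -(Real.exp (-C) * s ^ (-β)) := by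
        rw [he, show (1 - β - 1) = -β by ring]
        field_simp
        ring
      linarith
  set s₀ := δ / 2
  have hs₀ : s₀ ∈ Ioo 0 δ := ⟨by positivity, by simp only [s₀]; linarith⟩
  set K := H s₀ + e * s₀ ^ (1 - β)
  -- The constant `K` depends on the primitive `H`; near `0` it is absorbed by half of the divergent
  -- term.
  have htend : Tendsto (fun s : ℝ => e / 2 * s ^ (1 - β)) (𝓝[>] 0) atTop :=
    (tendsto_rpow_neg_nhdsGT_zero (by linarith)).const_mul_atTop (by positivity)
  obtain ⟨δ', hδ', hall'⟩ := exists_Ioo_of_eventually (htend.eventually_ge_atTop K)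
  refine not_memLp_of_rpow_le (r := 2 - β) (c := Real.exp (-C) * (e / 2) ^ 2)
    (δ := min δ' s₀) (by linarith) (by positivity) (lt_min hδ' hs₀.1) hc.1 (fun s hs => ?_) hL
  have hs1 : s ∈ Ioo 0 δ := ⟨hs.1, (hs.2.trans_le (min_le_right _ _)).trans hs₀.2⟩
  have h1 := hmono hs1 hs₀ (hs.2.trans_le (min_le_right _ _)).le
  have h2 := hall' s ⟨hs.1, hs.2.trans_le (min_le_left _ _)⟩
  have h3 : e / 2 * s ^ (1 - β) ≤ |H s| := by
    refine le_trans ?_ (neg_le_abs _)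
    simp only at h1
    linarith
  have h4 : Real.exp (-C) * s ^ β ≤ Real.exp (G s) := by
    rw [← exp_log_mul_add hs.1]
    exact Real.exp_le_exp.2 (by linarith [(hall s hs1).1.1])
  rw [Complex.norm_real, norm_mul, mul_pow, Real.norm_of_nonneg (Real.exp_pos _).le,
    ← Real.exp_nat_mul, show ((2 : ℕ) : ℝ) * (G s / 2) = G s by push_cast; ring, Real.norm_eq_abs]
  have h5 : (e / 2 * s ^ (1 - β)) ^ 2 ≤ |H s| ^ 2 :=
    pow_le_pow_left₀ (mul_nonneg (by positivity) (Real.rpow_nonneg hs.1.le _)) h3 2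
  have h6 : s ^ (2 - β) = s ^ β * (s ^ (1 - β)) ^ 2 := by
    rw [← Real.rpow_mul_natCast hs.1.le, ← Real.rpow_add hs.1]
    congr 1; push_cast; ring
  calc Real.exp (-C) * (e / 2) ^ 2 * s ^ (2 - β)
      = (Real.exp (-C) * s ^ β) * (e / 2 * s ^ (1 - β)) ^ 2 := by rw [h6]; ring
    _ ≤ Real.exp (G s) * |H s| ^ 2 := mul_le_mul h4 h5 (by positivity) (Real.exp_pos _).le

/-- The two exponents may differ, because along a spiralling leaf `G` is only known up to a multiple
of `log s`. From `q > 1` one gets `H = O(s ^ (1 - q))`, a bound that also dominates constants, so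
every solution has square `O(s ^ (p + 2 - 2q))`; the condition `2q < p + 3` is the integrability of
this power. -/
theorem limitCircleAtZero_of_bounds (ha : 0 < a)
    (hb : ∀ s ∈ openInterval a, DifferentiableAt ℝ b s)
    (hG : ∀ s ∈ openInterval a, HasDerivAt G (b s) s) {p q C : ℝ} (hq : 1 < q)
    (hpq : 2 * q < p + 3)
    (hlow : ∀ᶠ s in 𝓝[>] (0 : ℝ), q * Real.log s - C ≤ G s)
    (hup : ∀ᶠ s in 𝓝[>] (0 : ℝ), G s ≤ p * Real.log s + C) :
    LimitCircleAtZero a (potential b) := by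
  intro φ hφ
  obtain ⟨H, hH⟩ := exists_primitive (a := a) (f := fun s => Real.exp (-G s))
    (fun s hs => ((hG s hs).neg.exp).continuousAt.continuousWithinAt)
  obtain ⟨A, B, hAB⟩ := hφ.eq_combination hb hG hH
  obtain ⟨φ', hφ'⟩ := hφ
  obtain ⟨δ, hδ, hall⟩ := exists_Ioo_of_eventually
    (((hlow.and hup).and (openInterval_mem_nhdsGT ha)).and (Ioo_mem_nhdsGT one_pos))
  set e : ℝ := Real.exp C / (q - 1) with he
  have hq1 : 0 < q - 1 := by linarith
  have he0 : 0 < e := div_pos (Real.exp_pos _) hq1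
  have hHle : ∀ s ∈ Ioo 0 δ, Real.exp (-G s) ≤ Real.exp C * s ^ (-q) := fun s hs => by
    rw [← exp_log_mul_add hs.1]
    exact Real.exp_le_exp.2 (by linarith [(hall s hs).1.1.1])
  have hHmono : MonotoneOn H (Ioo 0 δ) := by
    refine monotoneOn_of_deriv_nonneg (convex_Ioo 0 δ)
      (fun s hs => (hH s (hall s hs).1.2).continuousAt.continuousWithinAt) ?_ ?_
    · rw [interior_Ioo]
      exact fun s hs => (hH s (hall s hs).1.2).differentiableAt.differentiableWithinAt
    · rw [interior_Ioo]
      intro s hs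
      rw [(hH s (hall s hs).1.2).deriv]
      exact (Real.exp_pos _).le
  have hanti : AntitoneOn (fun s => H s + e * s ^ (1 - q)) (Ioo 0 δ) := by
    have hd : ∀ s ∈ Ioo 0 δ, HasDerivAt (fun s => H s + e * s ^ (1 - q))
        (Real.exp (-G s) + e * ((1 - q) * s ^ (1 - q - 1))) s := fun s hs =>
      (hH s (hall s hs).1.2).add ((Real.hasDerivAt_rpow_const (Or.inl hs.1.ne')).const_mul e)
    refine antitoneOn_of_deriv_nonpos (convex_Ioo 0 δ)
      (fun s hs => (hd s hs).continuousAt.continuousWithinAt) ?_ ?_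
    · rw [interior_Ioo]; exact fun s hs => (hd s hs).differentiableAt.differentiableWithinAt
    · rw [interior_Ioo]
      intro s hs
      rw [(hd s hs).deriv]
      have h2 : e * ((1 - q) * s ^ (1 - q - 1)) = -(Real.exp C * s ^ (-q)) := by
        rw [he, show (1 - q - 1) = -q by ring]
        field_simp
        ring
      linarith [hHle s hs]
  set s₀ := δ / 2
  have hs₀ : s₀ ∈ Ioo 0 δ := ⟨by positivity, by simp only [s₀]; linarith⟩
  set K := |H s₀| + e * s₀ ^ (1 - q)
  have hsub : Ioo 0 s₀ ⊆ Ioo 0 δ := Ioo_subset_Ioo_right hs₀.2.le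
  have hK : 0 ≤ K := add_nonneg (abs_nonneg _) (mul_nonneg he0.le (Real.rpow_nonneg hs₀.1.le _))
  refine ⟨s₀, (hall s₀ hs₀).1.2, memLp_of_le_rpow (r := p + 2 - 2 * q)
    (c := Real.exp C * (‖A‖ + ‖B‖ * (K + e)) ^ 2) (by linarith) hs₀.1
    (fun s hs => (hφ' s (hall s (hsub hs)).1.2).1.continuousAt.continuousWithinAt) fun s hs => ?_⟩
  have hs1 := hsub hs
  have hone : 1 ≤ s ^ (1 - q) :=
    Real.one_le_rpow_of_pos_of_le_one_of_nonpos hs.1 (hall s hs1).2.2.le (by linarith)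
  have hHb : |H s| ≤ (K + e) * s ^ (1 - q) := by
    have h1 := hHmono hs1 hs₀ hs.2.le
    have h2 := hanti hs1 hs₀ hs.2.le
    simp only at h2
    have h3 : K ≤ K * s ^ (1 - q) := le_mul_of_one_le_right hK hone
    have h4 : 0 ≤ e * s₀ ^ (1 - q) := mul_nonneg he0.le (Real.rpow_nonneg hs₀.1.le _)
    have h5 := neg_abs_le (H s₀)
    have h6 := le_abs_self (H s₀)
    have h7 : 0 ≤ e * s ^ (1 - q) := by positivity
    rw [abs_le]
    constructor <;> nlinarith
  rw [hAB s (hall s hs1).1.2, norm_mul, mul_pow, Complex.norm_real,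
    Real.norm_of_nonneg (Real.exp_pos _).le, ← Real.exp_nat_mul,
    show ((2 : ℕ) : ℝ) * (G s / 2) = G s by push_cast; ring]
  have h1 : Real.exp (G s) ≤ Real.exp C * s ^ p := by
    rw [← exp_log_mul_add hs.1]
    exact Real.exp_le_exp.2 (hall s hs1).1.1.2
  have h2 : ‖A + B * (H s : ℂ)‖ ≤ (‖A‖ + ‖B‖ * (K + e)) * s ^ (1 - q) := by
    calc ‖A + B * (H s : ℂ)‖ ≤ ‖A‖ + ‖B‖ * |H s| := by
          refine (norm_add_le _ _).trans ?_
          rw [norm_mul, Complex.norm_real, Real.norm_eq_abs]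
      _ ≤ ‖A‖ * s ^ (1 - q) + ‖B‖ * ((K + e) * s ^ (1 - q)) :=
          add_le_add (le_mul_of_one_le_right (norm_nonneg _) hone)
            (mul_le_mul_of_nonneg_left hHb (norm_nonneg _))
      _ = _ := by ring
  have h3 : s ^ (p + 2 - 2 * q) = s ^ p * (s ^ (1 - q)) ^ 2 := by
    rw [← Real.rpow_mul_natCast hs.1.le, ← Real.rpow_add hs.1]
    congr 1; push_cast; ring
  calc Real.exp (G s) * ‖A + B * (H s : ℂ)‖ ^ 2
      ≤ (Real.exp C * s ^ p) * ((‖A‖ + ‖B‖ * (K + e)) * s ^ (1 - q)) ^ 2 :=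
        mul_le_mul h1 (pow_le_pow_left₀ (norm_nonneg _) h2 2) (by positivity)
          (mul_nonneg (Real.exp_pos _).le (Real.rpow_nonneg hs.1.le _))
    _ = _ := by rw [h3]; ring

/-- If `exp (∫ b)` is comparable to `s ^ β`, then the limit point case holds exactly for `β ≤ -1`
and for `β ≥ 3`. -/
theorem essSelfAdjointAtZero_iff_of_log_asymptotics (ha : 0 < a)
    (hb : ∀ s ∈ openInterval a, DifferentiableAt ℝ b s)
    (hG : ∀ s ∈ openInterval a, HasDerivAt G (b s) s) {β C : ℝ}
    (h : ∀ᶠ s in 𝓝[>] (0 : ℝ), |G s - β * Real.log s| ≤ C) :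
    EssSelfAdjointAtZero a (potential b) ↔ β ≤ -1 ∨ 3 ≤ β := by
  have hlow : ∀ᶠ s in 𝓝[>] (0 : ℝ), β * Real.log s - C ≤ G s :=
    h.mono fun s hs => by linarith [(abs_le.1 hs).1]
  have hup : ∀ᶠ s in 𝓝[>] (0 : ℝ), G s ≤ β * Real.log s + C :=
    h.mono fun s hs => by linarith [(abs_le.1 hs).2]
  constructor
  · intro hE
    by_contra! hβ
    obtain ⟨h1, h2⟩ := hβ
    -- The exponent `q` of the lower bound has to satisfy `1 < q < (β + 3) / 2`. It may be raised
    -- since `log s ≤ 0`, and `(β + 5) / 4` is the midpoint of that interval, which is nonempty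
    -- because `β > -1`; when `β` is larger it serves itself, as `β < 3`.
    have hC : ∀ᶠ s in 𝓝[>] (0 : ℝ), max β ((β + 5) / 4) * Real.log s - C ≤ G s := by
      filter_upwards [hlow, Ioo_mem_nhdsGT one_pos] with s hs h01
      have := mul_le_mul_of_nonpos_right (le_max_left β ((β + 5) / 4))
        (Real.log_nonpos h01.1.le h01.2.le)
      linarith
    refine hE (limitCircleAtZero_of_bounds ha hb hG ?_ ?_ hC hup)
    · exact lt_max_of_lt_right (by linarith)
    · rcases max_cases β ((β + 5) / 4) with h | h <;> rw [h.1] <;> linarith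
  · rintro (h1 | h1)
    · exact essSelfAdjointAtZero_of_le_neg_one hb hG h1 hlow
    · exact essSelfAdjointAtZero_of_three_le ha hb hG h1 hlow hup

end Criteria

end ContactSR

namespace ContactSR

/-! ### Mean value estimates at `0⁺` -/

section MeanValue

variable {E : Type*} [NormedAddCommGroup E] [NormedSpace ℝ E]

theorem norm_sub_le_of_hasDerivAt_Ioo {f f' : ℝ → E} {K δ : ℝ}
    (hf : ∀ s ∈ Ioo 0 δ, HasDerivAt f (f' s) s) (hK : ∀ s ∈ Ioo 0 δ, ‖f' s‖ ≤ K)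
    {s t : ℝ} (hs : s ∈ Ioo 0 δ) (ht : t ∈ Ioo 0 δ) : ‖f s - f t‖ ≤ K * |s - t| :=
  (convex_Ioo 0 δ).norm_image_sub_le_of_norm_hasDerivWithin_le
    (fun x hx => (hf x hx).hasDerivWithinAt) hK ht hs

theorem eventually_norm_le_mul {f f' : ℝ → E} {K : ℝ}
    (hf : ∀ᶠ s in 𝓝[>] (0 : ℝ), HasDerivAt f (f' s) s)
    (hK : ∀ᶠ s in 𝓝[>] (0 : ℝ), ‖f' s‖ ≤ K) (h0 : Tendsto f (𝓝[>] 0) (𝓝 0)) :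
    ∀ᶠ s in 𝓝[>] (0 : ℝ), ‖f s‖ ≤ K * s := by
  obtain ⟨δ, hδ, h⟩ := exists_Ioo_of_eventually (hf.and hK)
  filter_upwards [Ioo_mem_nhdsGT hδ] with s hs
  have hl : Tendsto (fun t => ‖f s - f t‖) (𝓝[>] 0) (𝓝 ‖f s - 0‖) :=
    (tendsto_const_nhds.sub h0).norm
  have hr : Tendsto (fun t : ℝ => K * |s - t|) (𝓝[>] 0) (𝓝 (K * |s - 0|)) := by
    refine Tendsto.mono_left (Continuous.tendsto ?_ 0) nhdsWithin_le_nhds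
    fun_prop
  have := le_of_tendsto_of_tendsto hl hr (by
    filter_upwards [Ioo_mem_nhdsGT hδ] with t ht
    exact norm_sub_le_of_hasDerivAt_Ioo (fun s hs => (h s hs).1) (fun s hs => (h s hs).2) hs ht)
  simpa [abs_of_pos hs.1] using this

theorem eventually_abs_le_of_deriv_bounded {f f' : ℝ → ℝ} {K : ℝ}
    (hf : ∀ᶠ s in 𝓝[>] (0 : ℝ), HasDerivAt f (f' s) s)
    (hK : ∀ᶠ s in 𝓝[>] (0 : ℝ), |f' s| ≤ K) :
    ∃ C, ∀ᶠ s in 𝓝[>] (0 : ℝ), |f s| ≤ C := by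
  obtain ⟨δ, hδ, h⟩ := exists_Ioo_of_eventually (hf.and hK)
  have h2 : δ / 2 ∈ Ioo 0 δ := ⟨by positivity, by linarith⟩
  refine ⟨K * δ + |f (δ / 2)|, ?_⟩
  filter_upwards [Ioo_mem_nhdsGT hδ] with s hs
  have h1 := norm_sub_le_of_hasDerivAt_Ioo (fun s hs => (h s hs).1) (fun s hs => (h s hs).2) hs h2
  have hK0 : 0 ≤ K := (abs_nonneg _).trans (h s hs).2
  have h3 : |s - δ / 2| ≤ δ := by rw [abs_le]; constructor <;> linarith [hs.1, hs.2]
  have h4 : |f s| ≤ |f s - f (δ / 2)| + |f (δ / 2)| := by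
    simpa using abs_add_le (f s - f (δ / 2)) (f (δ / 2))
  rw [Real.norm_eq_abs] at h1
  linarith [mul_le_mul_of_nonneg_left h3 hK0]

theorem eventually_le_of_deriv_nonneg {f f' : ℝ → ℝ}
    (hf : ∀ᶠ s in 𝓝[>] (0 : ℝ), HasDerivAt f (f' s) s)
    (h0 : ∀ᶠ s in 𝓝[>] (0 : ℝ), 0 ≤ f' s) :
    ∃ C, ∀ᶠ s in 𝓝[>] (0 : ℝ), f s ≤ C := by
  obtain ⟨δ, hδ, h⟩ := exists_Ioo_of_eventually (hf.and h0)
  have h2 : δ / 2 ∈ Ioo 0 δ := ⟨by positivity, by linarith⟩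
  have hm : MonotoneOn f (Ioo 0 δ) := by
    refine monotoneOn_of_deriv_nonneg (convex_Ioo 0 δ)
      (fun s hs => (h s hs).1.continuousAt.continuousWithinAt) ?_ ?_
    · rw [interior_Ioo]
      exact fun s hs => (h s hs).1.differentiableAt.differentiableWithinAt
    · rw [interior_Ioo]
      intro s hs
      rw [(h s hs).1.deriv]
      exact (h s hs).2
  refine ⟨f (δ / 2), ?_⟩
  filter_upwards [Ioo_mem_nhdsGT h2.1] with s hs
  exact hm ⟨hs.1, hs.2.trans h2.2⟩ h2 hs.2.le

theorem eventually_nonneg_of_deriv_nonneg {f f' : ℝ → ℝ}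
    (hf : ∀ᶠ s in 𝓝[>] (0 : ℝ), HasDerivAt f (f' s) s)
    (h0 : ∀ᶠ s in 𝓝[>] (0 : ℝ), 0 ≤ f' s) (hlim : Tendsto f (𝓝[>] 0) (𝓝 0)) :
    ∀ᶠ s in 𝓝[>] (0 : ℝ), 0 ≤ f s := by
  obtain ⟨δ, hδ, h⟩ := exists_Ioo_of_eventually (hf.and h0)
  have hm : MonotoneOn f (Ioo 0 δ) := by
    refine monotoneOn_of_deriv_nonneg (convex_Ioo 0 δ)
      (fun s hs => (h s hs).1.continuousAt.continuousWithinAt) ?_ ?_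
    · rw [interior_Ioo]
      exact fun s hs => (h s hs).1.differentiableAt.differentiableWithinAt
    · rw [interior_Ioo]
      intro s hs
      rw [(h s hs).1.deriv]
      exact (h s hs).2
  filter_upwards [Ioo_mem_nhdsGT hδ] with s hs
  refine le_of_tendsto hlim ?_
  filter_upwards [Ioo_mem_nhdsGT hs.1] with t ht
  exact hm ⟨ht.1, ht.2.trans hs.2⟩ hs ht.2.le

/-- A continuous function without zeros near `0⁺` has a constant sign there. -/
theorem eventually_pos_or_neg {f : ℝ → ℝ} (hc : ∀ᶠ s in 𝓝[>] (0 : ℝ), ContinuousAt f s)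
    (h0 : ∀ᶠ s in 𝓝[>] (0 : ℝ), f s ≠ 0) :
    (∀ᶠ s in 𝓝[>] (0 : ℝ), 0 < f s) ∨ ∀ᶠ s in 𝓝[>] (0 : ℝ), f s < 0 := by
  obtain ⟨δ, hδ, h⟩ := exists_Ioo_of_eventually (hc.and h0)
  have hcont : ContinuousOn f (Ioo 0 δ) := fun s hs => (h s hs).1.continuousWithinAt
  have h2 : δ / 2 ∈ Ioo 0 δ := ⟨by positivity, by linarith⟩
  rcases lt_or_gt_of_ne (h _ h2).2 with hn | hp
  · right
    filter_upwards [Ioo_mem_nhdsGT hδ] with s hs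
    by_contra! hs'
    obtain ⟨t, ht, ht0⟩ := isPreconnected_Ioo.intermediate_value h2 hs hcont ⟨hn.le, hs'⟩
    exact (h t ht).2 ht0
  · left
    filter_upwards [Ioo_mem_nhdsGT hδ] with s hs
    by_contra! hs'
    obtain ⟨t, ht, ht0⟩ := isPreconnected_Ioo.intermediate_value hs h2 hcont ⟨hs', hp.le⟩
    exact (h t ht).2 ht0

/-- A function whose derivative is positive at its zeros is eventually of one sign at `0⁺`. -/
theorem eventually_neg_or_nonneg {f f' : ℝ → ℝ}
    (hf : ∀ᶠ s in 𝓝[>] (0 : ℝ), HasDerivAt f (f' s) s)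
    (h0 : ∀ᶠ s in 𝓝[>] (0 : ℝ), f s = 0 → 0 < f' s) :
    (∀ᶠ s in 𝓝[>] (0 : ℝ), f s < 0) ∨ ∀ᶠ s in 𝓝[>] (0 : ℝ), 0 ≤ f s := by
  obtain ⟨δ, hδ, h⟩ := exists_Ioo_of_eventually (hf.and h0)
  refine or_iff_not_imp_left.2 fun hn => ?_
  filter_upwards [Ioo_mem_nhdsGT hδ] with s hs
  -- Zeros are crossed upwards only, so nonnegativity at one point `t` propagates to the right; such
  -- points exist to the left of any given `s`.
  have hfr : ∃ᶠ t in 𝓝[>] (0 : ℝ), 0 ≤ f t := by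
    simpa only [Filter.Frequently, not_le] using hn
  obtain ⟨t, ht, ht'⟩ := (hfr.and_eventually (Ioo_mem_nhdsGT hs.1)).exists
  have hsub : Icc t s ⊆ Ioo 0 δ := fun x hx => ⟨ht'.1.trans_le hx.1, hx.2.trans_lt hs.2⟩
  have := image_le_of_deriv_right_lt_deriv_boundary (f := fun x => -f x) (f' := fun x => -f' x)
    (B := fun _ => 0) (B' := fun _ => 0) (a := t) (b := s)
    (fun x hx => ((h x (hsub hx)).1.neg).continuousAt.continuousWithinAt)
    (fun x hx => ((h x (hsub (Ico_subset_Icc_self hx))).1.neg).hasDerivWithinAt)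
    (by simpa using ht) (fun x => hasDerivAt_const x 0)
    (fun x hx hx0 => by
      have := (h x (hsub (Ico_subset_Icc_self hx))).2 (by simpa using hx0)
      simpa using this)
    (right_mem_Icc.2 ht'.2.le)
  simpa using this

end MeanValue

/-! ### Curves tangent to a singular vector field -/

section SingularCurve

variable {E : Type*} [NormedAddCommGroup E] [InnerProductSpace ℝ E]

/-- The curve `z` tends to the origin as `s → 0⁺`, with velocity `v` of asymptotically unit length,
and it is tangent to a vector field with linear part `B`, the factor of proportionality being `k`.
The function `b` agrees with `k` up to a relative error `O(‖z‖)`. -/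
structure IsSingularCurve (B : E →L[ℝ] E) (z v : ℝ → E) (k b : ℝ → ℝ) (C : ℝ) : Prop where
  hasDerivAt : ∀ᶠ s in 𝓝[>] (0 : ℝ), HasDerivAt z (v s) s
  continuousAt_velocity : ∀ᶠ s in 𝓝[>] (0 : ℝ), ContinuousAt v s
  continuousAt_factor : ∀ᶠ s in 𝓝[>] (0 : ℝ), ContinuousAt k s
  tendsto_zero : Tendsto z (𝓝[>] 0) (𝓝 0)
  tendsto_norm : Tendsto (fun s => ‖v s‖) (𝓝[>] 0) (𝓝 1)
  velocity : ∀ᶠ s in 𝓝[>] (0 : ℝ), ‖v s - k s • B (z s)‖ ≤ C * |k s| * ‖z s‖ ^ 2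
  drift : ∀ᶠ s in 𝓝[>] (0 : ℝ), |b s - k s| ≤ C * |k s| * ‖z s‖

namespace IsSingularCurve

variable {B : E →L[ℝ] E} {z v : ℝ → E} {k b G : ℝ → ℝ} {C d : ℝ}

/-- A negative constant would force `|k| ‖z‖² = 0`, hence zero velocity, against the speed tending
to `1`. -/
theorem nonneg_const (h : IsSingularCurve B z v k b C) : 0 ≤ C := by
  have hv : ∀ᶠ s in 𝓝[>] (0 : ℝ), 1 / 2 < ‖v s‖ := h.tendsto_norm.eventually_const_lt (by norm_num)
  obtain ⟨s, h1, h2⟩ := (h.velocity.and hv).exists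
  by_contra! hC
  have hkz : |k s| * ‖z s‖ ^ 2 = 0 := by
    have h3 : 0 ≤ C * (|k s| * ‖z s‖ ^ 2) := by
      rw [← mul_assoc]; exact (norm_nonneg _).trans h1
    have h4 : 0 ≤ |k s| * ‖z s‖ ^ 2 := by positivity
    nlinarith
  have h3 : k s • B (z s) = 0 := by
    rcases mul_eq_zero.1 hkz with h | h
    · rw [abs_eq_zero.1 h, zero_smul]
    · rw [norm_eq_zero.1 (pow_eq_zero_iff two_ne_zero |>.1 h), map_zero, smul_zero]
  rw [h3, sub_zero, mul_assoc, hkz, mul_zero] at h1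
  linarith

theorem norm_tendsto (h : IsSingularCurve B z v k b C) :
    Tendsto (fun s => ‖z s‖) (𝓝[>] 0) (𝓝 0) := by simpa using h.tendsto_zero.norm

theorem eventually_norm_lt (h : IsSingularCurve B z v k b C) {ε : ℝ} (hε : 0 < ε) :
    ∀ᶠ s in 𝓝[>] (0 : ℝ), ‖z s‖ < ε := h.norm_tendsto.eventually_lt_const hε

theorem norm_le_two_mul (h : IsSingularCurve B z v k b C) :
    ∀ᶠ s in 𝓝[>] (0 : ℝ), ‖z s‖ ≤ 2 * s :=
  eventually_norm_le_mul h.hasDerivAt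
    ((h.tendsto_norm.eventually_lt_const (show (1 : ℝ) < 2 by norm_num)).mono fun _ h => h.le)
    h.tendsto_zero

/-- A speed close to `1` has to be produced by `k B z` and its error, both of size `O(|k| ‖z‖)`. In
particular neither `k` nor `z` vanishes near `0`. -/
theorem factor_lower (h : IsSingularCurve B z v k b C) :
    ∃ c > 0, ∀ᶠ s in 𝓝[>] (0 : ℝ), c ≤ |k s| * ‖z s‖ := by
  have hC := h.nonneg_const
  refine ⟨(2 * (‖B‖ + C + 1))⁻¹, by positivity, ?_⟩
  filter_upwards [h.velocity, h.eventually_norm_lt one_pos,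
    h.tendsto_norm.eventually_const_lt (show (1 : ℝ) / 2 < 1 by norm_num)] with s h1 h2 h3
  have h4 : ‖v s‖ ≤ ‖v s - k s • B (z s)‖ + ‖k s • B (z s)‖ := by
    simpa using norm_add_le (v s - k s • B (z s)) (k s • B (z s))
  have h5 : ‖k s • B (z s)‖ ≤ |k s| * (‖B‖ * ‖z s‖) := by
    rw [norm_smul, Real.norm_eq_abs]
    exact mul_le_mul_of_nonneg_left (B.le_opNorm _) (abs_nonneg _)
  have h6 : C * |k s| * ‖z s‖ ^ 2 ≤ C * (|k s| * ‖z s‖) := by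
    rw [mul_assoc, sq, ← mul_assoc (|k s|)]
    exact mul_le_mul_of_nonneg_left (mul_le_of_le_one_right (by positivity) h2.le) hC
  rw [inv_le_iff_one_le_mul₀ (by positivity)]
  have h7 : 0 ≤ |k s| * ‖z s‖ := by positivity
  nlinarith

/-- This is where non-degeneracy enters. The relation `B (1 - B) = d` with `d ≠ 0` makes `B` bounded
below by `|d| / (1 + ‖B‖)`, so a bounded speed bounds `|k| ‖z‖`. -/
theorem factor_upper (h : IsSingularCurve B z v k b C) (hB : ∀ x, B (B x) = B x - d • x)
    (hd : d ≠ 0) : ∃ K > 0, ∀ᶠ s in 𝓝[>] (0 : ℝ), |k s| * ‖z s‖ ≤ K := by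
  have hC := h.nonneg_const
  set m := |d| / (1 + ‖B‖) with hm
  have hm0 : 0 < m := div_pos (abs_pos.2 hd) (by positivity)
  have hmB : ∀ x, m * ‖x‖ ≤ ‖B x‖ := fun x => by
    have h1 : d • x = B x - B (B x) := by rw [hB]; abel
    have h2 : |d| * ‖x‖ ≤ ‖B x‖ + ‖B‖ * ‖B x‖ := by
      rw [← Real.norm_eq_abs, ← norm_smul, h1]
      exact (norm_sub_le _ _).trans (by gcongr; exact B.le_opNorm _)
    rw [hm, div_mul_eq_mul_div, div_le_iff₀ (by positivity)]
    linarith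
  refine ⟨4 / m, by positivity, ?_⟩
  filter_upwards [h.velocity, h.eventually_norm_lt (show 0 < m / (2 * (C + 1)) by positivity),
    h.tendsto_norm.eventually_lt_const (show (1 : ℝ) < 2 by norm_num)] with s h1 h2 h3
  have h4 : ‖k s • B (z s)‖ ≤ ‖v s - k s • B (z s)‖ + ‖v s‖ := by
    rw [norm_sub_rev]
    simpa using norm_add_le (k s • B (z s) - v s) (v s)
  have h5 : |k s| * (m * ‖z s‖) ≤ ‖k s • B (z s)‖ := by
    rw [norm_smul, Real.norm_eq_abs]
    exact mul_le_mul_of_nonneg_left (hmB _) (abs_nonneg _)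
  have h6 : C * ‖z s‖ ≤ m / 2 := by
    rw [lt_div_iff₀ (by positivity)] at h2
    nlinarith [norm_nonneg (z s)]
  have h7 : 0 ≤ |k s| * ‖z s‖ := by positivity
  have h8 : C * |k s| * ‖z s‖ ^ 2 ≤ m / 2 * (|k s| * ‖z s‖) := by
    calc C * |k s| * ‖z s‖ ^ 2 = (C * ‖z s‖) * (|k s| * ‖z s‖) := by ring
      _ ≤ _ := mul_le_mul_of_nonneg_right h6 h7
  rw [le_div_iff₀ hm0]
  nlinarith

/-- With `|k| ‖z‖` bounded, the relative errors in the velocity and in the drift become absolute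
ones. After division by a component of `z` comparable to `‖z‖` they are bounded, so they change
logarithms and primitives by `O(1)` only. -/
theorem bounds (h : IsSingularCurve B z v k b C) (hB : ∀ x, B (B x) = B x - d • x)
    (hd : d ≠ 0) : ∃ K > 0, ∀ᶠ s in 𝓝[>] (0 : ℝ), |k s| * ‖z s‖ ≤ K ∧ |b s - k s| ≤ K ∧
      ‖v s - k s • B (z s)‖ ≤ K * ‖z s‖ := by
  obtain ⟨K, hK, hk⟩ := h.factor_upper hB hd
  have hC := h.nonneg_const
  refine ⟨(C + 1) * K, by positivity, ?_⟩
  filter_upwards [hk, h.velocity, h.drift] with s h1 h2 h3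
  refine ⟨by nlinarith, ?_, ?_⟩
  · refine h3.trans ?_
    rw [mul_assoc]
    nlinarith
  · refine h2.trans ?_
    calc C * |k s| * ‖z s‖ ^ 2 = (C * (|k s| * ‖z s‖)) * ‖z s‖ := by ring
      _ ≤ _ := mul_le_mul_of_nonneg_right (by nlinarith) (norm_nonneg _)

theorem factor_sign (h : IsSingularCurve B z v k b C) :
    (∀ᶠ s in 𝓝[>] (0 : ℝ), 0 < k s) ∨ ∀ᶠ s in 𝓝[>] (0 : ℝ), k s < 0 := by
  obtain ⟨c, hc, h1⟩ := h.factor_lower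
  refine eventually_pos_or_neg h.continuousAt_factor (h1.mono fun s hs h0 => ?_)
  rw [h0] at hs
  simp at hs
  linarith

theorem eventually_ne_zero (h : IsSingularCurve B z v k b C) :
    ∀ᶠ s in 𝓝[>] (0 : ℝ), 0 < ‖z s‖ := by
  obtain ⟨c, hc, h1⟩ := h.factor_lower
  refine h1.mono fun s hs => ?_
  rcases (norm_nonneg (z s)).eq_or_lt with h0 | h0
  · rw [← h0] at hs
    simp at hs
    linarith
  · exact h0

/-- The derivative of the squared length of the component of `z` along an eigenvalue `μ`. -/
theorem hasDerivAt_component (h : IsSingularCurve B z v k b C)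
    {P : E →L[ℝ] E} {μ : ℝ} (hP : ∀ x, P (B x) = μ • P x) :
    ∀ᶠ s in 𝓝[>] (0 : ℝ), ∃ r : ℝ, HasDerivAt (fun t => ‖P (z t)‖ ^ 2)
      (2 * k s * μ * ‖P (z s)‖ ^ 2 + r) s ∧
      |r| ≤ 2 * ‖P (z s)‖ * (‖P‖ * ‖v s - k s • B (z s)‖) := by
  filter_upwards [h.hasDerivAt] with s hs
  have h1 : HasDerivAt (fun t => P (z t)) (P (v s)) s := P.hasFDerivAt.comp_hasDerivAt s hs
  have h2 : P (v s) = (k s * μ) • P (z s) + P (v s - k s • B (z s)) := by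
    rw [map_sub, map_smul, hP, smul_smul]; abel
  refine ⟨2 * inner ℝ (P (z s)) (P (v s - k s • B (z s))), ?_, ?_⟩
  · refine h1.norm_sq.congr_deriv ?_
    rw [h2, inner_add_right, inner_smul_right, real_inner_self_eq_norm_sq]
    ring
  · rw [abs_mul, abs_two, mul_assoc]
    refine mul_le_mul_of_nonneg_left ?_ zero_le_two
    exact (abs_real_inner_le_norm _ _).trans
      (mul_le_mul_of_nonneg_left (P.le_opNorm _) (norm_nonneg _))

/-- If the velocity converges to an eigenvector, the primitive of `b` is `λ⁻¹ log s + O(1)`. -/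
theorem log_asymptotics (h : IsSingularCurve B z v k b C) (hB : ∀ x, B (B x) = B x - d • x)
    (hd : d ≠ 0) (hG : ∀ᶠ s in 𝓝[>] (0 : ℝ), HasDerivAt G (b s) s) {w : E} {lam : ℝ}
    (hw : w ≠ 0) (hBw : B w = lam • w) (hlam : lam ≠ 1 / 2) (hv : Tendsto v (𝓝[>] 0) (𝓝 w)) :
    lam ≠ 0 ∧ ∃ K, ∀ᶠ s in 𝓝[>] (0 : ℝ), |G s - lam⁻¹ * Real.log s| ≤ K := by
  have hchar : d = lam * (1 - lam) := by
    have h1 := hB w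
    rw [hBw, map_smul, hBw, smul_smul, ← sub_smul] at h1
    have := smul_left_injective ℝ hw h1
    linarith
  have hlam0 : lam ≠ 0 := by rintro rfl; simp at hchar; exact hd hchar
  refine ⟨hlam0, ?_⟩
  -- By Cayley–Hamilton `P` kills the eigenline of the other eigenvalue `1 - λ`, and `P w = (2λ - 1)
  -- w`, which is nonzero because `λ ≠ 1/2`.
  set P : E →L[ℝ] E := B - (1 - lam) • ContinuousLinearMap.id ℝ E with hPdef
  have hPx : ∀ x, P x = B x - (1 - lam) • x := fun x => by simp [hPdef]
  have hP : ∀ x, P (B x) = lam • P x := fun x => by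
    rw [hPx, hPx, hB, hchar, smul_sub, smul_smul]
    module
  have hPw : P w ≠ 0 := by
    rw [hPx, hBw, ← sub_smul]
    exact smul_ne_zero (fun h => hlam (by linarith)) hw
  have hPw0 : 0 < ‖P w‖ := norm_pos_iff.2 hPw
  obtain ⟨K, hK, hbd⟩ := h.bounds hB hd
  -- the curve is asymptotic to `s w`
  have hz : ∀ ε > 0, ∀ᶠ s in 𝓝[>] (0 : ℝ), ‖z s - s • w‖ ≤ ε * s := fun ε hε => by
    refine eventually_norm_le_mul (f' := fun s => v s - w) ?_ ?_ ?_
    · filter_upwards [h.hasDerivAt] with s hs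
      exact (hs.sub ((hasDerivAt_id s).smul_const w)).congr_deriv (by simp)
    · have h0 : Tendsto (fun s => ‖v s - w‖) (𝓝[>] 0) (𝓝 0) :=
        tendsto_iff_norm_sub_tendsto_zero.1 hv
      exact (h0.eventually_lt_const hε).mono fun s hs => hs.le
    · have h0 : Tendsto (fun s : ℝ => s • w) (𝓝[>] 0) (𝓝 ((0 : ℝ) • w)) :=
        ((continuous_id.smul continuous_const).tendsto 0).mono_left nhdsWithin_le_nhds
      simpa using h.tendsto_zero.sub h0
  set c := ‖P w‖ / 2 with hc
  have hc0 : 0 < c := by positivity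
  have hPz : ∀ᶠ s in 𝓝[>] (0 : ℝ), c * s ≤ ‖P (z s)‖ := by
    filter_upwards [hz (c / (‖P‖ + 1)) (by positivity), self_mem_nhdsWithin] with s hs hs0
    have hs0 : 0 < s := hs0
    have h1 : P (z s) = s • P w + P (z s - s • w) := by rw [map_sub, map_smul]; abel
    have h2 : ‖P (z s - s • w)‖ ≤ c * s := by
      refine (P.le_opNorm _).trans ?_
      calc ‖P‖ * ‖z s - s • w‖ ≤ (‖P‖ + 1) * (c / (‖P‖ + 1) * s) := by gcongr; linarith
        _ = c * s := by field_simp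
    have h3 : ‖s • P w‖ ≤ ‖P (z s)‖ + ‖P (z s - s • w)‖ := by
      rw [h1]
      simpa using norm_sub_le (s • P w + P (z s - s • w)) (P (z s - s • w))
    rw [norm_smul, Real.norm_of_nonneg hs0.le] at h3
    have : ‖P w‖ = 2 * c := by rw [hc]; ring
    rw [this] at h3
    linarith
  have hz2 := h.norm_le_two_mul
  have hcomp := h.hasDerivAt_component hP
  -- the auxiliary function has a bounded derivative
  have hf : ∀ᶠ s in 𝓝[>] (0 : ℝ), ∃ f' : ℝ,
      HasDerivAt (fun t => G t - (2 * lam)⁻¹ * Real.log (‖P (z t)‖ ^ 2)) f' s ∧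
      |f'| ≤ K + |(2 * lam)⁻¹| * (2 * ‖P‖ * K * 2 / c) := by
    filter_upwards [hbd, hPz, hz2, hcomp, hG, self_mem_nhdsWithin] with s h1 h2 h3 h4 h5 hs0
    have hs0 : 0 < s := hs0
    obtain ⟨r, hr, hr'⟩ := h4
    have hp : 0 < ‖P (z s)‖ := lt_of_lt_of_le (by positivity) h2
    have hp2 : ‖P (z s)‖ ^ 2 ≠ 0 := by positivity
    refine ⟨_, h5.sub ((hr.log hp2).const_mul _), ?_⟩
    -- The factor `(2λ)⁻¹` is chosen so that the main term `2 k λ` of the logarithmic derivative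
    -- becomes `k` and cancels against `b` up to `O(1)`.
    have h6 : b s - (2 * lam)⁻¹ * ((2 * k s * lam * ‖P (z s)‖ ^ 2 + r) / ‖P (z s)‖ ^ 2)
        = (b s - k s) - (2 * lam)⁻¹ * (r / ‖P (z s)‖ ^ 2) := by
      field_simp
      ring
    rw [h6]
    refine (abs_sub _ _).trans (add_le_add h1.2.1 ?_)
    rw [abs_mul]
    refine mul_le_mul_of_nonneg_left ?_ (abs_nonneg _)
    rw [abs_div, abs_of_pos (show 0 < ‖P (z s)‖ ^ 2 by positivity), div_le_div_iff₀ (by positivity)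
      hc0]
    have h7 : ‖z s‖ * c ≤ 2 * ‖P (z s)‖ := by nlinarith
    calc |r| * c ≤ 2 * ‖P (z s)‖ * (‖P‖ * (K * ‖z s‖)) * c := by
          gcongr
          exact hr'.trans (by gcongr; exact h1.2.2)
      _ = 2 * ‖P (z s)‖ * ‖P‖ * K * (‖z s‖ * c) := by ring
      _ ≤ 2 * ‖P (z s)‖ * ‖P‖ * K * (2 * ‖P (z s)‖) := by gcongr
      _ = _ := by ring
  have hfd : ∀ᶠ s in 𝓝[>] (0 : ℝ),
      HasDerivAt (fun t => G t - (2 * lam)⁻¹ * Real.log (‖P (z t)‖ ^ 2))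
        (deriv (fun t => G t - (2 * lam)⁻¹ * Real.log (‖P (z t)‖ ^ 2)) s) s :=
    hf.mono fun s ⟨f', h1, _⟩ => h1.differentiableAt.hasDerivAt
  obtain ⟨K1, hK1⟩ := eventually_abs_le_of_deriv_bounded hfd
    (hf.mono fun s ⟨f', h1, h2⟩ => by rw [h1.deriv]; exact h2)
  refine ⟨K1 + |lam⁻¹| * (|Real.log c| + |Real.log (2 * (‖P‖ + 1))|), ?_⟩
  filter_upwards [hK1, hPz, hz2, self_mem_nhdsWithin] with s h1 h2 h3 hs0
  have hs0 : 0 < s := hs0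
  have hp : 0 < ‖P (z s)‖ := lt_of_lt_of_le (by positivity) h2
  have h4 : ‖P (z s)‖ ≤ 2 * (‖P‖ + 1) * s := by
    refine (P.le_opNorm _).trans ?_
    have := norm_nonneg P
    nlinarith
  have h5 : Real.log c + Real.log s ≤ Real.log ‖P (z s)‖ := by
    rw [← Real.log_mul hc0.ne' hs0.ne']
    exact Real.log_le_log (by positivity) h2
  have h6 : Real.log ‖P (z s)‖ ≤ Real.log (2 * (‖P‖ + 1)) + Real.log s := by
    rw [← Real.log_mul (by positivity) hs0.ne']
    exact Real.log_le_log hp h4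
  have h7 : |Real.log ‖P (z s)‖ - Real.log s| ≤ |Real.log c| + |Real.log (2 * (‖P‖ + 1))| := by
    rw [abs_le]
    have := neg_abs_le (Real.log c)
    have := abs_nonneg (Real.log c)
    have := le_abs_self (Real.log (2 * (‖P‖ + 1)))
    have := abs_nonneg (Real.log (2 * (‖P‖ + 1)))
    constructor <;> linarith
  have h8 : G s - lam⁻¹ * Real.log s
      = (G s - (2 * lam)⁻¹ * Real.log (‖P (z s)‖ ^ 2))
        + lam⁻¹ * (Real.log ‖P (z s)‖ - Real.log s) := by
    rw [Real.log_pow]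
    push_cast
    field_simp
    ring
  rw [h8]
  refine (abs_add_le _ _).trans (add_le_add h1 ?_)
  rw [abs_mul]
  exact mul_le_mul_of_nonneg_left h7 (abs_nonneg _)

end IsSingularCurve

end SingularCurve

end ContactSR

/-! ### Spirals, cones and the existence of tangents of singular curves -/

namespace ContactSR

namespace IsSingularCurve

variable {E : Type*} [NormedAddCommGroup E] [InnerProductSpace ℝ E]
  {B : E →L[ℝ] E} {z v : ℝ → E} {k b G : ℝ → ℝ} {C d : ℝ}

/-- Growth estimates when the eigenvalues of `B` are not real and distinct. -/
theorem rough_asymptotics (h : IsSingularCurve B z v k b C) (hB : ∀ x, B (B x) = B x - d • x)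
    (hd : 1 / 4 ≤ d) (hG : ∀ᶠ s in 𝓝[>] (0 : ℝ), HasDerivAt G (b s) s) :
    ∃ K, ∀ᶠ s in 𝓝[>] (0 : ℝ),
      (11 / 5 : ℝ) * Real.log s - K ≤ G s ∧ G s ≤ (9 / 5 : ℝ) * Real.log s + K := by
  have hd0 : d ≠ 0 := by linarith
  have hC := h.nonneg_const
  -- The trace-free part of `B`, whose square is the scalar `-(d - 1/4) ≤ 0`.
  set N : E →L[ℝ] E := B - (1 / 2 : ℝ) • ContinuousLinearMap.id ℝ E with hN
  have hNx : ∀ x, N x = B x - (1 / 2 : ℝ) • x := fun x => by simp [hN]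
  have hBx : ∀ x, B x = (1 / 2 : ℝ) • x + N x := fun x => by rw [hNx]; abel
  have hNN : ∀ x, N (N x) = (-(d - 1 / 4)) • x := fun x => by
    rw [hNx, hNx, map_sub, hB, map_smul]
    module
  -- the parameter of the adapted quadratic form
  obtain ⟨κ, hκ, hκd⟩ : ∃ κ : ℝ, 0 < κ ∧ |κ ^ 2 - (d - 1 / 4)| ≤ 1 / 40 * κ := by
    -- For `d > 1/4`, taking `κ² = d - 1/4` makes `N` skew for the form `‖N x‖² + κ² ‖x‖²`, so that
    -- the linear field `B` expands it exactly at rate `1`. For `d = 1/4` this `κ` would be `0` and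
    -- the form degenerate; a small positive `κ` costs a relative error of at most `κ`.
    rcases hd.eq_or_lt with h0 | h0
    · refine ⟨1 / 40, by norm_num, ?_⟩
      rw [← h0]; norm_num
    · refine ⟨√(d - 1 / 4), Real.sqrt_pos.2 (by linarith), ?_⟩
      rw [Real.sq_sqrt (by linarith), sub_self, abs_zero]
      positivity
  set r : ℝ → ℝ := fun s => ‖N (z s)‖ ^ 2 + κ ^ 2 * ‖z s‖ ^ 2 with hr
  set r' : ℝ → ℝ := fun s => 2 * inner ℝ (N (z s)) (N (v s)) + κ ^ 2 * (2 * inner ℝ (z s) (v s))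
    with hr'
  have hrd : ∀ᶠ s in 𝓝[>] (0 : ℝ), HasDerivAt r (r' s) s := by
    filter_upwards [h.hasDerivAt] with s hs
    have h1 : HasDerivAt (fun t => N (z t)) (N (v s)) s := N.hasFDerivAt.comp_hasDerivAt s hs
    exact h1.norm_sq.add (hs.norm_sq.const_mul _)
  have hrlow : ∀ s, κ ^ 2 * ‖z s‖ ^ 2 ≤ r s := fun s => le_add_of_nonneg_left (by positivity)
  have hrup : ∀ s, r s ≤ (‖N‖ ^ 2 + κ ^ 2) * ‖z s‖ ^ 2 := fun s => by
    rw [add_mul, hr]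
    have := pow_le_pow_left₀ (norm_nonneg _) (N.le_opNorm (z s)) 2
    rw [mul_pow] at this
    simpa using this
  have hrpos : ∀ᶠ s in 𝓝[>] (0 : ℝ), 0 < r s := by
    filter_upwards [h.eventually_ne_zero] with s hs
    exact lt_of_lt_of_le (by positivity) (hrlow s)
  -- One half of the tolerance `1/20` pays for the choice of `κ`, the other half for the quadratic
  -- error of the velocity, which is small as `z → 0`.
  have hmain : ∀ᶠ s in 𝓝[>] (0 : ℝ), |r' s - k s * r s| ≤ 1 / 20 * |k s| * r s := by
    set A := 2 * (‖N‖ ^ 2 + κ ^ 2) * C with hA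
    have hA0 : 0 ≤ A := by positivity
    filter_upwards [h.velocity, h.eventually_norm_lt (show 0 < κ ^ 2 / 40 / (A + 1) by positivity)]
      with s h1 h2
    set e := v s - k s • B (z s) with he
    have hv : v s = k s • ((1 / 2 : ℝ) • z s + N (z s)) + e := by rw [he, ← hBx]; abel
    have hNv : N (v s) = k s • ((1 / 2 : ℝ) • N (z s) + (-(d - 1 / 4)) • z s) + N e := by
      rw [hv, map_add, map_smul, map_add, map_smul, hNN]
    have h3 : r' s - k s * r s = k s * (2 * (κ ^ 2 - (d - 1 / 4)) * inner ℝ (z s) (N (z s)))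
        + (2 * inner ℝ (N (z s)) (N e) + κ ^ 2 * (2 * inner ℝ (z s) e)) := by
      simp only [hr', hr]
      rw [hNv, hv]
      simp only [inner_add_right, inner_smul_right, real_inner_self_eq_norm_sq]
      rw [real_inner_comm (z s) (N (z s))]
      ring
    have h4 : 2 * κ * |inner ℝ (z s) (N (z s))| ≤ r s := by
      have := abs_real_inner_le_norm (z s) (N (z s))
      simp only [hr]
      nlinarith [sq_nonneg (‖N (z s)‖ - κ * ‖z s‖)]
    have h5 : |k s * (2 * (κ ^ 2 - (d - 1 / 4)) * inner ℝ (z s) (N (z s)))|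
        ≤ |k s| * (1 / 40 * r s) := by
      rw [abs_mul, abs_mul, abs_mul, abs_two]
      refine mul_le_mul_of_nonneg_left ?_ (abs_nonneg _)
      nlinarith [abs_nonneg (inner ℝ (z s) (N (z s)))]
    have h6 : |2 * inner ℝ (N (z s)) (N e) + κ ^ 2 * (2 * inner ℝ (z s) e)|
        ≤ 2 * (‖N‖ ^ 2 + κ ^ 2) * (‖z s‖ * ‖e‖) := by
      have h7 : |inner ℝ (N (z s)) (N e)| ≤ ‖N‖ ^ 2 * (‖z s‖ * ‖e‖) := by
        refine (abs_real_inner_le_norm _ _).trans ?_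
        calc ‖N (z s)‖ * ‖N e‖ ≤ (‖N‖ * ‖z s‖) * (‖N‖ * ‖e‖) := by
              gcongr <;> exact N.le_opNorm _
          _ = _ := by ring
      have h8 := abs_real_inner_le_norm (z s) e
      refine (abs_add_le _ _).trans ?_
      rw [abs_mul, abs_mul, abs_mul, abs_two, abs_of_pos (show 0 < κ ^ 2 by positivity)]
      nlinarith [sq_nonneg κ]
    have h7 : 2 * (‖N‖ ^ 2 + κ ^ 2) * (‖z s‖ * ‖e‖) ≤ |k s| * (1 / 40 * r s) := by
      have h8 : A * ‖z s‖ ≤ κ ^ 2 / 40 := by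
        rw [lt_div_iff₀ (by positivity)] at h2
        nlinarith [norm_nonneg (z s)]
      calc 2 * (‖N‖ ^ 2 + κ ^ 2) * (‖z s‖ * ‖e‖)
          ≤ 2 * (‖N‖ ^ 2 + κ ^ 2) * (‖z s‖ * (C * |k s| * ‖z s‖ ^ 2)) := by gcongr
        _ = |k s| * ((A * ‖z s‖) * ‖z s‖ ^ 2) := by rw [hA]; ring
        _ ≤ |k s| * ((κ ^ 2 / 40) * ‖z s‖ ^ 2) := by gcongr
        _ ≤ |k s| * (1 / 40 * r s) :=
            mul_le_mul_of_nonneg_left (by linarith [hrlow s]) (abs_nonneg _)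
    rw [h3]
    refine (abs_add_le _ _).trans ?_
    linarith
  have hrlim : Tendsto r (𝓝[>] 0) (𝓝 0) := by
    have h1 : Tendsto (fun s => (‖N‖ ^ 2 + κ ^ 2) * ‖z s‖ ^ 2) (𝓝[>] 0) (𝓝 0) := by
      simpa using (h.norm_tendsto.pow 2).const_mul (‖N‖ ^ 2 + κ ^ 2)
    exact squeeze_zero (fun s => (by positivity : 0 ≤ κ ^ 2 * ‖z s‖ ^ 2).trans (hrlow s)) hrup h1
  -- Both eigenvalues have real part `1/2`, so the field repels from the origin. With `k < 0` the
  -- positive function `r` would decrease in `s`, although it tends to `0` at `0⁺`.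
  have hkpos : ∀ᶠ s in 𝓝[>] (0 : ℝ), 0 < k s := by
    refine h.factor_sign.resolve_right fun hneg => ?_
    have h1 : ∀ᶠ s in 𝓝[>] (0 : ℝ), 0 ≤ -r s := by
      refine eventually_nonneg_of_deriv_nonneg (f' := fun s => -r' s)
        (hrd.mono fun s hs => hs.neg) ?_ (by simpa using hrlim.neg)
      filter_upwards [hneg, hmain, hrpos] with s h2 h3 h4
      rw [abs_of_neg h2] at h3
      have := (abs_le.1 h3).2
      nlinarith [mul_pos (neg_pos.2 h2) h4]
    obtain ⟨s, h2, h3⟩ := (h1.and hrpos).exists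
    linarith
  have hb : ∀ᶠ s in 𝓝[>] (0 : ℝ), |b s - k s| ≤ 1 / 100 * k s := by
    filter_upwards [h.drift, hkpos, h.eventually_norm_lt (show 0 < 1 / 100 / (C + 1) by positivity)]
      with s h1 h2 h3
    refine h1.trans ?_
    rw [abs_of_pos h2]
    rw [lt_div_iff₀ (by positivity)] at h3
    nlinarith [norm_nonneg (z s)]
  have hlog : ∀ᶠ s in 𝓝[>] (0 : ℝ), HasDerivAt (fun t => Real.log (r t)) (r' s / r s) s := by
    filter_upwards [hrd, hrpos] with s h1 h2 using h1.log h2.ne'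
  have hlogb : ∀ᶠ s in 𝓝[>] (0 : ℝ),
      19 / 20 * k s ≤ r' s / r s ∧ r' s / r s ≤ 21 / 20 * k s := by
    filter_upwards [hmain, hrpos, hkpos] with s h1 h2 h3
    rw [abs_of_pos h3] at h1
    rw [le_div_iff₀ h2, div_le_iff₀ h2]
    constructor <;> nlinarith [(abs_le.1 h1).1, (abs_le.1 h1).2]
  -- The logarithmic derivative of `r` is `k` within 5% and `b` is `k` within 1%, so `b` lies
  -- between `9/10` and `11/10` of it, and both differences below are monotone. Since `r` is
  -- comparable to `s²`, these factors give the exponents `9/5` and `11/5`.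
  obtain ⟨K1, hK1⟩ := eventually_le_of_deriv_nonneg
    (f := fun s => G s - 9 / 10 * Real.log (r s)) (f' := fun s => b s - 9 / 10 * (r' s / r s))
    (by filter_upwards [hG, hlog] with s h1 h2 using h1.sub (h2.const_mul _))
    (by filter_upwards [hb, hlogb, hkpos] with s h1 h2 h3
        linarith [(abs_le.1 h1).1, h2.2])
  obtain ⟨K2, hK2⟩ := eventually_le_of_deriv_nonneg
    (f := fun s => 11 / 10 * Real.log (r s) - G s) (f' := fun s => 11 / 10 * (r' s / r s) - b s)
    (by filter_upwards [hG, hlog] with s h1 h2 using (h2.const_mul _).sub h1)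
    (by filter_upwards [hb, hlogb, hkpos] with s h1 h2 h3
        linarith [(abs_le.1 h1).2, h2.1])
  -- lower bound for `√r`
  obtain ⟨c, hc, hkz⟩ := h.factor_lower
  -- The derivative of `√r` is `½ (r'/r) √r ≥ ½ · (19/20) k · κ ‖z‖`, and `k ‖z‖ ≥ c`.
  set c1 := 19 / 40 * κ * c with hc1
  have hc10 : 0 < c1 := by positivity
  have hsq : ∀ᶠ s in 𝓝[>] (0 : ℝ), 0 ≤ √(r s) - c1 * s := by
    refine eventually_nonneg_of_deriv_nonneg (f' := fun s => r' s / (2 * √(r s)) - c1) ?_ ?_ ?_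
    · filter_upwards [hrd, hrpos] with s h1 h2
      refine ((h1.sqrt h2.ne').sub ((hasDerivAt_id s).const_mul c1)).congr_deriv (by simp)
    · filter_upwards [hlogb, hrpos, hkz, hkpos] with s h1 h2 h3 h4
      rw [abs_of_pos h4] at h3
      have h5 : 0 < √(r s) := Real.sqrt_pos.2 h2
      have h6 : κ * ‖z s‖ ≤ √(r s) := by
        refine Real.le_sqrt_of_sq_le ?_
        rw [mul_pow]; exact hrlow s
      have h7 : r' s / (2 * √(r s)) = 1 / 2 * (r' s / r s) * √(r s) := by
        conv_rhs => rw [← Real.sq_sqrt h2.le]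
        rw [Real.sqrt_sq h5.le]
        field_simp
      rw [h7, sub_nonneg]
      calc c1 ≤ 19 / 40 * κ * (k s * ‖z s‖) := by rw [hc1]; gcongr
        _ = 1 / 2 * (19 / 20 * k s) * (κ * ‖z s‖) := by ring
        _ ≤ 1 / 2 * (r' s / r s) * √(r s) := by
            gcongr
            · exact mul_nonneg (by norm_num) (le_trans (by positivity) h1.1)
            · exact h1.1
    · have h1 : Tendsto (fun s : ℝ => c1 * s) (𝓝[>] 0) (𝓝 (c1 * 0)) :=
        ((continuous_const.mul continuous_id).tendsto 0).mono_left nhdsWithin_le_nhds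
      simpa using hrlim.sqrt.sub h1
  set c2 := 4 * (‖N‖ ^ 2 + κ ^ 2) with hc2
  have hc20 : 0 < c2 := by positivity
  have hlogr : ∀ᶠ s in 𝓝[>] (0 : ℝ), 2 * Real.log c1 + 2 * Real.log s ≤ Real.log (r s) ∧
      Real.log (r s) ≤ Real.log c2 + 2 * Real.log s := by
    filter_upwards [hsq, hrpos, h.norm_le_two_mul, self_mem_nhdsWithin] with s h1 h2 h3 hs0
    have hs0 : 0 < s := hs0
    have h4 : (c1 * s) ^ 2 ≤ r s := (Real.le_sqrt' (by positivity)).1 (by linarith)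
    have h5 : r s ≤ c2 * s ^ 2 := by
      refine (hrup s).trans ?_
      have := pow_le_pow_left₀ (norm_nonneg _) h3 2
      rw [hc2]
      nlinarith [sq_nonneg ‖N‖, sq_nonneg κ]
    have h6 := Real.log_le_log (by positivity) h4
    have h7 := Real.log_le_log h2 h5
    rw [Real.log_pow, Real.log_mul hc10.ne' hs0.ne'] at h6
    rw [Real.log_mul hc20.ne' (by positivity), Real.log_pow] at h7
    push_cast at h6 h7
    constructor <;> linarith
  refine ⟨max (K1 + 9 / 10 * Real.log c2) (K2 - 11 / 5 * Real.log c1), ?_⟩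
  filter_upwards [hK1, hK2, hlogr] with s h1 h2 h3
  have h4 := le_max_left (K1 + 9 / 10 * Real.log c2) (K2 - 11 / 5 * Real.log c1)
  have h5 := le_max_right (K1 + 9 / 10 * Real.log c2) (K2 - 11 / 5 * Real.log c1)
  constructor <;> linarith [h3.1, h3.2]

theorem norm_le_components {P Q : E →L[ℝ] E} {μ ν : ℝ}
    (hdec : ∀ x, (ν - μ) • x = Q x - P x) (x : E) : |ν - μ| * ‖x‖ ≤ ‖Q x‖ + ‖P x‖ := by
  rw [← Real.norm_eq_abs, ← norm_smul, hdec]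
  exact norm_sub_le _ _

/-- Every cone around an eigenline is eventually entered or eventually left. -/
theorem cone_dichotomy (h : IsSingularCurve B z v k b C)
    {P Q : E →L[ℝ] E} {μ ν : ℝ} (hPB : ∀ x, P (B x) = μ • P x) (hQB : ∀ x, Q (B x) = ν • Q x)
    (hdec : ∀ x, (ν - μ) • x = Q x - P x) (hk : ∀ᶠ s in 𝓝[>] (0 : ℝ), 0 < k s * (ν - μ))
    {K : ℝ} (hK : 0 < K) :
    (∀ᶠ s in 𝓝[>] (0 : ℝ), ‖Q (z s)‖ ^ 2 - K * ‖P (z s)‖ ^ 2 < 0) ∨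
      ∀ᶠ s in 𝓝[>] (0 : ℝ), 0 ≤ ‖Q (z s)‖ ^ 2 - K * ‖P (z s)‖ ^ 2 := by
  have hC := h.nonneg_const
  have hne : ν - μ ≠ 0 := by
    obtain ⟨s, hs⟩ := hk.exists
    exact right_ne_zero_of_mul hs.ne'
  have hnorm := norm_le_components hdec
  have habs : ∀ᶠ s in 𝓝[>] (0 : ℝ), k s * (ν - μ) = |k s| * |ν - μ| := by
    filter_upwards [hk] with s hs
    rw [← abs_mul, abs_of_pos hs]
  have hgap : 0 < |ν - μ| := abs_pos.2 hne
  obtain ⟨c, hc, hkz⟩ := h.factor_lower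
  set f : ℝ → ℝ := fun s => ‖Q (z s)‖ ^ 2 - K * ‖P (z s)‖ ^ 2 with hf
  set A := 2 * (‖Q‖ ^ 2 + K * ‖P‖ ^ 2) * C with hA
  have hA0 : 0 ≤ A := by positivity
  -- On the boundary of the cone both components are comparable to `‖z‖`. There the linear part
  -- contributes `2 k (ν - μ) ‖Q z‖² ≥ c0 |k| ‖z‖²` to the derivative, while the error is at most `A
  -- |k| ‖z‖³`; so the boundary can be crossed in one direction only.
  set c0 := |ν - μ| ^ 3 * K / (K + 1) with hc0
  have hc00 : 0 < c0 := by positivity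
  have key : ∀ᶠ s in 𝓝[>] (0 : ℝ), ∃ f', HasDerivAt f f' s ∧ (f s = 0 → 0 < f') := by
    filter_upwards [h.hasDerivAt_component hQB, h.hasDerivAt_component hPB, h.velocity, habs, hkz,
      h.eventually_norm_lt (show 0 < c0 / (A + 1) by positivity), h.eventually_ne_zero]
      with s ⟨r1, h1, h1'⟩ ⟨r2, h2, h2'⟩ h3 h4 h5 h6 h7
    refine ⟨_, h1.sub (h2.const_mul K), fun h0 => ?_⟩
    have hPle := P.le_opNorm (z s)
    have hQle := Q.le_opNorm (z s)
    have hkpos : 0 < |k s| := by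
      by_contra! hk0
      have : |k s| = 0 := le_antisymm hk0 (abs_nonneg _)
      rw [this, zero_mul] at h5
      linarith
    have h8 : |r1| ≤ 2 * ‖Q‖ ^ 2 * C * |k s| * ‖z s‖ ^ 3 := by
      refine h1'.trans ?_
      calc 2 * ‖Q (z s)‖ * (‖Q‖ * ‖v s - k s • B (z s)‖)
          ≤ 2 * (‖Q‖ * ‖z s‖) * (‖Q‖ * (C * |k s| * ‖z s‖ ^ 2)) := by gcongr
        _ = _ := by ring
    have h9 : |r2| ≤ 2 * ‖P‖ ^ 2 * C * |k s| * ‖z s‖ ^ 3 := by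
      refine h2'.trans ?_
      calc 2 * ‖P (z s)‖ * (‖P‖ * ‖v s - k s • B (z s)‖)
          ≤ 2 * (‖P‖ * ‖z s‖) * (‖P‖ * (C * |k s| * ‖z s‖ ^ 2)) := by gcongr
        _ = _ := by ring
    have h10 : r1 - K * r2 ≥ -(A * |k s| * ‖z s‖ ^ 3) := by
      rw [hA]
      nlinarith [neg_abs_le r1, le_abs_self r2, mul_le_mul_of_nonneg_left h9 hK.le]
    have h11 : ‖Q (z s)‖ ^ 2 = K * ‖P (z s)‖ ^ 2 := by
      simp only [hf] at h0; linarith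
    have h12 : |ν - μ| ^ 2 * ‖z s‖ ^ 2 ≤ 2 * (‖Q (z s)‖ ^ 2 + ‖P (z s)‖ ^ 2) := by
      have := pow_le_pow_left₀ (by positivity) (hnorm (z s)) 2
      nlinarith [sq_nonneg (‖Q (z s)‖ - ‖P (z s)‖)]
    have h13 : 2 * k s * ν * ‖Q (z s)‖ ^ 2 + r1 - K * (2 * k s * μ * ‖P (z s)‖ ^ 2 + r2)
        = 2 * (|k s| * |ν - μ|) * ‖Q (z s)‖ ^ 2 + (r1 - K * r2) := by
      rw [← h4]
      linear_combination (2 * k s * μ) * h11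
    have h14 : c0 * ‖z s‖ ^ 2 ≤ 2 * |ν - μ| * ‖Q (z s)‖ ^ 2 := by
      have h15 : K * (‖Q (z s)‖ ^ 2 + ‖P (z s)‖ ^ 2) = (K + 1) * ‖Q (z s)‖ ^ 2 := by
        rw [mul_add, ← h11]; ring
      rw [hc0, div_mul_eq_mul_div, div_le_iff₀ (by positivity)]
      calc |ν - μ| ^ 3 * K * ‖z s‖ ^ 2 = |ν - μ| * K * (|ν - μ| ^ 2 * ‖z s‖ ^ 2) := by ring
        _ ≤ |ν - μ| * K * (2 * (‖Q (z s)‖ ^ 2 + ‖P (z s)‖ ^ 2)) := by gcongr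
        _ = 2 * |ν - μ| * (K * (‖Q (z s)‖ ^ 2 + ‖P (z s)‖ ^ 2)) := by ring
        _ = _ := by rw [h15]; ring
    have h16 : A * ‖z s‖ < c0 := by
      rw [lt_div_iff₀ (by positivity)] at h6
      nlinarith
    rw [h13]
    have h17 : A * |k s| * ‖z s‖ ^ 3 < |k s| * (2 * |ν - μ| * ‖Q (z s)‖ ^ 2) := by
      calc A * |k s| * ‖z s‖ ^ 3 = |k s| * ((A * ‖z s‖) * ‖z s‖ ^ 2) := by ring
        _ < |k s| * (c0 * ‖z s‖ ^ 2) := by gcongr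
        _ ≤ _ := by gcongr
    linarith
  refine eventually_neg_or_nonneg (f' := deriv f) ?_ ?_
  · exact key.mono fun s ⟨f', h1, _⟩ => h1.differentiableAt.hasDerivAt
  · exact key.mono fun s ⟨f', h1, h2⟩ => by rw [h1.deriv]; exact h2

/-- The two components of the curve are not comparable. -/
theorem not_comparable (h : IsSingularCurve B z v k b C)
    (hB : ∀ x, B (B x) = B x - d • x) (hd : d ≠ 0)
    {P Q : E →L[ℝ] E} {μ ν : ℝ} (hPB : ∀ x, P (B x) = μ • P x) (hQB : ∀ x, Q (B x) = ν • Q x)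
    (hdec : ∀ x, (ν - μ) • x = Q x - P x) (hk : ∀ᶠ s in 𝓝[>] (0 : ℝ), 0 < k s * (ν - μ))
    {K0 K1 : ℝ} (hK0 : 0 < K0) (hK1 : 0 < K1)
    (hlow : ∀ᶠ s in 𝓝[>] (0 : ℝ), 0 ≤ ‖Q (z s)‖ ^ 2 - K0 * ‖P (z s)‖ ^ 2)
    (hup : ∀ᶠ s in 𝓝[>] (0 : ℝ), ‖Q (z s)‖ ^ 2 - K1 * ‖P (z s)‖ ^ 2 < 0) : False := by
  have hC := h.nonneg_const
  have hne : ν - μ ≠ 0 := by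
    obtain ⟨s, hs⟩ := hk.exists
    exact right_ne_zero_of_mul hs.ne'
  have hnorm := norm_le_components hdec
  have habs : ∀ᶠ s in 𝓝[>] (0 : ℝ), k s * (ν - μ) = |k s| * |ν - μ| := by
    filter_upwards [hk] with s hs
    rw [← abs_mul, abs_of_pos hs]
  have hgap : 0 < |ν - μ| := abs_pos.2 hne
  obtain ⟨c, hc, hkz⟩ := h.factor_lower
  obtain ⟨K, hK, hbd⟩ := h.bounds hB hd
  have hcmp : ∃ m > 0, ∀ᶠ s in 𝓝[>] (0 : ℝ), m * ‖z s‖ ≤ ‖Q (z s)‖ ∧ m * ‖z s‖ ≤ ‖P (z s)‖ := by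
    set M0 := √K0⁻¹
    set M1 := √K1
    refine ⟨min (|ν - μ| / (1 + M0)) (|ν - μ| / (1 + M1)),
      lt_min (by positivity) (by positivity), ?_⟩
    filter_upwards [hlow, hup] with s h1 h2
    have h3 : ‖P (z s)‖ ≤ M0 * ‖Q (z s)‖ := by
      refine le_of_sq_le_sq ?_ (by positivity)
      rw [mul_pow, Real.sq_sqrt (by positivity), le_inv_mul_iff₀ hK0]
      linarith
    have h4 : ‖Q (z s)‖ ≤ M1 * ‖P (z s)‖ := by
      refine le_of_sq_le_sq ?_ (by positivity)
      rw [mul_pow, Real.sq_sqrt hK1.le]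
      linarith
    have h5 := hnorm (z s)
    constructor
    · refine (mul_le_mul_of_nonneg_right (min_le_left _ _) (norm_nonneg _)).trans ?_
      rw [div_mul_eq_mul_div, div_le_iff₀ (by positivity)]
      linarith
    · refine (mul_le_mul_of_nonneg_right (min_le_right _ _) (norm_nonneg _)).trans ?_
      rw [div_mul_eq_mul_div, div_le_iff₀ (by positivity)]
      linarith
  -- Both components are at least `m ‖z‖`, so the errors in their logarithmic derivatives are
  -- bounded, with total at most the `L` below.
  obtain ⟨m, hm, hcmp⟩ := hcmp
  set L := 2 * (‖Q‖ * K) / m + 2 * (‖P‖ * K) / m with hL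
  have hL0 : 0 ≤ L := by positivity
  set c1 := c * |ν - μ| / 2 with hc1
  have hc10 : 0 < c1 := by positivity
  -- The logarithm of the ratio of the squared components has derivative `2 k (ν - μ) + O(1)`, and
  -- `|k| ≥ c / ‖z‖ ≥ c / (2s)` makes the main term at least `2 c1 / s`. One half of it absorbs `L`;
  -- the other makes `f` monotone, so the logarithm of the ratio is at most `K2 + c1 log s`, which
  -- tends to `-∞` and violates the lower bound `K0`.
  set f : ℝ → ℝ := fun s => Real.log (‖Q (z s)‖ ^ 2) - Real.log (‖P (z s)‖ ^ 2)
    - c1 * Real.log s with hf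
  have key : ∀ᶠ s in 𝓝[>] (0 : ℝ), ∃ f', HasDerivAt f f' s ∧ 0 ≤ f' := by
    filter_upwards [h.hasDerivAt_component hQB, h.hasDerivAt_component hPB, hbd, habs, hkz,
      h.norm_le_two_mul, h.eventually_ne_zero, hcmp,
      Ioo_mem_nhdsGT (show 0 < c1 / (2 * (L + 1)) by positivity)]
      with s ⟨r1, h1, h1'⟩ ⟨r2, h2, h2'⟩ h3 h4 h5 h6 h7 h8 hs
    have hQ0 : 0 < ‖Q (z s)‖ := lt_of_lt_of_le (by positivity) h8.1
    have hP0 : 0 < ‖P (z s)‖ := lt_of_lt_of_le (by positivity) h8.2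
    refine ⟨_, ((h1.log (by positivity)).sub (h2.log (by positivity))).sub
      ((Real.hasDerivAt_log hs.1.ne').const_mul c1), ?_⟩
    have hr1 : |r1 / ‖Q (z s)‖ ^ 2| ≤ 2 * (‖Q‖ * K) / m := by
      rw [abs_div, abs_of_pos (show 0 < ‖Q (z s)‖ ^ 2 by positivity),
        div_le_div_iff₀ (by positivity) hm]
      calc |r1| * m ≤ 2 * ‖Q (z s)‖ * (‖Q‖ * (K * ‖z s‖)) * m := by
            gcongr
            exact h1'.trans (by gcongr; exact h3.2.2)
        _ = 2 * ‖Q (z s)‖ * ‖Q‖ * K * (m * ‖z s‖) := by ring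
        _ ≤ 2 * ‖Q (z s)‖ * ‖Q‖ * K * ‖Q (z s)‖ := by gcongr; exact h8.1
        _ = _ := by ring
    have hr2 : |r2 / ‖P (z s)‖ ^ 2| ≤ 2 * (‖P‖ * K) / m := by
      rw [abs_div, abs_of_pos (show 0 < ‖P (z s)‖ ^ 2 by positivity),
        div_le_div_iff₀ (by positivity) hm]
      calc |r2| * m ≤ 2 * ‖P (z s)‖ * (‖P‖ * (K * ‖z s‖)) * m := by
            gcongr
            exact h2'.trans (by gcongr; exact h3.2.2)
        _ = 2 * ‖P (z s)‖ * ‖P‖ * K * (m * ‖z s‖) := by ring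
        _ ≤ 2 * ‖P (z s)‖ * ‖P‖ * K * ‖P (z s)‖ := by gcongr; exact h8.2
        _ = _ := by ring
    have h9 : (2 * k s * ν * ‖Q (z s)‖ ^ 2 + r1) / ‖Q (z s)‖ ^ 2
        - (2 * k s * μ * ‖P (z s)‖ ^ 2 + r2) / ‖P (z s)‖ ^ 2 - c1 * s⁻¹
        = 2 * (|k s| * |ν - μ|) + r1 / ‖Q (z s)‖ ^ 2 - r2 / ‖P (z s)‖ ^ 2 - c1 * s⁻¹ := by
      rw [← h4]
      field_simp
      ring
    rw [h9]
    have h10 : 2 * c1 * s⁻¹ ≤ 2 * (|k s| * |ν - μ|) := by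
      have h11 : c ≤ |k s| * (2 * s) := h5.trans (by gcongr)
      rw [← div_eq_mul_inv, div_le_iff₀ hs.1, hc1]
      nlinarith
    have h12 : L ≤ c1 * s⁻¹ := by
      have h13 := hs.2
      rw [lt_div_iff₀ (by positivity)] at h13
      rw [← div_eq_mul_inv, le_div_iff₀ hs.1]
      nlinarith [hs.1]
    have := (abs_le.1 hr1).1
    have := (abs_le.1 hr2).2
    linarith
  obtain ⟨K2, hK2⟩ := eventually_le_of_deriv_nonneg (f := f) (f' := deriv f)
    (key.mono fun s ⟨f', h1, _⟩ => h1.differentiableAt.hasDerivAt)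
    (key.mono fun s ⟨f', h1, h2⟩ => by rw [h1.deriv]; exact h2)
  have hlim : Tendsto (fun s => c1 * Real.log s) (𝓝[>] 0) atBot :=
    Real.tendsto_log_nhdsGT_zero.const_mul_atBot hc10
  obtain ⟨s, h1, h2, h3, h4, h5⟩ := (hK2.and (hlow.and (hcmp.and (h.eventually_ne_zero.and
    (hlim.eventually_lt_atBot (Real.log K0 - K2)))))).exists
  have hQ0 : 0 < ‖Q (z s)‖ := lt_of_lt_of_le (by positivity) h3.1
  have hP0 : 0 < ‖P (z s)‖ := lt_of_lt_of_le (by positivity) h3.2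
  have h6 : Real.log K0 + Real.log (‖P (z s)‖ ^ 2) ≤ Real.log (‖Q (z s)‖ ^ 2) := by
    rw [← Real.log_mul hK0.ne' (by positivity)]
    exact Real.log_le_log (by positivity) (by linarith)
  simp only [hf] at h1
  linarith

/-- When the eigenvalues of `B` are real and distinct, the curve approaches one of the two
eigenlines; here `μ`, `ν` are the eigenvalues, ordered according to the sign of the factor `k`. -/
theorem approaches_eigenline_aux (h : IsSingularCurve B z v k b C)
    (hB : ∀ x, B (B x) = B x - d • x) (hd : d ≠ 0) {μ ν : ℝ} (hsum : μ + ν = 1)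
    (hprod : μ * ν = d) (hk : ∀ᶠ s in 𝓝[>] (0 : ℝ), 0 < k s * (ν - μ)) :
    (∀ ε > 0, ∀ᶠ s in 𝓝[>] (0 : ℝ), ‖B (z s) - μ • z s‖ ≤ ε * ‖z s‖) ∨
      ∀ ε > 0, ∀ᶠ s in 𝓝[>] (0 : ℝ), ‖B (z s) - ν • z s‖ ≤ ε * ‖z s‖ := by
  set P : E →L[ℝ] E := B - ν • ContinuousLinearMap.id ℝ E with hP
  set Q : E →L[ℝ] E := B - μ • ContinuousLinearMap.id ℝ E with hQ
  have hPx : ∀ x, P x = B x - ν • x := fun x => by simp [hP]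
  have hQx : ∀ x, Q x = B x - μ • x := fun x => by simp [hQ]
  have hμ : μ = 1 - ν := by linarith
  have hPB : ∀ x, P (B x) = μ • P x := fun x => by
    rw [hPx, hPx, hB, ← hprod, hμ]; module
  have hQB : ∀ x, Q (B x) = ν • Q x := fun x => by
    rw [hQx, hQx, hB, ← hprod, hμ]; module
  have hdec : ∀ x, (ν - μ) • x = Q x - P x := fun x => by rw [hPx, hQx]; module
  -- `Q` kills the `μ`-line and `P` the `ν`-line. Either the curve enters every cone around the
  -- `μ`-line, or it finally stays outside one of them; in the second case it stays outside all of
  -- them, since its components cannot remain comparable.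
  by_cases hall : ∀ K > 0, ∀ᶠ s in 𝓝[>] (0 : ℝ), ‖Q (z s)‖ ^ 2 - K * ‖P (z s)‖ ^ 2 < 0
  · left
    intro ε hε
    filter_upwards [hall ((ε / (‖P‖ + 1)) ^ 2) (by positivity)] with s hs
    rw [← hQx]
    have h1 : ‖Q (z s)‖ ≤ ε / (‖P‖ + 1) * ‖P (z s)‖ := by
      refine le_of_sq_le_sq ?_ (by positivity)
      rw [mul_pow]; linarith
    refine h1.trans ?_
    calc ε / (‖P‖ + 1) * ‖P (z s)‖ ≤ ε / (‖P‖ + 1) * ((‖P‖ + 1) * ‖z s‖) := by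
          gcongr
          exact (P.le_opNorm _).trans (by gcongr; linarith)
      _ = ε * ‖z s‖ := by field_simp
  · right
    simp only [not_forall] at hall
    obtain ⟨K0, hK0, hn0⟩ := hall
    have hlow := (h.cone_dichotomy hPB hQB hdec hk hK0).resolve_left hn0
    suffices hall2 : ∀ K > 0, ∀ᶠ s in 𝓝[>] (0 : ℝ), 0 ≤ ‖Q (z s)‖ ^ 2 - K * ‖P (z s)‖ ^ 2 by
      intro ε hε
      filter_upwards [hall2 ((ε / (‖Q‖ + 1))⁻¹ ^ 2) (by positivity)] with s hs
      rw [← hPx]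
      have h1 : (ε / (‖Q‖ + 1))⁻¹ * ‖P (z s)‖ ≤ ‖Q (z s)‖ := by
        refine le_of_sq_le_sq ?_ (by positivity)
        rw [mul_pow]; linarith
      rw [inv_mul_le_iff₀ (by positivity)] at h1
      refine h1.trans ?_
      calc ε / (‖Q‖ + 1) * ‖Q (z s)‖ ≤ ε / (‖Q‖ + 1) * ((‖Q‖ + 1) * ‖z s‖) := by
            gcongr
            exact (Q.le_opNorm _).trans (by gcongr; linarith)
        _ = ε * ‖z s‖ := by field_simp
    intro K1 hK1
    refine (h.cone_dichotomy hPB hQB hdec hk hK1).resolve_left fun hup =>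
      h.not_comparable hB hd hPB hQB hdec hk hK0 hK1 hlow hup

theorem approaches_eigenline (h : IsSingularCurve B z v k b C)
    (hB : ∀ x, B (B x) = B x - d • x) (hd : d ≠ 0) (hd4 : d < 1 / 4) :
    ∃ μ : ℝ, μ * (1 - μ) = d ∧ ∀ ε > 0, ∀ᶠ s in 𝓝[>] (0 : ℝ),
      ‖B (z s) - μ • z s‖ ≤ ε * ‖z s‖ := by
  set D := √(1 - 4 * d) with hD
  have hD0 : 0 < D := Real.sqrt_pos.2 (by linarith)
  have hDsq : D ^ 2 = 1 - 4 * d := Real.sq_sqrt (by linarith)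
  rcases h.factor_sign with hk | hk
  · rcases h.approaches_eigenline_aux hB hd (μ := (1 - D) / 2) (ν := (1 + D) / 2) (by ring)
      (by nlinarith) (hk.mono fun s hs => by nlinarith) with h1 | h1
    · exact ⟨_, by nlinarith, h1⟩
    · exact ⟨_, by nlinarith, h1⟩
  · rcases h.approaches_eigenline_aux hB hd (μ := (1 + D) / 2) (ν := (1 - D) / 2) (by ring)
      (by nlinarith) (hk.mono fun s hs => by nlinarith) with h1 | h1
    · exact ⟨_, by nlinarith, h1⟩
    · exact ⟨_, by nlinarith, h1⟩

/-- The velocity is asymptotically in the kernel of `B - μ`. -/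
theorem tendsto_velocity_component (h : IsSingularCurve B z v k b C)
    (hB : ∀ x, B (B x) = B x - d • x) (hd : d ≠ 0) {μ : ℝ} (hμ : μ * (1 - μ) = d)
    (hε : ∀ ε > 0, ∀ᶠ s in 𝓝[>] (0 : ℝ), ‖B (z s) - μ • z s‖ ≤ ε * ‖z s‖) :
    Tendsto (fun s => B (v s) - μ • v s) (𝓝[>] 0) (𝓝 0) := by
  obtain ⟨K, hK, hbd⟩ := h.bounds hB hd
  set Q : E →L[ℝ] E := B - μ • ContinuousLinearMap.id ℝ E with hQ
  have hQx : ∀ x, Q x = B x - μ • x := fun x => by simp [hQ]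
  have hQB : ∀ x, Q (B x) = (1 - μ) • Q x := fun x => by
    rw [hQx, hQx, hB, ← hμ]; module
  simp only [← hQx] at hε ⊢
  rw [tendsto_zero_iff_norm_tendsto_zero, Metric.tendsto_nhds]
  intro ε hε0
  filter_upwards [hbd, hε (ε / (2 * (K * |1 - μ| + 1))) (by positivity),
    h.eventually_norm_lt (show 0 < ε / (2 * (‖Q‖ * K + 1)) by positivity)] with s h1 h2 h3
  -- Here `Q z = o(‖z‖)`, and `|k| ‖z‖` is bounded, so the first term tends to `0`; so does the
  -- error, which is `O(‖z‖)`.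
  have h4 : Q (v s) = (k s * (1 - μ)) • Q (z s) + Q (v s - k s • B (z s)) := by
    rw [map_sub, map_smul, hQB, smul_smul]; abel
  rw [dist_zero_right, norm_norm, h4]
  refine (norm_add_le _ _).trans_lt ?_
  have h5 : ‖(k s * (1 - μ)) • Q (z s)‖ ≤ (K * |1 - μ|) * (ε / (2 * (K * |1 - μ| + 1))) := by
    rw [norm_smul, Real.norm_eq_abs, abs_mul]
    calc |k s| * |1 - μ| * ‖Q (z s)‖
        ≤ |k s| * |1 - μ| * (ε / (2 * (K * |1 - μ| + 1)) * ‖z s‖) := by gcongr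
      _ = (|k s| * ‖z s‖) * |1 - μ| * (ε / (2 * (K * |1 - μ| + 1))) := by ring
      _ ≤ _ := by gcongr; exact h1.1
  have h6 : ‖Q (v s - k s • B (z s))‖ ≤ (‖Q‖ * K) * (ε / (2 * (‖Q‖ * K + 1))) := by
    refine (Q.le_opNorm _).trans ?_
    calc ‖Q‖ * ‖v s - k s • B (z s)‖ ≤ ‖Q‖ * (K * ‖z s‖) := by gcongr; exact h1.2.2
      _ ≤ ‖Q‖ * (K * (ε / (2 * (‖Q‖ * K + 1)))) := by gcongr
      _ = _ := by ring
  have h7 : ∀ x : ℝ, 0 ≤ x → x * (ε / (2 * (x + 1))) < ε / 2 := fun x hx => by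
    rw [mul_div_assoc', div_lt_div_iff₀ (by positivity) two_pos]
    nlinarith
  have := h7 (K * |1 - μ|) (by positivity)
  have := h7 (‖Q‖ * K) (by positivity)
  linarith

end IsSingularCurve

end ContactSR

namespace ContactSR

/-! ### Singular curves in the plane -/

section Planar

variable {A : Matrix (Fin 2) (Fin 2) ℝ}
  {B : EuclideanSpace ℝ (Fin 2) →L[ℝ] EuclideanSpace ℝ (Fin 2)}

theorem cayley_hamilton_of_trace_one (hB : ∀ x i, B x i = ∑ j, A i j * x j) (htr : A.trace = 1)
    (x : EuclideanSpace ℝ (Fin 2)) : B (B x) = B x - A.det • x := by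
  rw [Matrix.trace_fin_two] at htr
  have h11 : A 1 1 = 1 - A 0 0 := by linarith
  ext i
  simp only [PiLp.sub_apply, PiLp.smul_apply, smul_eq_mul, hB, Fin.sum_univ_two,
    Matrix.det_fin_two]
  fin_cases i <;> simp [h11] <;> ring

theorem exists_unit_eigenvector (hB : ∀ x i, B x i = ∑ j, A i j * x j) (htr : A.trace = 1)
    {μ : ℝ} (hμ : μ * (1 - μ) = A.det) :
    ∃ e : EuclideanSpace ℝ (Fin 2), e 0 ^ 2 + e 1 ^ 2 = 1 ∧ B e = μ • e := by
  rw [Matrix.trace_fin_two] at htr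
  have h0 : (A - μ • (1 : Matrix (Fin 2) (Fin 2) ℝ)).det = 0 := by
    rw [Matrix.det_fin_two] at hμ ⊢
    simp
    linear_combination -hμ + (-μ) * htr
  obtain ⟨w, hw, hw0⟩ := Matrix.exists_mulVec_eq_zero_iff.2 h0
  have hpos : 0 < w 0 ^ 2 + w 1 ^ 2 := by
    by_contra! hle
    refine hw (funext fun i => ?_)
    have h1 : w 0 ^ 2 = 0 := by nlinarith [sq_nonneg (w 0), sq_nonneg (w 1)]
    have h2 : w 1 ^ 2 = 0 := by nlinarith [sq_nonneg (w 0), sq_nonneg (w 1)]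
    fin_cases i
    · simpa using h1
    · simpa using h2
  set n := √(w 0 ^ 2 + w 1 ^ 2)
  have hn : n ^ 2 = w 0 ^ 2 + w 1 ^ 2 := Real.sq_sqrt hpos.le
  have hn0 : 0 < n := Real.sqrt_pos.2 hpos
  have e0 := congr_fun hw0 0
  have e1 := congr_fun hw0 1
  simp [Matrix.mulVec, dotProduct, Fin.sum_univ_two] at e0 e1
  refine ⟨!₂[w 0 / n, w 1 / n], ?_, ?_⟩
  · simp
    field_simp
    linarith
  · ext i
    rw [hB]
    fin_cases i <;> simp [Fin.sum_univ_two] <;> field_simp <;> linarith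

/-- A continuous family of almost unit vectors that is asymptotic to a simple eigenline converges. -/
theorem tendsto_of_asymptotic_eigenline (hB : ∀ x i, B x i = ∑ j, A i j * x j)
    (htr : A.trace = 1) {μ : ℝ} (hμ : μ * (1 - μ) = A.det) (hμ2 : μ ≠ 1 / 2)
    {v : ℝ → EuclideanSpace ℝ (Fin 2)} (hc : ∀ᶠ s in 𝓝[>] (0 : ℝ), ContinuousAt v s)
    (hn : Tendsto (fun s => ‖v s‖) (𝓝[>] 0) (𝓝 1))
    (hQ : Tendsto (fun s => B (v s) - μ • v s) (𝓝[>] 0) (𝓝 0)) :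
    ∃ w, w ≠ 0 ∧ B w = μ • w ∧ Tendsto v (𝓝[>] 0) (𝓝 w) := by
  obtain ⟨e, he, hBe⟩ := exists_unit_eigenvector hB htr hμ
  set f : EuclideanSpace ℝ (Fin 2) := !₂[-e 1, e 0] with hf
  have hf0 : f 0 = -e 1 := by simp [hf]
  have hf1 : f 1 = e 0 := by simp [hf]
  -- If `f`, orthogonal to `e`, were an eigenvector for `μ` as well, `B` would be the scalar `μ`,
  -- and trace `1` would give `μ = 1/2`.
  have hBf : B f - μ • f ≠ 0 := by
    intro h
    rw [Matrix.trace_fin_two] at htr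
    have e0 := congrArg (fun x : EuclideanSpace ℝ (Fin 2) => x 0) hBe
    have e1 := congrArg (fun x : EuclideanSpace ℝ (Fin 2) => x 1) hBe
    have f0 := congrArg (fun x : EuclideanSpace ℝ (Fin 2) => x 0) h
    have f1 := congrArg (fun x : EuclideanSpace ℝ (Fin 2) => x 1) h
    simp [hB, Fin.sum_univ_two, hf0, hf1] at e0 e1 f0 f1
    have h00 : A 0 0 = μ := by linear_combination e 0 * e0 - e 1 * f0 + (μ - A 0 0) * he
    have h11 : A 1 1 = μ := by linear_combination e 1 * e1 + e 0 * f1 + (μ - A 1 1) * he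
    exact hμ2 (by linarith)
  set α : ℝ → ℝ := fun s => e 0 * v s 0 + e 1 * v s 1 with hα
  set β : ℝ → ℝ := fun s => -e 1 * v s 0 + e 0 * v s 1 with hβ
  have hdec : ∀ s, v s = α s • e + β s • f := fun s => by
    ext i
    fin_cases i
    · simp [hf, hα, hβ]; linear_combination (-v s 0) * he
    · simp [hf, hα, hβ]; linear_combination (-v s 1) * he
  have hnorm : ∀ s, ‖v s‖ ^ 2 = α s ^ 2 + β s ^ 2 := fun s => by
    rw [EuclideanSpace.real_norm_sq_eq, Fin.sum_univ_two]
    linear_combination (-(v s 0 ^ 2 + v s 1 ^ 2)) * he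
  have hβ0 : Tendsto β (𝓝[>] 0) (𝓝 0) := by
    have h1 : ∀ s, ‖B (v s) - μ • v s‖ / ‖B f - μ • f‖ = |β s| := fun s => by
      have : B (v s) - μ • v s = β s • (B f - μ • f) := by
        conv_lhs => rw [hdec s]
        rw [map_add, map_smul, map_smul, hBe]
        module
      rw [this, norm_smul, Real.norm_eq_abs, mul_div_cancel_right₀]
      exact norm_ne_zero_iff.2 hBf
    rw [tendsto_zero_iff_abs_tendsto_zero]
    have := hQ.norm.div_const ‖B f - μ • f‖
    simpa [h1, Function.comp_def] using this
  have hα2 : Tendsto (fun s => α s ^ 2) (𝓝[>] 0) (𝓝 1) := by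
    have := (hn.pow 2).sub (hβ0.pow 2)
    simpa [hnorm] using this
  have hαc : ∀ᶠ s in 𝓝[>] (0 : ℝ), ContinuousAt α s := hc.mono fun s hs => by
    have : ∀ i, ContinuousAt (fun s => v s i) s := fun i =>
      (PiLp.continuous_apply 2 (fun _ : Fin 2 => ℝ) i).continuousAt.comp hs
    exact ((this 0).const_mul _).add ((this 1).const_mul _)
  have hα0 : ∀ᶠ s in 𝓝[>] (0 : ℝ), α s ≠ 0 := by
    filter_upwards [hα2.eventually_const_lt (show (0 : ℝ) < 1 by norm_num)] with s hs h0
    simp [h0] at hs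
  have he0 : e ≠ 0 := by rintro rfl; simp at he
  have hαs : Tendsto (fun s => |α s|) (𝓝[>] 0) (𝓝 1) := by
    simpa [Real.sqrt_sq_eq_abs] using hα2.sqrt
  have hfin : ∀ t : ℝ, Tendsto α (𝓝[>] 0) (𝓝 t) → Tendsto v (𝓝[>] 0) (𝓝 (t • e)) := fun t ht => by
    have := (ht.smul_const e).add (hβ0.smul_const f)
    simpa [← hdec] using this
  -- The coefficient along `e` has absolute value tending to `1`; by continuity its sign is finally
  -- constant, which selects `e` or `-e`.
  rcases eventually_pos_or_neg hαc hα0 with hp | hp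
  · refine ⟨(1 : ℝ) • e, by simpa using he0, by simpa using hBe, hfin 1 ?_⟩
    exact hαs.congr' (hp.mono fun s hs => abs_of_pos hs)
  · refine ⟨(-1 : ℝ) • e, by simpa using he0, by simpa using hBe, hfin (-1) ?_⟩
    exact hαs.neg.congr' (hp.mono fun s hs => by rw [abs_of_neg hs, neg_neg])

/-- The analytic core of the theorem, with no geometry left. For determinant at least `1/4` the
exponents `9/5` and `11/5` satisfy `2 · 11/5 < 9/5 + 3`, which is the limit circle case. Below `1/4`
a tangent eigenline exists, and `1/λ ≤ -1` or `1/λ ≥ 3` is solved for `λ`. -/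
theorem IsSingularCurve.essSelfAdjointAtZero_iff {z v : ℝ → EuclideanSpace ℝ (Fin 2)}
    {k b : ℝ → ℝ} {C : ℝ} {a : EReal} (h : IsSingularCurve B z v k b C)
    (hB : ∀ x i, B x i = ∑ j, A i j * x j) (htr : A.trace = 1) (hdet : A.det ≠ 0) (ha : 0 < a)
    (hb : ∀ s ∈ openInterval a, DifferentiableAt ℝ b s) :
    EssSelfAdjointAtZero a (potential b) ↔ ∃ lam ∈ Icc (-1 : ℝ) (1 / 3), ∃ w, w ≠ 0 ∧
      B w = lam • w ∧ Tendsto v (𝓝[>] 0) (𝓝 w) := by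
  have hCH := cayley_hamilton_of_trace_one hB htr
  obtain ⟨G, hG⟩ := exists_primitive (a := a) (f := b)
    (fun s hs => (hb s hs).continuousAt.continuousWithinAt)
  have hG' : ∀ᶠ s in 𝓝[>] (0 : ℝ), HasDerivAt G (b s) s :=
    mem_of_superset (openInterval_mem_nhdsGT ha) hG
  constructor
  · intro hE
    have hd : A.det < 1 / 4 := by
      by_contra! hd
      obtain ⟨K, hK⟩ := h.rough_asymptotics hCH hd hG'
      exact hE (limitCircleAtZero_of_bounds ha hb hG (p := 9 / 5) (q := 11 / 5) (C := K)
        (by norm_num) (by norm_num) (hK.mono fun s hs => hs.1) (hK.mono fun s hs => hs.2))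
    obtain ⟨μ, hμ, hε⟩ := h.approaches_eigenline hCH hdet hd
    have hμ2 : μ ≠ 1 / 2 := by rintro rfl; norm_num at hμ; linarith
    obtain ⟨w, hw0, hBw, hw⟩ := tendsto_of_asymptotic_eigenline hB htr hμ hμ2
      h.continuousAt_velocity h.tendsto_norm (h.tendsto_velocity_component hCH hdet hμ hε)
    obtain ⟨hμ0, K, hK⟩ := h.log_asymptotics hCH hdet hG' hw0 hBw hμ2 hw
    refine ⟨μ, ?_, w, hw0, hBw, hw⟩
    rcases (essSelfAdjointAtZero_iff_of_log_asymptotics ha hb hG hK).1 hE with h1 | h1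
    · have hneg : μ < 0 := inv_lt_zero.1 (by linarith)
      have := mul_le_mul_of_nonpos_left h1 hneg.le
      rw [mul_inv_cancel₀ hμ0] at this
      exact ⟨by linarith, by linarith⟩
    · have hpos : 0 < μ := inv_pos.1 (by linarith)
      have := mul_le_mul_of_nonneg_left h1 hpos.le
      rw [mul_inv_cancel₀ hμ0] at this
      exact ⟨by linarith, by linarith⟩
  · rintro ⟨μ, hμ, w, hw0, hBw, hw⟩
    have hμ2 : μ ≠ 1 / 2 := by rintro rfl; norm_num at hμ
    obtain ⟨hμ0, K, hK⟩ := h.log_asymptotics hCH hdet hG' hw0 hBw hμ2 hw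
    rw [essSelfAdjointAtZero_iff_of_log_asymptotics ha hb hG hK]
    rcases lt_or_gt_of_ne hμ0 with hneg | hpos
    · left
      have : μ * μ⁻¹ = 1 := mul_inv_cancel₀ hμ0
      have hi : μ⁻¹ < 0 := inv_lt_zero.2 hneg
      nlinarith [hμ.1]
    · right
      rw [le_inv_comm₀ (by norm_num) hpos]
      norm_num
      linarith [hμ.2]

/-- If a matrix of trace one has a real eigenvalue, all its eigenvalues are real. -/
theorem allEigenvaluesReal_of_hasEigenvector (htr : A.trace = 1) {lam : ℝ} {c : Fin 2 → ℝ}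
    (hc : Module.End.HasEigenvector (Matrix.toLin' A) lam c) : AllEigenvaluesReal A := by
  have hchar : ∀ {K : Type} [Field K] (D : Matrix (Fin 2) (Fin 2) K) (t : K)
      (w : Fin 2 → K), w ≠ 0 → Matrix.toLin' D w = t • w → t ^ 2 - D.trace * t + D.det = 0 := by
    intro K _ D t w hw hDw
    have h1 : (D - t • (1 : Matrix (Fin 2) (Fin 2) K)).mulVec w = 0 := by
      rw [Matrix.sub_mulVec, Matrix.smul_mulVec, Matrix.one_mulVec, ← Matrix.toLin'_apply, hDw,
        sub_self]
    have h2 := Matrix.exists_mulVec_eq_zero_iff.1 ⟨w, hw, h1⟩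
    rw [Matrix.det_fin_two] at h2 ⊢
    rw [Matrix.trace_fin_two]
    simp at h2
    linear_combination h2
  have h1 := hchar A lam c hc.2 hc.apply_eq_smul
  intro t ht
  obtain ⟨w, hw⟩ := ht.exists_hasEigenvector
  have h2 := hchar _ t w hw.2 hw.apply_eq_smul
  have h3 : (A.map ((↑) : ℝ → ℂ)).trace = ((A.trace : ℝ) : ℂ) := by
    simp [Matrix.trace_fin_two]
  have h4 : (A.map ((↑) : ℝ → ℂ)).det = ((A.det : ℝ) : ℂ) := by
    simp [Matrix.det_fin_two]
  rw [h3, h4, htr] at h2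
  rw [htr] at h1
  -- The trace makes `1 - λ` the other root of the characteristic polynomial.
  have h5 : (t - (lam : ℂ)) * (t - ((1 - lam : ℝ) : ℂ)) = 0 := by
    have h6 : ((A.det : ℝ) : ℂ) = ((lam * (1 - lam) : ℝ) : ℂ) := by
      congr 1; linarith
    rw [h6] at h2
    push_cast at h2 ⊢
    linear_combination h2
  rcases mul_eq_zero.1 h5 with h | h
  · rw [sub_eq_zero.1 h]; simp
  · rw [sub_eq_zero.1 h]; simp

end Planar

end ContactSR

noncomputable section

namespace ContactSR

/-! ### Charts -/

section Charts

variable {n : ℕ} {M : Type*} [TopologicalSpace M] [ChartedSpace (EuclideanSpace ℝ (Fin n)) M]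
  [IsManifold (𝓡 n) ∞ M]

/-- The chart at `c`. -/
abbrev chart (n : ℕ) {M : Type*} [TopologicalSpace M]
    [ChartedSpace (EuclideanSpace ℝ (Fin n)) M] (c : M) : M → EuclideanSpace ℝ (Fin n) :=
  extChartAt (𝓡 n) c

/-- The inverse of the chart at `c`. -/
abbrev param (n : ℕ) {M : Type*} [TopologicalSpace M]
    [ChartedSpace (EuclideanSpace ℝ (Fin n)) M] (c : M) : EuclideanSpace ℝ (Fin n) → M :=
  (extChartAt (𝓡 n) c).symm

/-- The derivative of the chart at `c`. -/
abbrev dchart (n : ℕ) {M : Type*} [TopologicalSpace M]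
    [ChartedSpace (EuclideanSpace ℝ (Fin n)) M] (c : M) (q : M) :
    TangentSpace (𝓡 n) q →L[ℝ] EuclideanSpace ℝ (Fin n) :=
  mfderiv (𝓡 n) 𝓘(ℝ, EuclideanSpace ℝ (Fin n)) (extChartAt (𝓡 n) c) q

/-- The derivative of the inverse of the chart at `c`. -/
abbrev dparam (n : ℕ) {M : Type*} [TopologicalSpace M]
    [ChartedSpace (EuclideanSpace ℝ (Fin n)) M] (c : M) (x : EuclideanSpace ℝ (Fin n)) :
    EuclideanSpace ℝ (Fin n) →L[ℝ] TangentSpace (𝓡 n) (param n c x) :=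
  mfderiv 𝓘(ℝ, EuclideanSpace ℝ (Fin n)) (𝓡 n) (extChartAt (𝓡 n) c).symm x

variable (c : M)

theorem mdifferentiableAt_param {x : EuclideanSpace ℝ (Fin n)}
    (hx : x ∈ (extChartAt (𝓡 n) c).target) :
    MDifferentiableAt 𝓘(ℝ, EuclideanSpace ℝ (Fin n)) (𝓡 n) (param n c) x := by
  have : IsManifold (𝓡 n) 1 M := IsManifold.of_le (n := ∞) (by simp)
  have h := mdifferentiableWithinAt_extChartAt_symm (I := 𝓡 n) hx
  rwa [ModelWithCorners.range_eq_univ, mdifferentiableWithinAt_univ] at h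

theorem mdifferentiableAt_chart {q : M} (hq : q ∈ (extChartAt (𝓡 n) c).source) :
    MDifferentiableAt (𝓡 n) 𝓘(ℝ, EuclideanSpace ℝ (Fin n)) (chart n c) q := by
  have : IsManifold (𝓡 n) 1 M := IsManifold.of_le (n := ∞) (by simp)
  exact mdifferentiableAt_extChartAt (by rwa [extChartAt_source] at hq)

theorem dchart_dparam {x : EuclideanSpace ℝ (Fin n)} (hx : x ∈ (extChartAt (𝓡 n) c).target)
    (v : EuclideanSpace ℝ (Fin n)) : dchart n c (param n c x) (dparam n c x v) = v := by
  have : IsManifold (𝓡 n) 1 M := IsManifold.of_le (n := ∞) (by simp)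
  have h := mfderiv_extChartAt_comp_mfderivWithin_extChartAt_symm (I := 𝓡 n) hx
  rw [ModelWithCorners.range_eq_univ, mfderivWithin_univ] at h
  exact congrArg (fun L => L v) h

theorem dparam_dchart {x : EuclideanSpace ℝ (Fin n)} (hx : x ∈ (extChartAt (𝓡 n) c).target)
    (v : TangentSpace (𝓡 n) (param n c x)) :
    dparam n c x (dchart n c (param n c x) v) = v := by
  have : IsManifold (𝓡 n) 1 M := IsManifold.of_le (n := ∞) (by simp)
  have h := mfderivWithin_extChartAt_symm_comp_mfderiv_extChartAt (I := 𝓡 n) hx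
  rw [ModelWithCorners.range_eq_univ, mfderivWithin_univ] at h
  exact congrArg (fun L => L v) h

theorem dchart_injective {q : M} (hq : q ∈ (extChartAt (𝓡 n) c).source) :
    Function.Injective (dchart n c q) := by
  have : IsManifold (𝓡 n) 1 M := IsManifold.of_le (n := ∞) (by simp)
  exact (isInvertible_mfderiv_extChartAt hq).injective

/-- The expression in the chart at `c` of a vector field. -/
def coordField (X : (q : M) → TangentSpace (𝓡 n) q) (x : EuclideanSpace ℝ (Fin n)) :
    EuclideanSpace ℝ (Fin n) :=
  dchart n c (param n c x) (X (param n c x))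

theorem dparam_coordField (X : (q : M) → TangentSpace (𝓡 n) q) {x : EuclideanSpace ℝ (Fin n)}
    (hx : x ∈ (extChartAt (𝓡 n) c).target) :
    dparam n c x (coordField c X x) = X (param n c x) :=
  dparam_dchart c hx _

omit [IsManifold (𝓡 n) ∞ M] in
theorem coordField_chart {c q : M} (hq : q ∈ (extChartAt (𝓡 n) c).source)
    (X : (q : M) → TangentSpace (𝓡 n) q) :
    coordField c X (chart n c q) = dchart n c q (X q) := by
  have h : ∀ r, r = q → dchart n c r (X r) = dchart n c q (X q) := by rintro r rfl; rfl
  exact h _ ((extChartAt (𝓡 n) c).left_inv hq)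

/-- Topology and smoothness of the tangent bundle are expressed through trivializations; this
identifies their fibre coordinate with the derivative of the chart. -/
theorem trivializationAt_snd {q : M} (hq : q ∈ (extChartAt (𝓡 n) c).source)
    (v : TangentSpace (𝓡 n) q) :
    (trivializationAt (EuclideanSpace ℝ (Fin n)) (TangentSpace (𝓡 n)) c ⟨q, v⟩).2
      = dchart n c q v := by
  have : IsManifold (𝓡 n) 1 M := IsManifold.of_le (n := ∞) (by simp)
  rw [extChartAt_source] at hq
  have h := TangentBundle.continuousLinearMapAt_trivializationAt (I := 𝓡 n) hq
  have h2 := congrArg (fun L => L v) h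
  rw [← show _ = dchart n c q v from h2]
  rw [Bundle.Trivialization.continuousLinearMapAt_apply,
    Bundle.Trivialization.linearMapAt_apply, if_pos]
  simpa using hq

theorem contDiffAt_coordField {X : (q : M) → TangentSpace (𝓡 n) q} {q : M}
    (hq : q ∈ (extChartAt (𝓡 n) c).source)
    (hX : ContMDiffAt (𝓡 n) (𝓡 n).tangent ∞ (fun q => (⟨q, X q⟩ : TangentBundle (𝓡 n) M)) q) :
    ContDiffAt ℝ ∞ (coordField c X) (chart n c q) := by
  have : IsManifold (𝓡 n) 1 M := IsManifold.of_le (n := ∞) (by simp)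
  have hbase : q ∈ (trivializationAt (EuclideanSpace ℝ (Fin n)) (TangentSpace (𝓡 n)) c).baseSet :=
    by rw [extChartAt_source] at hq; simpa using hq
  have h1 := (Bundle.Trivialization.contMDiffAt_section_iff
    (trivializationAt (EuclideanSpace ℝ (Fin n)) (TangentSpace (𝓡 n)) c) hbase).1 hX
  have ht : chart n c q ∈ (extChartAt (𝓡 n) c).target := (extChartAt (𝓡 n) c).map_source hq
  have h2 : ContMDiffAt 𝓘(ℝ, EuclideanSpace ℝ (Fin n)) (𝓡 n) ∞ (param n c) (chart n c q) :=
    (contMDiffOn_extChartAt_symm c).contMDiffAt ((isOpen_extChartAt_target c).mem_nhds ht)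
  have h3 : param n c (chart n c q) = q := (extChartAt (𝓡 n) c).left_inv hq
  rw [← contMDiffAt_iff_contDiffAt]
  refine (ContMDiffAt.comp_of_eq h1 h2 h3).congr_of_eventuallyEq ?_
  filter_upwards [(isOpen_extChartAt_target c).mem_nhds ht] with x hx
  exact (trivializationAt_snd c ((extChartAt (𝓡 n) c).map_target hx) _).symm

end Charts

/-! ### Pull-back of one-forms to a surface -/

section PullBack

variable {M : Type*} [TopologicalSpace M] [ChartedSpace (EuclideanSpace ℝ (Fin 3)) M]
  [IsManifold (𝓡 3) ∞ M]
  {S : Type*} [TopologicalSpace S] [ChartedSpace (EuclideanSpace ℝ (Fin 2)) S]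
  [IsManifold (𝓡 2) ∞ S]
  {α : (q : M) → TangentSpace (𝓡 3) q →L[ℝ] ℝ} {ι : S → M}

/-- The expression in the chart at `c` of the pull-back of a one-form to a surface. -/
def pullForm (α : (q : M) → TangentSpace (𝓡 3) q →L[ℝ] ℝ) (ι : S → M) (c : S)
    (x : EuclideanSpace ℝ (Fin 2)) : EuclideanSpace ℝ (Fin 2) →L[ℝ] ℝ :=
  (α (ι (param 2 c x))).comp ((mfderiv (𝓡 2) (𝓡 3) ι (param 2 c x)).comp (dparam 2 c x))

/-- The expression of a map between charts. -/
def chartMap (ι : S → M) (c : S) (m : M) (x : EuclideanSpace ℝ (Fin 2)) :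
    EuclideanSpace ℝ (Fin 3) :=
  chart 3 m (ι (param 2 c x))

theorem contDiffAt_chartMap (hι : ContMDiff (𝓡 2) (𝓡 3) ∞ ι) {c : S} {m : M}
    {x : EuclideanSpace ℝ (Fin 2)} (hx : x ∈ (extChartAt (𝓡 2) c).target)
    (hm : ι (param 2 c x) ∈ (extChartAt (𝓡 3) m).source) :
    ContDiffAt ℝ ∞ (chartMap ι c m) x := by
  rw [← contMDiffAt_iff_contDiffAt]
  have h2 : ContMDiffAt 𝓘(ℝ, EuclideanSpace ℝ (Fin 2)) (𝓡 2) ∞ (param 2 c) x :=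
    (contMDiffOn_extChartAt_symm c).contMDiffAt ((isOpen_extChartAt_target c).mem_nhds hx)
  have h3 : ContMDiffAt (𝓡 3) 𝓘(ℝ, EuclideanSpace ℝ (Fin 3)) ∞ (chart 3 m) (ι (param 2 c x)) :=
    contMDiffAt_extChartAt' (by rwa [extChartAt_source] at hm)
  exact h3.comp x (hι.contMDiffAt.comp x h2)

theorem fderiv_chartMap (hι : ContMDiff (𝓡 2) (𝓡 3) ∞ ι) {c : S} {m : M}
    {x : EuclideanSpace ℝ (Fin 2)} (hx : x ∈ (extChartAt (𝓡 2) c).target)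
    (hm : ι (param 2 c x) ∈ (extChartAt (𝓡 3) m).source) (v : EuclideanSpace ℝ (Fin 2)) :
    fderiv ℝ (chartMap ι c m) x v
      = dchart 3 m (ι (param 2 c x)) (mfderiv (𝓡 2) (𝓡 3) ι (param 2 c x) (dparam 2 c x v)) := by
  have h1 := mdifferentiableAt_param c hx
  have h2 : MDifferentiableAt (𝓡 2) (𝓡 3) ι (param 2 c x) :=
    hι.contMDiffAt.mdifferentiableAt (by simp)
  have h3 := mdifferentiableAt_chart m hm
  have h4 := (h3.hasMFDerivAt.comp x (h2.hasMFDerivAt.comp x h1.hasMFDerivAt)).mfderiv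
  rw [← mfderiv_eq_fderiv]
  exact congrArg (fun L => L v) h4

omit [IsManifold (𝓡 3) ∞ M] in
theorem eventually_mem_charts (hι : ContMDiff (𝓡 2) (𝓡 3) ∞ ι) {c : S} {m : M}
    {x : EuclideanSpace ℝ (Fin 2)} (hx : x ∈ (extChartAt (𝓡 2) c).target)
    (hm : ι (param 2 c x) ∈ (extChartAt (𝓡 3) m).source) :
    ∀ᶠ y in 𝓝 x, y ∈ (extChartAt (𝓡 2) c).target ∧
      ι (param 2 c y) ∈ (extChartAt (𝓡 3) m).source := by
  refine Filter.Eventually.and ((isOpen_extChartAt_target c).mem_nhds hx) ?_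
  have h : ContinuousAt (fun y => ι (param 2 c y)) x :=
    hι.continuous.continuousAt.comp (mdifferentiableAt_param c hx).continuousAt
  exact h.preimage_mem_nhds ((isOpen_extChartAt_source m).mem_nhds hm)

theorem formInChart_dchart {m q : M} (hq : q ∈ (extChartAt (𝓡 3) m).source)
    (v : TangentSpace (𝓡 3) q) : formInChart α m (chart 3 m q) (dchart 3 m q v) = α q v := by
  obtain ⟨y, hy, rfl⟩ : ∃ y ∈ (extChartAt (𝓡 3) m).target, param 3 m y = q :=
    ⟨chart 3 m q, (extChartAt (𝓡 3) m).map_source hq, (extChartAt (𝓡 3) m).left_inv hq⟩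
  have hyy : chart 3 m (param 3 m y) = y := (extChartAt (𝓡 3) m).right_inv hy
  rw [hyy]
  change α (param 3 m y) (dparam 3 m y (dchart 3 m (param 3 m y) v)) = _
  rw [dparam_dchart m hy]

/-- Between charts the pull-back is a composition of smooth maps of Euclidean spaces, so that
smoothness and derivatives can be computed by ordinary calculus. -/
theorem pullForm_eq (hι : ContMDiff (𝓡 2) (𝓡 3) ∞ ι) {c : S} {m : M}
    {x : EuclideanSpace ℝ (Fin 2)} (hx : x ∈ (extChartAt (𝓡 2) c).target)
    (hm : ι (param 2 c x) ∈ (extChartAt (𝓡 3) m).source) :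
    pullForm α ι c x
      = (formInChart α m (chartMap ι c m x)).comp (fderiv ℝ (chartMap ι c m) x) := by
  ext v
  rw [ContinuousLinearMap.comp_apply, fderiv_chartMap hι hx hm, chartMap, formInChart_dchart hm]
  rfl

omit [IsManifold (𝓡 3) ∞ M] in
theorem contDiffAt_formInChart (hα : IsSmoothOneForm α) {m : M} {y : EuclideanSpace ℝ (Fin 3)}
    (hy : y ∈ (extChartAt (𝓡 3) m).target) : ContDiffAt ℝ ∞ (formInChart α m) y :=
  (hα m).contDiffAt ((isOpen_extChartAt_target m).mem_nhds hy)

theorem contDiffAt_pullForm (hα : IsSmoothOneForm α) (hι : ContMDiff (𝓡 2) (𝓡 3) ∞ ι) {c : S}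
    {x : EuclideanSpace ℝ (Fin 2)} (hx : x ∈ (extChartAt (𝓡 2) c).target) :
    ContDiffAt ℝ ∞ (pullForm α ι c) x := by
  set m := ι (param 2 c x)
  have hm : ι (param 2 c x) ∈ (extChartAt (𝓡 3) m).source := mem_extChartAt_source _
  have hF := contDiffAt_chartMap hι hx hm
  have h1 : ContDiffAt ℝ ∞ (fun y => formInChart α m (chartMap ι c m y)) x :=
    ContDiffAt.comp (g := formInChart α m) x
      (contDiffAt_formInChart hα ((extChartAt (𝓡 3) m).map_source hm)) hF
  have h2 : ContDiffAt ℝ ∞ (fderiv ℝ (chartMap ι c m)) x := hF.fderiv_right (by simp)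
  refine (h1.clm_comp h2).congr_of_eventuallyEq ?_
  filter_upwards [eventually_mem_charts hι hx hm] with y hy
  exact pullForm_eq hι hy.1 hy.2

/-- The exterior derivative commutes with the pull-back to a surface. -/
theorem extDeriv_pullForm (hα : IsSmoothOneForm α) (hι : ContMDiff (𝓡 2) (𝓡 3) ∞ ι) {c : S}
    {x : EuclideanSpace ℝ (Fin 2)} (hx : x ∈ (extChartAt (𝓡 2) c).target)
    (v w : EuclideanSpace ℝ (Fin 2)) :
    extDerivOneForm α (ι (param 2 c x))
      (mfderiv (𝓡 2) (𝓡 3) ι (param 2 c x) (dparam 2 c x v))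
      (mfderiv (𝓡 2) (𝓡 3) ι (param 2 c x) (dparam 2 c x w))
      = fderiv ℝ (pullForm α ι c) x v w - fderiv ℝ (pullForm α ι c) x w v := by
  -- The exterior derivative at a point is defined in the chart at that very point, so this chart
  -- has to be used.
  set m := ι (param 2 c x) with hmdef
  have hm : ι (param 2 c x) ∈ (extChartAt (𝓡 3) m).source := mem_extChartAt_source _
  have hF := contDiffAt_chartMap hι hx hm
  have hy : chartMap ι c m x ∈ (extChartAt (𝓡 3) m).target := (extChartAt (𝓡 3) m).map_source hm
  have h1 : DifferentiableAt ℝ (fun y => formInChart α m (chartMap ι c m y)) x :=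
    (ContDiffAt.comp (g := formInChart α m) x (contDiffAt_formInChart hα hy) hF).differentiableAt
      (by simp)
  have h2 : DifferentiableAt ℝ (fderiv ℝ (chartMap ι c m)) x :=
    (hF.fderiv_right (m := ∞) (by simp)).differentiableAt (by simp)
  have h3 : pullForm α ι c =ᶠ[𝓝 x]
      fun y => (formInChart α m (chartMap ι c m y)).comp (fderiv ℝ (chartMap ι c m) y) := by
    filter_upwards [eventually_mem_charts hι hx hm] with y hy
    exact pullForm_eq hι hy.1 hy.2
  have h4 : fderiv ℝ (fun y => formInChart α m (chartMap ι c m y)) x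
      = (fderiv ℝ (formInChart α m) (chartMap ι c m x)).comp (fderiv ℝ (chartMap ι c m) x) :=
    fderiv_fun_comp x ((contDiffAt_formInChart hα hy).differentiableAt (by simp))
      (hF.differentiableAt (by simp))
  -- By the product rule the only extra term contains the second derivative of the chart expression
  -- of `ι`; it is symmetric and disappears on antisymmetrization.
  have h5 : ∀ v w, fderiv ℝ (pullForm α ι c) x v w
      = fderiv ℝ (formInChart α m) (chartMap ι c m x) (fderiv ℝ (chartMap ι c m) x v)
          (fderiv ℝ (chartMap ι c m) x w)
        + formInChart α m (chartMap ι c m x) (fderiv ℝ (fderiv ℝ (chartMap ι c m)) x v w) := by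
    intro v w
    rw [h3.fderiv_eq, fderiv_clm_comp h1 h2, h4]
    simp
    ring
  have h6 : fderiv ℝ (fderiv ℝ (chartMap ι c m)) x v w
      = fderiv ℝ (fderiv ℝ (chartMap ι c m)) x w v :=
    (hF.isSymmSndFDerivAt (by
      rw [minSmoothness_of_isRCLikeNormedField]
      exact WithTop.coe_le_coe.2 (le_top : (2 : ℕ∞) ≤ ⊤))) v w
  rw [h5, h5, h6, add_sub_add_right_eq_sub, fderiv_chartMap hι hx hm, fderiv_chartMap hι hx hm]
  rfl

end PullBack

end ContactSR

/-! ### The characteristic set and the surface density -/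

namespace ContactSR

/-- In the charts adapted to the immersion the map is a linear injection, and derivatives of charts
are injective. -/
theorem mfderiv_injective_of_isImmersionAt {M : Type*} [TopologicalSpace M]
    [ChartedSpace (EuclideanSpace ℝ (Fin 3)) M] [IsManifold (𝓡 3) ∞ M]
    {S : Type*} [TopologicalSpace S] [ChartedSpace (EuclideanSpace ℝ (Fin 2)) S]
    [IsManifold (𝓡 2) ∞ S] {ι : S → M} {q : S} (h : IsImmersionAt (𝓡 2) (𝓡 3) ∞ ι q) :
    Function.Injective (mfderiv (𝓡 2) (𝓡 3) ι q) := by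
  have : IsManifold (𝓡 2) 1 S := IsManifold.of_le (n := ∞) (by simp)
  have hdom := contMDiffAt_of_mem_maximalAtlas h.domChart_mem_maximalAtlas h.mem_domChart_source
  have hcod := contMDiffAt_of_mem_maximalAtlas h.codChart_mem_maximalAtlas h.mem_codChart_source
  have hdom' : MDifferentiableAt (𝓡 2) (𝓡 2) h.domChart q := hdom.mdifferentiableAt (by simp)
  have hcod' : MDifferentiableAt (𝓡 3) (𝓡 3) h.codChart (ι q) := hcod.mdifferentiableAt (by simp)
  have hι : MDifferentiableAt (𝓡 2) (𝓡 3) ι q := h.contMDiffAt.mdifferentiableAt (by simp)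
  have heq : h.codChart ∘ ι =ᶠ[𝓝 q]
      (h.equiv.toContinuousLinearMap.comp (ContinuousLinearMap.inl ℝ _ _)) ∘ h.domChart := by
    filter_upwards [h.domChart.open_source.mem_nhds h.mem_domChart_source] with y hy
    have hy' : y ∈ (h.domChart.extend (𝓡 2)).source := by
      rw [OpenPartialHomeomorph.extend_source]; exact hy
    have h1 := h.writtenInCharts ((h.domChart.extend (𝓡 2)).map_source hy')
    rw [Function.comp_apply, Function.comp_apply, (h.domChart.extend (𝓡 2)).left_inv hy'] at h1
    exact h1
  set T := h.equiv.toContinuousLinearMap.comp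
    (ContinuousLinearMap.inl ℝ (EuclideanSpace ℝ (Fin 2)) h.complement) with hT
  have hT' : Function.Injective T := by
    rw [hT]
    exact h.equiv.injective.comp (fun a b hab => congrArg Prod.fst hab)
  have hTd : HasMFDerivAt (𝓡 2) (𝓡 3) T (h.domChart q) T := T.hasMFDerivAt
  have h1 := hcod'.hasMFDerivAt.comp q hι.hasMFDerivAt
  have h2 := (hTd.comp q hdom'.hasMFDerivAt).congr_of_eventuallyEq heq
  have h3 := h1.mfderiv.symm.trans h2.mfderiv
  have h4 : Function.Injective (mfderiv (𝓡 2) (𝓡 2) h.domChart q) := by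
    have hd : h.domChart.MDifferentiable (𝓡 2) (𝓡 2) :=
      ⟨fun y hy => ((contMDiffAt_of_mem_maximalAtlas h.domChart_mem_maximalAtlas hy).mdifferentiableAt
        (by simp)).mdifferentiableWithinAt,
       fun y hy => ((contMDiffAt_symm_of_mem_maximalAtlas h.domChart_mem_maximalAtlas
        hy).mdifferentiableAt (by simp)).mdifferentiableWithinAt⟩
    exact hd.mfderiv_injective h.mem_domChart_source
  intro v w hvw
  apply h4
  apply hT'
  have h5 := congrArg (fun L => L v) h3
  have h6 := congrArg (fun L => L w) h3
  refine h5.symm.trans (Eq.trans ?_ h6)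
  exact congrArg (mfderiv (𝓡 3) (𝓡 3) h.codChart (ι q)) hvw

variable {M : Type*} [TopologicalSpace M] [ChartedSpace (EuclideanSpace ℝ (Fin 3)) M]
  [IsManifold (𝓡 3) ∞ M]
  {S : Type*} [TopologicalSpace S] [ChartedSpace (EuclideanSpace ℝ (Fin 2)) S]
  [IsManifold (𝓡 2) ∞ S]

namespace ContactSubRiemannian

variable (C : ContactSubRiemannian M)

theorem dα_swap (q : M) (v w : TangentSpace (𝓡 3) q) : C.dα q v w = -C.dα q w v := by
  simp only [dα, extDerivOneForm]; ring

theorem dα_self (q : M) (v : TangentSpace (𝓡 3) q) : C.dα q v v = 0 := by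
  simp only [dα, extDerivOneForm]; ring

theorem exists_bilinear_dα (q : M) : ∃ (T : EuclideanSpace ℝ (Fin 3) →L[ℝ]
    EuclideanSpace ℝ (Fin 3) →L[ℝ] ℝ) (φ : TangentSpace (𝓡 3) q →L[ℝ] EuclideanSpace ℝ (Fin 3)),
    ∀ v w, C.dα q v w = T (φ v) (φ w) - T (φ w) (φ v) :=
  ⟨_, dchart 3 q q, fun _ _ => rfl⟩

theorem dα_add_right (q : M) (v w w' : TangentSpace (𝓡 3) q) :
    C.dα q v (w + w') = C.dα q v w + C.dα q v w' := by
  obtain ⟨T, φ, h⟩ := C.exists_bilinear_dα q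
  simp only [h, map_add, add_apply]
  ring

theorem dα_smul_right (q : M) (v w : TangentSpace (𝓡 3) q) (t : ℝ) :
    C.dα q v (t • w) = t * C.dα q v w := by
  obtain ⟨T, φ, h⟩ := C.exists_bilinear_dα q
  simp only [h, map_smul, smul_apply, smul_eq_mul]
  ring

theorem finrank_D (q : M) : Module.finrank ℝ (C.D q) = 2 := by
  have h3 : Module.finrank ℝ (TangentSpace (𝓡 3) q) = 3 := finrank_euclideanSpace_fin (𝕜 := ℝ)
  have : FiniteDimensional ℝ (TangentSpace (𝓡 3) q) :=
    inferInstanceAs (FiniteDimensional ℝ (EuclideanSpace ℝ (Fin 3)))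
  have h1 := (C.α q).toLinearMap.finrank_range_add_finrank_ker
  have h2 : LinearMap.range (C.α q).toLinearMap = ⊤ := by
    rw [LinearMap.range_eq_top]
    refine LinearMap.surjective_of_ne_zero fun h => C.form_ne_zero q ?_
    ext v
    exact congrArg (fun L => L v) h
  rw [h2, h3, finrank_top, Module.finrank_self] at h1
  change Module.finrank ℝ (LinearMap.ker (C.α q).toLinearMap) = 2
  omega

variable {C} {ι : S → M}

omit [IsManifold (𝓡 2) ∞ S] in
theorem mem_charSet_iff {q : S} (hinj : Function.Injective (mfderiv (𝓡 2) (𝓡 3) ι q)) :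
    q ∈ C.charSet ι ↔ ∀ v, C.α (ι q) (mfderiv (𝓡 2) (𝓡 3) ι q v) = 0 := by
  have : FiniteDimensional ℝ (TangentSpace (𝓡 3) (ι q)) :=
    inferInstanceAs (FiniteDimensional ℝ (EuclideanSpace ℝ (Fin 3)))
  constructor
  · intro h v
    have h1 : mfderiv (𝓡 2) (𝓡 3) ι q v
        ∈ LinearMap.range (mfderiv (𝓡 2) (𝓡 3) ι q).toLinearMap := ⟨v, rfl⟩
    rw [show LinearMap.range (mfderiv (𝓡 2) (𝓡 3) ι q).toLinearMap = C.D (ι q) from h] at h1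
    exact h1
  · intro h
    refine Submodule.eq_of_le_of_finrank_eq ?_ ?_
    · rintro _ ⟨v, rfl⟩
      exact h v
    · rw [C.finrank_D, LinearMap.finrank_range_of_inj hinj]
      exact finrank_euclideanSpace_fin (𝕜 := ℝ)

theorem pullForm_ne_zero_iff (hι : Manifold.IsSmoothEmbedding (𝓡 2) (𝓡 3) ∞ ι) {c : S}
    {x : EuclideanSpace ℝ (Fin 2)} (hx : x ∈ (extChartAt (𝓡 2) c).target) :
    pullForm C.α ι c x ≠ 0 ↔ param 2 c x ∉ C.charSet ι := by
  rw [not_iff_comm, not_not,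
    mem_charSet_iff (mfderiv_injective_of_isImmersionAt (hι.isImmersion.isImmersionAt _))]
  constructor
  · intro h
    ext v
    exact h _
  · intro h v
    have := congrArg (fun L => L (dchart 2 c (param 2 c x) v)) h
    simp only [pullForm, ContinuousLinearMap.comp_apply, dparam_dchart c hx] at this
    exact this

theorem isOpen_compl_charSet (hι : Manifold.IsSmoothEmbedding (𝓡 2) (𝓡 3) ∞ ι) :
    IsOpen (C.charSet ι)ᶜ := by
  rw [isOpen_iff_mem_nhds]
  intro q hq
  have hs : q ∈ (extChartAt (𝓡 2) q).source := mem_extChartAt_source q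
  have ht : chart 2 q q ∈ (extChartAt (𝓡 2) q).target := (extChartAt (𝓡 2) q).map_source hs
  have hqq : param 2 q (chart 2 q q) = q := (extChartAt (𝓡 2) q).left_inv hs
  have h1 : pullForm C.α ι q (chart 2 q q) ≠ 0 :=
    (pullForm_ne_zero_iff hι ht).2 (by rw [hqq]; exact hq)
  have h2 := (contDiffAt_pullForm C.smooth_form hι.contMDiff ht).continuousAt.eventually_ne h1
  have h3 : ContinuousAt (chart 2 q) q := (mdifferentiableAt_chart q hs).continuousAt
  filter_upwards [h3.eventually h2, (isOpen_extChartAt_source q).mem_nhds hs] with y hy hys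
  have h4 := (pullForm_ne_zero_iff hι ((extChartAt (𝓡 2) q).map_source hys)).1 hy
  rwa [show param 2 q (chart 2 q y) = y from (extChartAt (𝓡 2) q).left_inv hys] at h4

/-- The surface density of a basis `e₀, e₁` contracted with the unit characteristic field is, up to
sign, the restriction of the contact form. -/
theorem surfaceDensity_mul {N : (q : S) → C.D (ι q)} (hN : C.IsHorizontalUnitNormal ι N)
    {Xh : (q : S) → TangentSpace (𝓡 2) q} (hXh : C.IsUnitCharField ι Xh) {q : S}
    (hq : q ∉ C.charSet ι) {e₀ e₁ : TangentSpace (𝓡 2) q} {a₀ a₁ : ℝ}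
    (ha : Xh q = a₀ • e₀ + a₁ • e₁) :
    ∃ σ : ℝ, (σ = 1 ∨ σ = -1) ∧
      C.surfaceDensity ι N q e₀ e₁ * a₀ = σ * C.α (ι q) (mfderiv (𝓡 2) (𝓡 3) ι q e₁) ∧
      C.surfaceDensity ι N q e₀ e₁ * a₁ = -σ * C.α (ι q) (mfderiv (𝓡 2) (𝓡 3) ι q e₀) := by
  obtain ⟨hmem, hunit⟩ := hXh.unit q hq
  obtain ⟨hN1, hNorth⟩ := hN q hq
  -- `N` and the characteristic field form an orthonormal basis of `D`, on which `dα` is `±1`.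
  have hδ := C.normalized (ι q) (N q) (C.pushD ι q ⟨Xh q, hmem⟩) hN1 hunit (hNorth _)
  set L := mfderiv (𝓡 2) (𝓡 3) ι q with hL
  change |C.dα (ι q) (N q) (L (Xh q))| = 1 at hδ
  have hα : C.α (ι q) (L (Xh q)) = 0 := hmem
  have hαN : C.α (ι q) (N q) = 0 := (N q).2
  rw [ha, map_add, map_smul, map_smul] at hδ hα
  rw [dα_add_right, dα_smul_right, dα_smul_right] at hδ
  rw [map_add, map_smul, map_smul, smul_eq_mul, smul_eq_mul] at hα
  set A₀ := C.α (ι q) (L e₀)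
  set A₁ := C.α (ι q) (L e₁)
  set l₀ := C.dα (ι q) (N q) (L e₀)
  set l₁ := C.dα (ι q) (N q) (L e₁)
  have hP : C.surfaceDensity ι N q e₀ e₁ = |l₀ * A₁ - l₁ * A₀| := by
    simp only [surfaceDensity, popp, ← hL]
    rw [hαN, C.dα_swap (ι q) (L e₁) (N q)]
    congr 1
    simp only [A₀, A₁, l₀, l₁]
    ring
  rw [hP]
  set P := l₀ * A₁ - l₁ * A₀ with hPdef
  -- By `α(Xh) = a₀ A₀ + a₁ A₁ = 0`, multiplying `P` by a coordinate of `Xh` produces `dα(N, Xh) =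
  -- a₀ l₀ + a₁ l₁ = ±1` times the value of `α` on the other basis vector.
  have h0 : P * a₀ = (a₀ * l₀ + a₁ * l₁) * A₁ := by linear_combination -l₁ * hα
  have h1 : P * a₁ = -(a₀ * l₀ + a₁ * l₁) * A₀ := by linear_combination l₀ * hα
  rcases abs_eq (zero_le_one' ℝ) |>.1 hδ with hd | hd <;> rw [hd] at h0 h1 <;>
    rcases abs_choice P with hp | hp <;> rw [hp]
  · exact ⟨1, Or.inl rfl, by linarith, by linarith⟩
  · exact ⟨-1, Or.inr rfl, by linarith, by linarith⟩
  · exact ⟨-1, Or.inr rfl, by linarith, by linarith⟩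
  · exact ⟨1, Or.inl rfl, by linarith, by linarith⟩

end ContactSubRiemannian

end ContactSR

/-! ### The divergence of the unit characteristic field -/

namespace ContactSR

variable {M : Type*} [TopologicalSpace M] [ChartedSpace (EuclideanSpace ℝ (Fin 3)) M]
  [IsManifold (𝓡 3) ∞ M]
  {S : Type*} [TopologicalSpace S] [ChartedSpace (EuclideanSpace ℝ (Fin 2)) S]
  [IsManifold (𝓡 2) ∞ S]

theorem euclidean_two_eq (v : EuclideanSpace ℝ (Fin 2)) :
    v = v 0 • EuclideanSpace.single (0 : Fin 2) (1 : ℝ)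
      + v 1 • EuclideanSpace.single (1 : Fin 2) (1 : ℝ) := by
  ext i
  fin_cases i <;> simp

namespace ContactSubRiemannian

variable {C : ContactSubRiemannian M} {ι : S → M} {N : (q : S) → C.D (ι q)}
  {Xh : (q : S) → TangentSpace (𝓡 2) q}

theorem contDiffAt_coordField_charField (hι : Manifold.IsSmoothEmbedding (𝓡 2) (𝓡 3) ∞ ι)
    (hXh : C.IsUnitCharField ι Xh) {c q : S} (hc : q ∈ (extChartAt (𝓡 2) c).source)
    (hq : q ∉ C.charSet ι) : ContDiffAt ℝ ∞ (coordField c Xh) (chart 2 c q) :=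
  contDiffAt_coordField c hc
    (hXh.smooth.contMDiffAt ((isOpen_compl_charSet hι).mem_nhds hq))

/-- The coordinates of the unit characteristic field annihilate the pulled back contact form. -/
theorem pullForm_coordField (hXh : C.IsUnitCharField ι Xh) {c : S} {x : EuclideanSpace ℝ (Fin 2)}
    (hx : x ∈ (extChartAt (𝓡 2) c).target) (hq : param 2 c x ∉ C.charSet ι) :
    pullForm C.α ι c x (coordField c Xh x) = 0 := by
  obtain ⟨h, -⟩ := hXh.unit _ hq
  simp only [pullForm, ContinuousLinearMap.comp_apply, dparam_coordField c Xh hx]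
  exact h

/-- The divergence of the unit characteristic field is `dα(X, W) / α(W)`, for every tangent vector
`W` that is transverse to the characteristic direction. -/
theorem divergence_eq (hι : Manifold.IsSmoothEmbedding (𝓡 2) (𝓡 3) ∞ ι)
    (hN : C.IsHorizontalUnitNormal ι N) (hXh : C.IsUnitCharField ι Xh) {q : S}
    (hq : q ∉ C.charSet ι) (ε : ℝ) (W : TangentSpace (𝓡 2) q)
    (hW : C.α (ι q) (mfderiv (𝓡 2) (𝓡 3) ι q W) ≠ 0) :
    divergence (C.surfaceDensity ι N) (fun q => ε • Xh q) q
      = ε * C.dα (ι q) (mfderiv (𝓡 2) (𝓡 3) ι q (Xh q)) (mfderiv (𝓡 2) (𝓡 3) ι q W)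
        / C.α (ι q) (mfderiv (𝓡 2) (𝓡 3) ι q W) := by
  have hs : q ∈ (extChartAt (𝓡 2) q).source := mem_extChartAt_source q
  obtain ⟨x₀, hx₀def⟩ : ∃ x₀, x₀ = chart 2 q q := ⟨_, rfl⟩
  have ht : x₀ ∈ (extChartAt (𝓡 2) q).target := hx₀def ▸ (extChartAt (𝓡 2) q).map_source hs
  have hqq : param 2 q x₀ = q := by rw [hx₀def]; exact (extChartAt (𝓡 2) q).left_inv hs
  set e : Fin 2 → EuclideanSpace ℝ (Fin 2) := fun i => EuclideanSpace.single i 1 with he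
  set A := pullForm C.α ι q with hA
  set a := coordField q Xh with ha
  set ρ : EuclideanSpace ℝ (Fin 2) → ℝ := fun x =>
    C.surfaceDensity ι N (param 2 q x) (dparam 2 q x (e 0)) (dparam 2 q x (e 1)) with hρ
  have hAne : A x₀ ≠ 0 := (pullForm_ne_zero_iff hι ht).2 (by rw [hqq]; exact hq)
  have hAsm := contDiffAt_pullForm C.smooth_form hι.contMDiff ht (c := q)
  have hasm : ContDiffAt ℝ ∞ a x₀ := by
    rw [hx₀def]; exact contDiffAt_coordField_charField hι hXh hs hq
  have hgood : ∀ᶠ x in 𝓝 x₀, x ∈ (extChartAt (𝓡 2) q).target ∧ A x ≠ 0 :=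
    Filter.Eventually.and ((isOpen_extChartAt_target q).mem_nhds ht)
      (hAsm.continuousAt.eventually_ne hAne)
  have hAe : ∀ x v, A x v = v 0 * A x (e 0) + v 1 * A x (e 1) := fun x v => by
    conv_lhs => rw [euclidean_two_eq v]
    simp [he]
  -- the pointwise identity
  have hpt : ∀ x, x ∈ (extChartAt (𝓡 2) q).target → A x ≠ 0 → ∃ σ : ℝ, (σ = 1 ∨ σ = -1) ∧
      ρ x * a x 0 = σ * A x (e 1) ∧ ρ x * a x 1 = -σ * A x (e 0) ∧ 0 < ρ x := by
    intro x hx hAx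
    have hqx := (pullForm_ne_zero_iff hι hx).1 hAx
    obtain ⟨σ, hσ, h0, h1⟩ := surfaceDensity_mul hN hXh hqx (e₀ := dparam 2 q x (e 0))
      (e₁ := dparam 2 q x (e 1)) (a₀ := a x 0) (a₁ := a x 1) (by
        rw [← dparam_coordField q Xh hx]
        conv_lhs => rw [euclidean_two_eq (coordField q Xh x)]
        rw [map_add, map_smul, map_smul])
    refine ⟨σ, hσ, h0, h1, ?_⟩
    refine lt_of_le_of_ne (abs_nonneg _) fun hρ0 => hAx ?_
    have hσ0 : σ ≠ 0 := by rcases hσ with h | h <;> rw [h] <;> norm_num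
    have h2 : A x (e 1) = 0 := by
      have : σ * A x (e 1) = 0 := by
        rw [show σ * A x (e 1) = _ from h0.symm]
        exact mul_eq_zero_of_left hρ0.symm _
      exact (mul_eq_zero.1 this).resolve_left hσ0
    have h3 : A x (e 0) = 0 := by
      have : -σ * A x (e 0) = 0 := by
        rw [show -σ * A x (e 0) = _ from h1.symm]
        exact mul_eq_zero_of_left hρ0.symm _
      exact (mul_eq_zero.1 this).resolve_left (neg_ne_zero.2 hσ0)
    ext v
    rw [hAe, h2, h3]
    simp
  obtain ⟨σ, hσ, hσ0, hσ1, hρpos⟩ := hpt x₀ ht hAne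
  have hσσ : σ * σ = 1 := by rcases hσ with h | h <;> rw [h] <;> norm_num
  -- the sign is locally constant
  set τ : EuclideanSpace ℝ (Fin 2) → ℝ := fun x => a x 0 * A x (e 1) - a x 1 * A x (e 0) with hτ
  have hsum : ∀ x, A x ≠ 0 → 0 < A x (e 1) ^ 2 + A x (e 0) ^ 2 := fun x hx => by
    by_contra! hle
    refine hx ?_
    have h0 : A x (e 0) = 0 := by nlinarith [sq_nonneg (A x (e 0)), sq_nonneg (A x (e 1))]
    have h1 : A x (e 1) = 0 := by nlinarith [sq_nonneg (A x (e 0)), sq_nonneg (A x (e 1))]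
    ext v
    rw [hAe, h0, h1]
    simp
  have hτc : ContinuousAt τ x₀ := by
    have h1 : ∀ i, ContinuousAt (fun x => a x i) x₀ := fun i =>
      (PiLp.continuous_apply 2 (fun _ : Fin 2 => ℝ) i).continuousAt.comp hasm.continuousAt
    have h2 : ∀ v, ContinuousAt (fun x => A x v) x₀ := fun v =>
      hAsm.continuousAt.clm_apply continuousAt_const
    exact ((h1 0).mul (h2 _)).sub ((h1 1).mul (h2 _))
  -- Since `ρ σ τ = A(e₁)² + A(e₀)² > 0`, the sign `σ` is the sign of `τ`, which is continuous.
  have hτ0 : 0 < σ * τ x₀ := by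
    have h1 : ρ x₀ * (σ * τ x₀) = A x₀ (e 1) ^ 2 + A x₀ (e 0) ^ 2 := by
      simp only [hτ]
      linear_combination σ * A x₀ (e 1) * hσ0 - σ * A x₀ (e 0) * hσ1
        + (A x₀ (e 1) ^ 2 + A x₀ (e 0) ^ 2) * hσσ
    by_contra! hle
    have := hsum x₀ hAne
    nlinarith
  -- `N` is not assumed continuous. Only the products `ρ a` are differentiated, and with a fixed
  -- sign they are coefficients of the smooth form `A`.
  have hloc : ∀ᶠ x in 𝓝 x₀, ρ x * a x 0 = σ * A x (e 1) ∧ ρ x * a x 1 = -σ * A x (e 0) := by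
    filter_upwards [hgood, (hτc.const_mul σ).eventually_const_lt hτ0] with x hx hτx
    obtain ⟨σ', hσ', h0, h1, hρx⟩ := hpt x hx.1 hx.2
    have hσσ' : σ' * σ' = 1 := by rcases hσ' with h | h <;> rw [h] <;> norm_num
    have h2 : ρ x * (σ' * τ x) = A x (e 1) ^ 2 + A x (e 0) ^ 2 := by
      simp only [hτ]
      linear_combination σ' * A x (e 1) * h0 - σ' * A x (e 0) * h1
        + (A x (e 1) ^ 2 + A x (e 0) ^ 2) * hσσ'
    have h3 : 0 < σ' * τ x := by
      by_contra! hle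
      have := hsum x hx.2
      nlinarith
    have h4 : σ' = σ := by
      rcases hσ with rfl | rfl <;> rcases hσ' with rfl | rfl <;> first | rfl | (exfalso; linarith)
    rw [← h4]
    exact ⟨h0, h1⟩
  -- differentiation
  have hAd : ∀ v w, fderiv ℝ (fun x => A x v) x₀ w = fderiv ℝ A x₀ w v := fun v w => by
    rw [fderiv_clm_apply (hAsm.differentiableAt (by simp)) (differentiableAt_const v)]
    simp
    rfl
  have hdiv : divergence (C.surfaceDensity ι N) (fun q => ε • Xh q) q
      = (ρ x₀)⁻¹ * ∑ i, fderiv ℝ (fun x => ρ x * (ε • a x) i) x₀ (e i) := by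
    rw [hx₀def]
    simp only [divergence, hρ, ha, coordField]
    congr 1
    refine Finset.sum_congr rfl fun i _ => ?_
    congr 2
    funext x
    exact congrArg (fun v : EuclideanSpace ℝ (Fin 2) => _ * v i)
      ((dchart 2 q (param 2 q x)).map_smul ε (Xh (param 2 q x)))
  have hAdiff : ∀ v, DifferentiableAt ℝ (fun x => A x v) x₀ := fun v =>
    (hAsm.differentiableAt (by simp)).clm_apply (differentiableAt_const v)
  have hd0 : fderiv ℝ (fun x => ρ x * (ε • a x) 0) x₀ (e 0)
      = ε * σ * fderiv ℝ A x₀ (e 0) (e 1) := by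
    have : (fun x => ρ x * (ε • a x) 0) =ᶠ[𝓝 x₀] fun x => (ε * σ) * A x (e 1) := by
      filter_upwards [hloc] with x hx
      simp only [PiLp.smul_apply, smul_eq_mul]
      linear_combination ε * hx.1
    rw [this.fderiv_eq, fderiv_const_mul (hAdiff _), smul_apply, hAd, smul_eq_mul]
  have hd1 : fderiv ℝ (fun x => ρ x * (ε • a x) 1) x₀ (e 1)
      = -(ε * σ) * fderiv ℝ A x₀ (e 1) (e 0) := by
    have : (fun x => ρ x * (ε • a x) 1) =ᶠ[𝓝 x₀] fun x => (-(ε * σ)) * A x (e 0) := by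
      filter_upwards [hloc] with x hx
      simp only [PiLp.smul_apply, smul_eq_mul]
      linear_combination ε * hx.2
    rw [this.fderiv_eq, fderiv_const_mul (hAdiff _), smul_apply, hAd, smul_eq_mul]
  rw [hdiv, Fin.sum_univ_two, hd0, hd1]
  -- comparison with the invariant expression
  obtain ⟨w, hw⟩ : ∃ w, w = dchart 2 q q W := ⟨_, rfl⟩
  -- The points `param 2 q x₀` and `q` are equal but not definitionally, so tangent vectors at them
  -- are compared in the total space.
  have hpush : ∀ v : EuclideanSpace ℝ (Fin 2), ∀ V : TangentSpace (𝓡 2) q, v = dchart 2 q q V →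
      (⟨param 2 q x₀, dparam 2 q x₀ v⟩ : TangentBundle (𝓡 2) S) = ⟨q, V⟩ := by
    rintro v V rfl
    have h1 : ∀ y (hy : y ∈ (extChartAt (𝓡 2) q).target), ∀ r (hr : param 2 q y = r)
        (V : TangentSpace (𝓡 2) r), (⟨param 2 q y, dparam 2 q y (dchart 2 q r V)⟩ :
          TangentBundle (𝓡 2) S) = ⟨r, V⟩ := by
      rintro y hy r rfl V
      rw [dparam_dchart q hy]
    exact h1 x₀ ht q hqq V
  have hinv : ∀ (Q : S) (V₁ V₂ : TangentSpace (𝓡 2) Q) (R : S) (U₁ U₂ : TangentSpace (𝓡 2) R),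
      (⟨Q, V₁⟩ : TangentBundle (𝓡 2) S) = ⟨R, U₁⟩ → (⟨Q, V₂⟩ : TangentBundle (𝓡 2) S) = ⟨R, U₂⟩ →
      C.dα (ι Q) (mfderiv (𝓡 2) (𝓡 3) ι Q V₁) (mfderiv (𝓡 2) (𝓡 3) ι Q V₂)
        = C.dα (ι R) (mfderiv (𝓡 2) (𝓡 3) ι R U₁) (mfderiv (𝓡 2) (𝓡 3) ι R U₂) ∧
      C.α (ι Q) (mfderiv (𝓡 2) (𝓡 3) ι Q V₂) = C.α (ι R) (mfderiv (𝓡 2) (𝓡 3) ι R U₂) := by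
    rintro Q V₁ V₂ R U₁ U₂ h1 h2
    obtain rfl : Q = R := congrArg Bundle.TotalSpace.proj h1
    obtain rfl : V₁ = U₁ := by simpa using h1
    obtain rfl : V₂ = U₂ := by simpa using h2
    exact ⟨rfl, rfl⟩
  have hax : a x₀ = dchart 2 q q (Xh q) := by
    have : ∀ r, r = q → dchart 2 q r (Xh r) = dchart 2 q q (Xh q) := by rintro r rfl; rfl
    exact this _ hqq
  obtain ⟨hd, hα⟩ := hinv _ _ _ _ _ _ (hpush (a x₀) (Xh q) hax) (hpush w W hw)
  have hd' := extDeriv_pullForm C.smooth_form hι.contMDiff ht (a x₀) w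
  rw [show extDerivOneForm C.α (ι (param 2 q x₀)) = C.dα (ι (param 2 q x₀)) from rfl, hd] at hd'
  have hα' : A x₀ w = C.α (ι q) (mfderiv (𝓡 2) (𝓡 3) ι q W) := hα
  rw [← hα'] at hW ⊢
  rw [hd']
  -- By bilinearity `dA(a, w) = (a₀ w₁ - a₁ w₀) dA(e₀, e₁)`, while `ρ (a₀ w₁ - a₁ w₀) = σ A(w)`;
  -- together they turn the coordinate divergence into the invariant quotient.
  have hbil : ∀ v u, fderiv ℝ A x₀ v u = v 0 * (u 0 * fderiv ℝ A x₀ (e 0) (e 0)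
      + u 1 * fderiv ℝ A x₀ (e 0) (e 1)) + v 1 * (u 0 * fderiv ℝ A x₀ (e 1) (e 0)
      + u 1 * fderiv ℝ A x₀ (e 1) (e 1)) := fun v u => by
    conv_lhs => rw [euclidean_two_eq v, euclidean_two_eq u]
    simp [he]
  rw [← hA, hbil (a x₀) w, hbil w (a x₀), inv_mul_eq_div, div_eq_div_iff hρpos.ne' hW, hAe x₀ w]
  linear_combination (ε * (fderiv ℝ A x₀ (e 0) (e 1) - fderiv ℝ A x₀ (e 1) (e 0))) *
    (-w 1 * hσ0 + w 0 * hσ1)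

end ContactSubRiemannian

end ContactSR

/-! ### Leaves and their drift coefficient in a fixed chart -/

namespace ContactSR

variable {M : Type*} [TopologicalSpace M] [ChartedSpace (EuclideanSpace ℝ (Fin 3)) M]
  [IsManifold (𝓡 3) ∞ M]
  {S : Type*} [TopologicalSpace S] [ChartedSpace (EuclideanSpace ℝ (Fin 2)) S]
  [IsManifold (𝓡 2) ∞ S]

namespace ContactSubRiemannian

variable {C : ContactSubRiemannian M} {ι : S → M} {N : (q : S) → C.D (ι q)}
  {Xh : (q : S) → TangentSpace (𝓡 2) q} {ε : ℝ} {ℓ : Set S} {p : S} {a : EReal} {γ : ℝ → S}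

omit [IsManifold (𝓡 2) ∞ S] in
theorem IsArcLength.notMem_charSet (hγ : C.IsArcLength ι Xh ε ℓ p a γ) {s : ℝ}
    (hs : s ∈ openInterval a) : γ s ∉ C.charSet ι := by
  obtain ⟨q, -, hℓ⟩ := hγ.leaf
  have h1 : γ s ∈ C.leafThrough ι q := hℓ ▸ hγ.bijOn.mapsTo hs
  obtain ⟨c, -, hc, h⟩ := h1
  rw [← hc]
  exact (h 1 (right_mem_Icc.2 zero_le_one)).1

omit [IsManifold (𝓡 2) ∞ S] in
theorem IsArcLength.hasMFDerivAt (hγ : C.IsArcLength ι Xh ε ℓ p a γ) {s : ℝ}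
    (hs : s ∈ openInterval a) :
    HasMFDerivAt 𝓘(ℝ, ℝ) (𝓡 2) γ s ((1 : ℝ →L[ℝ] ℝ).smulRight (ε • Xh (γ s))) :=
  (hγ.velocity s hs).hasMFDerivAt ((isOpen_openInterval a).mem_nhds hs)

theorem IsArcLength.hasDerivAt_chart (hγ : C.IsArcLength ι Xh ε ℓ p a γ) {s : ℝ}
    (hs : s ∈ openInterval a) {c : S} (hc : γ s ∈ (extChartAt (𝓡 2) c).source) :
    HasDerivAt (fun t => chart 2 c (γ t)) (ε • coordField c Xh (chart 2 c (γ s))) s := by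
  have h1 := (mdifferentiableAt_chart c hc).hasMFDerivAt.comp s (hγ.hasMFDerivAt hs)
  have h2 : HasFDerivAt (fun t => chart 2 c (γ t)) ((1 : ℝ →L[ℝ] ℝ).smulRight
      (ε • coordField c Xh (chart 2 c (γ s)))) s := by
    refine hasMFDerivAt_iff_hasFDerivAt.1 (h1.congr_mfderiv ?_)
    rw [coordField_chart hc]
    ext
    change dchart 2 c (γ s) ((1 : ℝ) • (ε • Xh (γ s))) = (1 : ℝ) • ε • dchart 2 c (γ s) (Xh (γ s))
    rw [one_smul, one_smul, map_smul]
  simpa using h2.hasDerivAt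

/-- By definition the divergence at `γ s` is computed in the chart centred at `γ s`, which moves
with `s`. The invariant formula transfers it to one fixed chart, where it can be differentiated in
`s` and estimated as `s → 0`. -/
theorem IsArcLength.driftCoeff_eq (hγ : C.IsArcLength ι Xh ε ℓ p a γ)
    (hι : Manifold.IsSmoothEmbedding (𝓡 2) (𝓡 3) ∞ ι)
    (hN : C.IsHorizontalUnitNormal ι N) (hXh : C.IsUnitCharField ι Xh) {s : ℝ}
    (hs : s ∈ openInterval a) {c : S} (hc : γ s ∈ (extChartAt (𝓡 2) c).source)
    {w : EuclideanSpace ℝ (Fin 2)} (hw : pullForm C.α ι c (chart 2 c (γ s)) w ≠ 0) :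
    C.driftCoeff ι N Xh ε γ s = ε *
      (fderiv ℝ (pullForm C.α ι c) (chart 2 c (γ s)) (coordField c Xh (chart 2 c (γ s))) w
        - fderiv ℝ (pullForm C.α ι c) (chart 2 c (γ s)) w (coordField c Xh (chart 2 c (γ s))))
      / pullForm C.α ι c (chart 2 c (γ s)) w := by
  have hq := hγ.notMem_charSet hs
  rw [driftCoeff]
  obtain ⟨x, hx, hxq⟩ : ∃ x ∈ (extChartAt (𝓡 2) c).target, param 2 c x = γ s :=
    ⟨chart 2 c (γ s), (extChartAt (𝓡 2) c).map_source hc, (extChartAt (𝓡 2) c).left_inv hc⟩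
  rw [← hxq] at hw hq ⊢
  have hxx : chart 2 c (param 2 c x) = x := (extChartAt (𝓡 2) c).right_inv hx
  rw [hxx] at hw ⊢
  rw [divergence_eq hι hN hXh hq ε (dparam 2 c x w) hw]
  rw [← dparam_coordField c Xh hx, ← extDeriv_pullForm C.smooth_form hι.contMDiff hx]
  rfl

theorem IsArcLength.differentiableAt_driftCoeff (hγ : C.IsArcLength ι Xh ε ℓ p a γ)
    (hι : Manifold.IsSmoothEmbedding (𝓡 2) (𝓡 3) ∞ ι)
    (hN : C.IsHorizontalUnitNormal ι N) (hXh : C.IsUnitCharField ι Xh) {s : ℝ}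
    (hs : s ∈ openInterval a) : DifferentiableAt ℝ (C.driftCoeff ι N Xh ε γ) s := by
  set c := γ s with hcdef
  have hc : γ s ∈ (extChartAt (𝓡 2) c).source := mem_extChartAt_source _
  have ht : chart 2 c (γ s) ∈ (extChartAt (𝓡 2) c).target := (extChartAt (𝓡 2) c).map_source hc
  have hleft : param 2 c (chart 2 c (γ s)) = γ s := (extChartAt (𝓡 2) c).left_inv hc
  have hne : pullForm C.α ι c (chart 2 c (γ s)) ≠ 0 :=
    (pullForm_ne_zero_iff hι ht).2 (by rw [hleft]; exact hγ.notMem_charSet hs)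
  obtain ⟨w, hw⟩ : ∃ w, pullForm C.α ι c (chart 2 c (γ s)) w ≠ 0 := by
    by_contra! h
    exact hne (by ext v; exact h v)
  have hx := hγ.hasDerivAt_chart hs hc
  have hA := contDiffAt_pullForm C.smooth_form hι.contMDiff ht (c := c)
  have hAx : DifferentiableAt ℝ (fun t => pullForm C.α ι c (chart 2 c (γ t))) s :=
    DifferentiableAt.comp (g := pullForm C.α ι c) s (hA.differentiableAt (by simp))
      hx.differentiableAt
  have hDAx : DifferentiableAt ℝ (fun t => fderiv ℝ (pullForm C.α ι c) (chart 2 c (γ t))) s :=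
    DifferentiableAt.comp (g := fderiv ℝ (pullForm C.α ι c)) s
      ((hA.fderiv_right (m := ∞) (by simp)).differentiableAt (by simp)) hx.differentiableAt
  have hax : DifferentiableAt ℝ (fun t => coordField c Xh (chart 2 c (γ t))) s :=
    DifferentiableAt.comp (g := coordField c Xh) s
      ((contDiffAt_coordField_charField hι hXh hc (hγ.notMem_charSet hs)).differentiableAt
        (by simp)) hx.differentiableAt
  have hAw : DifferentiableAt ℝ (fun t => pullForm C.α ι c (chart 2 c (γ t)) w) s :=
    hAx.clm_apply (differentiableAt_const w)
  have hd := ((((hDAx.clm_apply hax).clm_apply (differentiableAt_const w)).sub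
    ((hDAx.clm_apply (differentiableAt_const w)).clm_apply hax)).const_mul ε).div hAw hw
  refine hd.congr_of_eventuallyEq ?_
  filter_upwards [(isOpen_openInterval a).mem_nhds hs,
    (hγ.hasMFDerivAt hs).continuousAt.preimage_mem_nhds ((isOpen_extChartAt_source c).mem_nhds hc),
    hAw.continuousAt.eventually_ne hw] with t h1 h2 h3
  exact hγ.driftCoeff_eq hι hN hXh h1 h2 h3

end ContactSubRiemannian

end ContactSR

/-! ### From a planar one-form with a zero to a singular curve -/

namespace ContactSR

/-- Differentiability of the derivative at `x₀` bounds its increment by `K ‖x - x₀‖` on the ball of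
that radius, and the mean value inequality gives one more power. -/
theorem exists_quadratic_remainder {E F : Type*} [NormedAddCommGroup E] [NormedSpace ℝ E]
    [NormedAddCommGroup F] [NormedSpace ℝ F] {f : E → F} {x₀ : E} (hf : ContDiffAt ℝ 2 f x₀) :
    ∃ K ≥ 0, ∀ᶠ x in 𝓝 x₀, ‖f x - f x₀ - fderiv ℝ f x₀ (x - x₀)‖ ≤ K * ‖x - x₀‖ ^ 2 := by
  have h1 : DifferentiableAt ℝ (fderiv ℝ f) x₀ :=
    (hf.fderiv_right (m := 1) (by norm_num)).differentiableAt (by simp)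
  obtain ⟨K, hK0, hK⟩ := h1.hasFDerivAt.isBigO_sub.exists_nonneg
  have h2 : ∀ᶠ x in 𝓝 x₀, DifferentiableAt ℝ f x :=
    (hf.eventually (by simp)).mono fun x hx => hx.differentiableAt (by simp)
  obtain ⟨r, hr, hball⟩ := Metric.eventually_nhds_iff_ball.1 (h2.and hK.bound)
  refine ⟨K, hK0, ?_⟩
  filter_upwards [Metric.ball_mem_nhds x₀ hr] with x hx
  have hsub : Metric.closedBall x₀ ‖x - x₀‖ ⊆ Metric.ball x₀ r :=
    Metric.closedBall_subset_ball (by simpa [dist_eq_norm] using hx)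
  have h3 := (convex_closedBall x₀ ‖x - x₀‖).norm_image_sub_le_of_norm_hasFDerivWithin_le
    (f := fun y => f y - fderiv ℝ f x₀ y) (f' := fun y => fderiv ℝ f y - fderiv ℝ f x₀)
    (C := K * ‖x - x₀‖) (x := x₀) (y := x)
    (fun y hy => ((hball y (hsub hy)).1.hasFDerivAt.sub
      (fderiv ℝ f x₀).hasFDerivAt).hasFDerivWithinAt)
    (fun y hy => ((hball y (hsub hy)).2).trans (mul_le_mul_of_nonneg_left
      (by simpa [dist_eq_norm] using hy) hK0))
    (Metric.mem_closedBall_self (norm_nonneg _)) (by simp [dist_eq_norm])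
  calc ‖f x - f x₀ - fderiv ℝ f x₀ (x - x₀)‖
      = ‖f x - fderiv ℝ f x₀ x - (f x₀ - fderiv ℝ f x₀ x₀)‖ := by
        rw [map_sub]; congr 1; abel
    _ ≤ K * ‖x - x₀‖ * ‖x - x₀‖ := h3
    _ = _ := by ring

/-- A curve tangent to the kernel of a one-form in the plane that vanishes at `x₀` is a singular
curve in the linear coordinates `V`; the linear part is read off from the derivative of the
form. -/
theorem isSingularCurve_of_form
    {A : EuclideanSpace ℝ (Fin 2) → EuclideanSpace ℝ (Fin 2) →L[ℝ] ℝ}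
    {x₀ : EuclideanSpace ℝ (Fin 2)} (hA : ContDiffAt ℝ ∞ A x₀) (hA0 : A x₀ = 0)
    (V : EuclideanSpace ℝ (Fin 2) ≃L[ℝ] EuclideanSpace ℝ (Fin 2))
    {H : Matrix (Fin 2) (Fin 2) ℝ} {c δ : ℝ} (hc : c ≠ 0) (hδ : δ * δ = 1)
    (hH : ∀ i j, H i j = -c * fderiv ℝ A x₀ (V (EuclideanSpace.single i 1))
      (V (EuclideanSpace.single j 1)))
    (htr : H 1 0 - H 0 1 = δ)
    {B : EuclideanSpace ℝ (Fin 2) →L[ℝ] EuclideanSpace ℝ (Fin 2)}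
    (hB0 : ∀ y : EuclideanSpace ℝ (Fin 2), B y 0 = -δ * (y 0 * H 0 1 + y 1 * H 1 1))
    (hB1 : ∀ y : EuclideanSpace ℝ (Fin 2), B y 1 = δ * (y 0 * H 0 0 + y 1 * H 1 0))
    {x x' : ℝ → EuclideanSpace ℝ (Fin 2)} {b : ℝ → ℝ}
    (hx : ∀ᶠ s in 𝓝[>] (0 : ℝ), HasDerivAt x (x' s) s)
    (hx' : ∀ᶠ s in 𝓝[>] (0 : ℝ), ContinuousAt x' s)
    (hlim : Tendsto x (𝓝[>] 0) (𝓝 x₀))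
    (hker : ∀ᶠ s in 𝓝[>] (0 : ℝ), A (x s) (x' s) = 0)
    (hne : ∀ᶠ s in 𝓝[>] (0 : ℝ), A (x s) ≠ 0)
    (hb : ∀ᶠ s in 𝓝[>] (0 : ℝ), ∀ w, b s * A (x s) w
      = fderiv ℝ A (x s) (x' s) w - fderiv ℝ A (x s) w (x' s))
    (hnorm : Tendsto (fun s => ‖V.symm (x' s)‖) (𝓝[>] 0) (𝓝 1)) :
    ∃ k K, IsSingularCurve B (fun s => V.symm (x s - x₀)) (fun s => V.symm (x' s)) k b K := by
  set e : Fin 2 → EuclideanSpace ℝ (Fin 2) := fun i => EuclideanSpace.single i 1 with he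
  set z : ℝ → EuclideanSpace ℝ (Fin 2) := fun s => V.symm (x s - x₀) with hz
  set v : ℝ → EuclideanSpace ℝ (Fin 2) := fun s => V.symm (x' s) with hv
  set α : Fin 2 → ℝ → ℝ := fun i s => A (x s) (V (e i)) with hα
  have hδ0 : δ ≠ 0 := by rintro rfl; simp at hδ
  have hVz : ∀ s, V (z s) = x s - x₀ := fun s => V.apply_symm_apply _
  have hVv : ∀ s, V (v s) = x' s := fun s => V.apply_symm_apply _
  have hVe : ∀ y : EuclideanSpace ℝ (Fin 2), V y = y 0 • V (e 0) + y 1 • V (e 1) := fun y => by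
    conv_lhs => rw [euclidean_two_eq y]
    rw [map_add, map_smul, map_smul]
  have hAV : ∀ s (y : EuclideanSpace ℝ (Fin 2)), A (x s) (V y) = y 0 * α 0 s + y 1 * α 1 s :=
      fun s y => by
    rw [hVe, map_add, map_smul, map_smul]; rfl
  have hpos : ∀ᶠ s in 𝓝[>] (0 : ℝ), 0 < α 0 s ^ 2 + α 1 s ^ 2 := by
    filter_upwards [hne] with s hs
    by_contra! hle
    refine hs ?_
    have h0 : α 0 s = 0 := by nlinarith [sq_nonneg (α 0 s), sq_nonneg (α 1 s)]
    have h1 : α 1 s = 0 := by nlinarith [sq_nonneg (α 0 s), sq_nonneg (α 1 s)]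
    ext y
    rw [← V.apply_symm_apply y, hAV, h0, h1]
    simp
  set c' := δ / c with hc'
  have hc'0 : c' ≠ 0 := div_ne_zero hδ0 hc
  -- The velocity lies in the kernel of the covector `(α 0, α 1)`, so it is `k₀ (α 1, -α 0)`; the
  -- factor `k` will be `c' k₀`.
  set k₀ : ℝ → ℝ := fun s => (v s 0 * α 1 s - v s 1 * α 0 s) / (α 0 s ^ 2 + α 1 s ^ 2) with hk₀
  have hv01 : ∀ᶠ s in 𝓝[>] (0 : ℝ), v s 0 = k₀ s * α 1 s ∧ v s 1 = -(k₀ s * α 0 s) := by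
    filter_upwards [hker, hpos] with s h1 h2
    rw [← hVv, hAV] at h1
    simp only [hk₀]
    constructor
    · rw [div_mul_eq_mul_div, eq_div_iff h2.ne']
      linear_combination α 0 s * h1
    · rw [div_mul_eq_mul_div, ← neg_div, eq_div_iff h2.ne']
      linear_combination α 1 s * h1
  -- the drift
  set f : EuclideanSpace ℝ (Fin 2) → ℝ := fun y =>
    fderiv ℝ A y (V (e 0)) (V (e 1)) - fderiv ℝ A y (V (e 1)) (V (e 0)) with hf
  have hbf : ∀ᶠ s in 𝓝[>] (0 : ℝ), b s = k₀ s * f (x s) := by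
    filter_upwards [hb, hv01, hpos] with s h1 h2 h3
    have h4 : ∀ y : EuclideanSpace ℝ (Fin 2), b s * (y 0 * α 0 s + y 1 * α 1 s)
        = k₀ s * f (x s) * (y 0 * α 0 s + y 1 * α 1 s) := fun y => by
      rw [← hAV, h1, ← hVv, hVe (v s), hVe y, h2.1, h2.2]
      simp only [map_add, map_smul, add_apply, smul_apply, smul_eq_mul, hf]
      rw [show A (x s) (V (e 0)) = α 0 s from rfl, show A (x s) (V (e 1)) = α 1 s from rfl]
      ring
    have h5 := h4 !₂[α 0 s, α 1 s]
    simp at h5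
    have h6 : α 0 s * α 0 s + α 1 s * α 1 s ≠ 0 := by nlinarith
    exact h5.resolve_right h6
  have hDA : DifferentiableAt ℝ (fderiv ℝ A) x₀ :=
    (hA.fderiv_right (m := ∞) (by simp)).differentiableAt (by simp)
  have hfd : DifferentiableAt ℝ f x₀ :=
    ((hDA.clm_apply (differentiableAt_const _)).clm_apply (differentiableAt_const _)).sub
      ((hDA.clm_apply (differentiableAt_const _)).clm_apply (differentiableAt_const _))
  -- The trace normalization enters here: the drift is `k₀ f`, and `f x₀ = δ / c` is the same
  -- constant that relates `(α 1, -α 0)` to `B z`. So velocity and drift have a common factor.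
  have hf0 : f x₀ = c' := by
    have h1 := hH 1 0
    have h2 := hH 0 1
    have h3 : c * f x₀ = δ := by
      rw [← htr, h1, h2]
      simp only [hf, he]
      ring
    rw [hc', eq_div_iff hc, mul_comm, h3]
  obtain ⟨K1, hK10, hK1⟩ := hfd.hasFDerivAt.isBigO_sub.exists_nonneg
  -- quadratic remainder
  obtain ⟨K2, hK20, hK2⟩ := exists_quadratic_remainder (hA.of_le (m := 2) (by
    exact WithTop.coe_le_coe.2 (le_top : (2 : ℕ∞) ≤ ⊤)))
  have hnz : ∀ s, ‖x s - x₀‖ ≤ ‖V.toContinuousLinearMap‖ * ‖z s‖ := fun s => by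
    rw [← hVz]; exact V.toContinuousLinearMap.le_opNorm _
  set nV := ‖V.toContinuousLinearMap‖ with hnV
  have hlin : ∀ (y : EuclideanSpace ℝ (Fin 2)) i, fderiv ℝ A x₀ (V y) (V (e i))
      = -(y 0 * H 0 i + y 1 * H 1 i) / c := by
    intro y i
    rw [hVe, map_add, map_smul, map_smul, add_apply, smul_apply, smul_apply, hH, hH, smul_eq_mul,
      smul_eq_mul, eq_div_iff hc]
    simp only [he]
    ring
  have hrem : ∀ i, ∀ᶠ s in 𝓝[>] (0 : ℝ), |α i s + (z s 0 * H 0 i + z s 1 * H 1 i) / c|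
      ≤ K2 * nV ^ 2 * ‖V (e i)‖ * ‖z s‖ ^ 2 := fun i => by
    filter_upwards [hlim.eventually hK2] with s hs
    rw [hA0, sub_zero] at hs
    have h1 : α i s + (z s 0 * H 0 i + z s 1 * H 1 i) / c
        = (A (x s) - fderiv ℝ A x₀ (x s - x₀)) (V (e i)) := by
      rw [sub_apply, ← hVz, hlin]
      simp only [hα]
      ring
    rw [h1, ← Real.norm_eq_abs]
    refine (ContinuousLinearMap.le_opNorm _ _).trans ?_
    calc ‖A (x s) - fderiv ℝ A x₀ (x s - x₀)‖ * ‖V (e i)‖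
        ≤ (K2 * (nV * ‖z s‖) ^ 2) * ‖V (e i)‖ := by
          gcongr
          exact hs.trans (by gcongr; exact hnz s)
      _ = _ := by ring
  set K3 := (|c'|)⁻¹ * (K2 * nV ^ 2 * ‖V (e 1)‖ + K2 * nV ^ 2 * ‖V (e 0)‖) with hK3
  have hK30 : 0 ≤ K3 := by positivity
  set K4 := |c'|⁻¹ * (K1 * nV) with hK4
  have hK40 : 0 ≤ K4 := by positivity
  have hc'inv : c'⁻¹ * (1 / c) = δ := by
    rw [hc']
    field_simp
    linarith
  have hxc : ∀ᶠ s in 𝓝[>] (0 : ℝ), ContinuousAt (fun t => A (x t)) s := by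
    have h1 : ∀ᶠ y in 𝓝 x₀, ContinuousAt A y :=
      ((hA.of_le (m := 1) (by simp)).eventually (by simp)).mono fun y hy => hy.continuousAt
    filter_upwards [hlim.eventually h1, hx] with s hs hxs
    exact ContinuousAt.comp (g := A) hs hxs.continuousAt
  refine ⟨fun s => c' * k₀ s, K3 + K4, ?_, ?_, ?_, ?_, hnorm, ?_, ?_⟩
  · filter_upwards [hx] with s hs
    exact V.symm.toContinuousLinearMap.hasFDerivAt.comp_hasDerivAt s (hs.sub_const x₀)
  · filter_upwards [hx'] with s hs
    exact V.symm.continuous.continuousAt.comp hs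
  · filter_upwards [hx', hxc, hpos] with s h1 h2 h3
    have h4 : ContinuousAt v s := V.symm.continuous.continuousAt.comp h1
    have h5 : ∀ i, ContinuousAt (fun t => v t i) s := fun i =>
      (PiLp.continuous_apply 2 (fun _ : Fin 2 => ℝ) i).continuousAt.comp h4
    have h6 : ∀ i, ContinuousAt (α i) s := fun i => h2.clm_apply continuousAt_const
    exact ContinuousAt.const_mul ((((h5 0).mul (h6 1)).sub ((h5 1).mul (h6 0))).div
      (((h6 0).pow 2).add ((h6 1).pow 2)) h3.ne') c'
  · have h1 : Tendsto (fun s => V.symm (x s - x₀)) (𝓝[>] 0) (𝓝 (V.symm (x₀ - x₀))) :=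
      (V.symm.continuous.tendsto _).comp (hlim.sub_const x₀)
    rw [sub_self, map_zero] at h1
    exact h1
  · filter_upwards [hv01, hrem 0, hrem 1] with s h1 h2 h3
    have h4 : ∀ y : EuclideanSpace ℝ (Fin 2), ‖y‖ ≤ |y 0| + |y 1| := fun y => by
      conv_lhs => rw [euclidean_two_eq y]
      refine (norm_add_le _ _).trans ?_
      simp [norm_smul]
    refine (h4 _).trans ?_
    have h5 : (v s - (c' * k₀ s) • B (z s)) 0
        = k₀ s * (α 1 s + (z s 0 * H 0 1 + z s 1 * H 1 1) / c) := by
      rw [PiLp.sub_apply, PiLp.smul_apply, smul_eq_mul, hB0, h1.1]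
      have : c' * δ = 1 / c := by rw [hc', div_mul_eq_mul_div, hδ]
      linear_combination (k₀ s * (z s 0 * H 0 1 + z s 1 * H 1 1)) * this
    have h6 : (v s - (c' * k₀ s) • B (z s)) 1
        = -(k₀ s * (α 0 s + (z s 0 * H 0 0 + z s 1 * H 1 0) / c)) := by
      rw [PiLp.sub_apply, PiLp.smul_apply, smul_eq_mul, hB1, h1.2]
      have : c' * δ = 1 / c := by rw [hc', div_mul_eq_mul_div, hδ]
      linear_combination (-(k₀ s * (z s 0 * H 0 0 + z s 1 * H 1 0))) * this
    rw [h5, h6, abs_neg, abs_mul, abs_mul, abs_mul]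
    have h7 : |c'|⁻¹ * |c'| = 1 := inv_mul_cancel₀ (abs_ne_zero.2 hc'0)
    calc |k₀ s| * |α 1 s + (z s 0 * H 0 1 + z s 1 * H 1 1) / c|
          + |k₀ s| * |α 0 s + (z s 0 * H 0 0 + z s 1 * H 1 0) / c|
        ≤ |k₀ s| * (K2 * nV ^ 2 * ‖V (e 1)‖ * ‖z s‖ ^ 2)
          + |k₀ s| * (K2 * nV ^ 2 * ‖V (e 0)‖ * ‖z s‖ ^ 2) := by gcongr
      _ = K3 * (|c'| * |k₀ s|) * ‖z s‖ ^ 2 := by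
          rw [hK3]
          linear_combination (-(|k₀ s| * ‖z s‖ ^ 2 *
            (K2 * nV ^ 2 * ‖V (e 1)‖ + K2 * nV ^ 2 * ‖V (e 0)‖))) * h7
      _ ≤ (K3 + K4) * (|c'| * |k₀ s|) * ‖z s‖ ^ 2 := by gcongr; linarith
  · filter_upwards [hbf, hlim.eventually hK1.bound] with s h1 h2
    rw [h1, hf0, Real.norm_eq_abs] at *
    have h7 : |c'|⁻¹ * |c'| = 1 := inv_mul_cancel₀ (abs_ne_zero.2 hc'0)
    rw [show k₀ s * f (x s) - c' * k₀ s = k₀ s * (f (x s) - c') by ring, abs_mul, abs_mul]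
    calc |k₀ s| * |f (x s) - c'| ≤ |k₀ s| * (K1 * (nV * ‖z s‖)) := by
          gcongr
          exact h2.trans (by gcongr; exact hnz s)
      _ = K4 * (|c'| * |k₀ s|) * ‖z s‖ := by
          rw [hK4]
          linear_combination (-(|k₀ s| * (K1 * nV) * ‖z s‖)) * h7
      _ ≤ (K3 + K4) * (|c'| * |k₀ s|) * ‖z s‖ := by gcongr; linarith

end ContactSR

/-! ### The horizontal Hessian at a characteristic point -/

namespace ContactSR

variable {M : Type*} [TopologicalSpace M] [ChartedSpace (EuclideanSpace ℝ (Fin 3)) M]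
  [IsManifold (𝓡 3) ∞ M]
  {S : Type*} [TopologicalSpace S] [ChartedSpace (EuclideanSpace ℝ (Fin 2)) S]
  [IsManifold (𝓡 2) ∞ S] {ι : S → M}

theorem fderiv_chartMap_dchart (hι : ContMDiff (𝓡 2) (𝓡 3) ∞ ι) {c q : S} {m : M}
    (hq : q ∈ (extChartAt (𝓡 2) c).source) (hm : ι q ∈ (extChartAt (𝓡 3) m).source)
    (v : TangentSpace (𝓡 2) q) :
    fderiv ℝ (chartMap ι c m) (chart 2 c q) (dchart 2 c q v)
      = dchart 3 m (ι q) (mfderiv (𝓡 2) (𝓡 3) ι q v) := by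
  obtain ⟨x, hx, rfl⟩ : ∃ x ∈ (extChartAt (𝓡 2) c).target, param 2 c x = q :=
    ⟨chart 2 c q, (extChartAt (𝓡 2) c).map_source hq, (extChartAt (𝓡 2) c).left_inv hq⟩
  have hxx : chart 2 c (param 2 c x) = x := (extChartAt (𝓡 2) c).right_inv hx
  rw [hxx, fderiv_chartMap hι hx hm, dparam_dchart c hx]

theorem mfderiv_eq_fderiv_param {f : M → ℝ} {m q : M} (hq : q ∈ (extChartAt (𝓡 3) m).source)
    (hf : MDifferentiableAt (𝓡 3) 𝓘(ℝ, ℝ) f q) (v : TangentSpace (𝓡 3) q) :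
    mfderiv (𝓡 3) 𝓘(ℝ, ℝ) f q v
      = fderiv ℝ (fun y => f (param 3 m y)) (chart 3 m q) (dchart 3 m q v) := by
  obtain ⟨y, hy, rfl⟩ : ∃ y ∈ (extChartAt (𝓡 3) m).target, param 3 m y = q :=
    ⟨chart 3 m q, (extChartAt (𝓡 3) m).map_source hq, (extChartAt (𝓡 3) m).left_inv hq⟩
  have hyy : chart 3 m (param 3 m y) = y := (extChartAt (𝓡 3) m).right_inv hy
  have h1 := (hf.hasMFDerivAt.comp y (mdifferentiableAt_param m hy).hasMFDerivAt).mfderiv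
  rw [hyy, ← mfderiv_eq_fderiv]
  refine Eq.trans ?_ (congrArg (fun L => L (dchart 3 m (param 3 m y) v)) h1).symm
  change _ = mfderiv (𝓡 3) 𝓘(ℝ, ℝ) f (param 3 m y)
    (dparam 3 m y (dchart 3 m (param 3 m y) v))
  rw [dparam_dchart m hy]

theorem fieldDeriv_eq_fderiv {f : M → ℝ} {m q : M} (hq : q ∈ (extChartAt (𝓡 3) m).source)
    (hf : MDifferentiableAt (𝓡 3) 𝓘(ℝ, ℝ) f q) (X : (q : M) → TangentSpace (𝓡 3) q) :
    fieldDeriv X f q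
      = fderiv ℝ (fun y => f (param 3 m y)) (chart 3 m q) (coordField m X (chart 3 m q)) := by
  rw [coordField_chart hq, ← mfderiv_eq_fderiv_param hq hf]
  rfl

theorem contDiffAt_comp_param {f : M → ℝ} {m : M} {y : EuclideanSpace ℝ (Fin 3)}
    (hy : y ∈ (extChartAt (𝓡 3) m).target)
    (hf : ContMDiffAt (𝓡 3) 𝓘(ℝ, ℝ) ∞ f (param 3 m y)) :
    ContDiffAt ℝ ∞ (fun y => f (param 3 m y)) y := by
  rw [← contMDiffAt_iff_contDiffAt]
  have h2 : ContMDiffAt 𝓘(ℝ, EuclideanSpace ℝ (Fin 3)) (𝓡 3) ∞ (param 3 m) y :=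
    (contMDiffOn_extChartAt_symm m).contMDiffAt ((isOpen_extChartAt_target m).mem_nhds hy)
  exact hf.comp y h2

namespace ContactSubRiemannian

variable {C : ContactSubRiemannian M} {p : S} {U : Set M} {X : Fin 2 → (q : M) → C.D q}
  {u : M → ℝ}

omit [IsManifold (𝓡 2) ∞ S] in
theorem exists_mfderiv_eq (hp : p ∈ C.charSet ι) (w : C.D (ι p)) :
    ∃ v, mfderiv (𝓡 2) (𝓡 3) ι p v = w := by
  have h : (w : TangentSpace (𝓡 3) (ι p))
      ∈ LinearMap.range (mfderiv (𝓡 2) (𝓡 3) ι p).toLinearMap := by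
    rw [show LinearMap.range (mfderiv (𝓡 2) (𝓡 3) ι p).toLinearMap = C.D (ι p) from hp]
    exact w.2
  exact h

omit [IsManifold (𝓡 2) ∞ S] in
/-- At a characteristic point the differential of a defining function is a multiple of the contact
form. -/
theorem exists_mfderiv_eq_smul_form (hι : Manifold.IsSmoothEmbedding (𝓡 2) (𝓡 3) ∞ ι)
    (hp : p ∈ C.charSet ι) (hU : IsOpen U) (hpU : ι p ∈ U) (hu : IsLocalDefiningFun ι U u) :
    ∃ c : ℝ, c ≠ 0 ∧ ∀ v, mfderiv (𝓡 3) 𝓘(ℝ, ℝ) u (ι p) v = c * C.α (ι p) v := by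
  have hud : MDifferentiableAt (𝓡 3) 𝓘(ℝ, ℝ) u (ι p) :=
    ((hu.smooth.contMDiffAt (hU.mem_nhds hpU)).mdifferentiableAt (by simp))
  have hιd : MDifferentiableAt (𝓡 2) (𝓡 3) ι p :=
    hι.contMDiff.contMDiffAt.mdifferentiableAt (by simp)
  have h0 : u ∘ ι =ᶠ[𝓝 p] fun _ => 0 := by
    filter_upwards [hι.contMDiff.continuous.continuousAt.preimage_mem_nhds (hU.mem_nhds hpU)]
      with q hq
    exact (hu.zero_iff _ hq).2 ⟨q, rfl⟩
  have h1 := (hud.hasMFDerivAt.comp p hιd.hasMFDerivAt).mfderiv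
  rw [h0.mfderiv_eq, mfderiv_const] at h1
  set du : TangentSpace (𝓡 3) (ι p) →L[ℝ] ℝ := mfderiv (𝓡 3) 𝓘(ℝ, ℝ) u (ι p) with hdu
  have h2 : ∀ w, C.α (ι p) w = 0 → du w = 0 := fun w hw => by
    obtain ⟨v, hv⟩ := exists_mfderiv_eq hp (⟨w, hw⟩ : C.D (ι p))
    rw [show w = _ from hv.symm]
    exact (congrArg (fun L => L v) h1).symm
  obtain ⟨e, he⟩ : ∃ e, C.α (ι p) e = 1 := by
    obtain ⟨v, hv⟩ : ∃ v, C.α (ι p) v ≠ 0 := by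
      by_contra! h
      exact C.form_ne_zero (ι p) (by ext v; exact h v)
    exact ⟨(C.α (ι p) v)⁻¹ • v, by rw [map_smul, smul_eq_mul, inv_mul_cancel₀ hv]⟩
  have h3 : ∀ v, du v = du e * C.α (ι p) v := fun v => by
    have := h2 (v - C.α (ι p) v • e) (by rw [map_sub, map_smul, he]; simp)
    rw [map_sub, map_smul, sub_eq_zero, smul_eq_mul] at this
    rw [this, mul_comm]
  refine ⟨du e, fun h => hu.du_ne_zero _ hpU ?_, h3⟩
  rw [← hdu]
  ext v
  rw [h3, h, zero_mul]
  rfl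

/-- At a characteristic point the horizontal Hessian of a defining function is the derivative of
the pulled back contact form, up to a factor. -/
theorem exists_hess_eq (hι : Manifold.IsSmoothEmbedding (𝓡 2) (𝓡 3) ∞ ι)
    (hp : p ∈ C.charSet ι) (hU : IsOpen U) (hpU : ι p ∈ U) (hX : C.IsOrthonormalFrameOn X U)
    (hu : IsLocalDefiningFun ι U u) :
    ∃ c : ℝ, c ≠ 0 ∧ ∀ i j v w, mfderiv (𝓡 2) (𝓡 3) ι p v = X i (ι p) →
      mfderiv (𝓡 2) (𝓡 3) ι p w = X j (ι p) →
      C.hess X u (ι p) i j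
        = -c * fderiv ℝ (pullForm C.α ι p) (chart 2 p p) (dchart 2 p p v) (dchart 2 p p w) := by
  obtain ⟨c, hc, hcu⟩ := exists_mfderiv_eq_smul_form hι hp hU hpU hu
  refine ⟨c, hc, fun i j v w hv hw => ?_⟩
  obtain ⟨m, hmdef⟩ : ∃ m, m = ι p := ⟨_, rfl⟩
  obtain ⟨x₀, hx₀⟩ : ∃ x₀, x₀ = chart 2 p p := ⟨_, rfl⟩
  obtain ⟨y₀, hy₀⟩ : ∃ y₀, y₀ = chart 3 m (ι p) := ⟨_, rfl⟩
  have hs : p ∈ (extChartAt (𝓡 2) p).source := mem_extChartAt_source p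
  have ht : x₀ ∈ (extChartAt (𝓡 2) p).target := hx₀ ▸ (extChartAt (𝓡 2) p).map_source hs
  have hpp : param 2 p x₀ = p := by rw [hx₀]; exact (extChartAt (𝓡 2) p).left_inv hs
  have hms : ι p ∈ (extChartAt (𝓡 3) m).source := by rw [hmdef]; exact mem_extChartAt_source _
  have hy₀t : y₀ ∈ (extChartAt (𝓡 3) m).target := hy₀ ▸ (extChartAt (𝓡 3) m).map_source hms
  have hmm : param 3 m y₀ = ι p := by rw [hy₀]; exact (extChartAt (𝓡 3) m).left_inv hms
  have hms' : ι (param 2 p x₀) ∈ (extChartAt (𝓡 3) m).source := by rw [hpp]; exact hms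
  set F := chartMap ι p m with hF
  have hFx₀ : F x₀ = y₀ := by rw [hF, chartMap, hpp, hy₀]
  have hFc : ContDiffAt ℝ ∞ F x₀ := contDiffAt_chartMap hι.contMDiff ht hms'
  set ut : EuclideanSpace ℝ (Fin 3) → ℝ := fun y => u (param 3 m y) with hut
  -- The form `du - c α` vanishes at `p`, equals `du` on the distribution, and equals `-c α` on
  -- vectors tangent to the surface. Because of its zero at `p`, its derivative there does not see
  -- how `X j` is extended: along the frame it gives the Hessian, along the surface the derivative
  -- of the pulled back form.
  set θ : EuclideanSpace ℝ (Fin 3) → EuclideanSpace ℝ (Fin 3) →L[ℝ] ℝ :=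
    fun y => fderiv ℝ ut y - c • formInChart C.α m y with hθ
  have huU : ∀ q ∈ U, ContMDiffAt (𝓡 3) 𝓘(ℝ, ℝ) ∞ u q := fun q hq =>
    hu.smooth.contMDiffAt (hU.mem_nhds hq)
  have hutc : ∀ y ∈ (extChartAt (𝓡 3) m).target, param 3 m y ∈ U → ContDiffAt ℝ ∞ ut y :=
    fun y hy hyU => contDiffAt_comp_param hy (huU _ hyU)
  have hut₀ := hutc y₀ hy₀t (by rw [hmm]; exact hpU)
  have hθc : ContDiffAt ℝ ∞ θ y₀ := (hut₀.fderiv_right (by simp)).sub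
    ((contDiffAt_formInChart C.smooth_form hy₀t).const_smul c)
  have hθd : DifferentiableAt ℝ θ y₀ := hθc.differentiableAt (by simp)
  have hθ0 : θ y₀ = 0 := by
    ext v
    obtain ⟨t, rfl⟩ : ∃ t : TangentSpace (𝓡 3) (ι p), dchart 3 m (ι p) t = v := by
      rw [← hmm]
      exact ⟨dparam 3 m y₀ v, dchart_dparam m hy₀t v⟩
    have h1 := mfderiv_eq_fderiv_param hms ((huU _ hpU).mdifferentiableAt (by simp)) t
    have h2 := formInChart_dchart (α := C.α) hms t
    rw [← hy₀] at h1 h2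
    simp only [hθ, sub_apply, smul_apply, smul_eq_mul, zero_apply]
    rw [← h1, h2, hcu, sub_self]
  -- the restriction of `θ` to the surface
  have hev : ∀ᶠ x in 𝓝 x₀, (x ∈ (extChartAt (𝓡 2) p).target ∧
      ι (param 2 p x) ∈ (extChartAt (𝓡 3) m).source) ∧ ι (param 2 p x) ∈ U := by
    refine (eventually_mem_charts hι.contMDiff ht hms').and ?_
    have h : ContinuousAt (fun y => ι (param 2 p y)) x₀ :=
      hι.contMDiff.continuous.continuousAt.comp (mdifferentiableAt_param p ht).continuousAt
    exact h.preimage_mem_nhds (hU.mem_nhds (by rw [hpp]; exact hpU))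
  have hparam : ∀ x, ι (param 2 p x) ∈ (extChartAt (𝓡 3) m).source →
      param 3 m (F x) = ι (param 2 p x) := fun x hx => (extChartAt (𝓡 3) m).left_inv hx
  have hutF : ∀ᶠ x in 𝓝 x₀, ut (F x) = 0 := by
    filter_upwards [hev] with x hx
    rw [hut]
    simp only
    rw [hparam x hx.1.2]
    exact (hu.zero_iff _ hx.2).2 ⟨_, rfl⟩
  have hres : ∀ᶠ x in 𝓝 x₀, θ (F x) (fderiv ℝ F x (dchart 2 p p w))
      = -c * pullForm C.α ι p x (dchart 2 p p w) := by
    filter_upwards [hev, hutF.eventually_nhds] with x hx hx0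
    have hFt : F x ∈ (extChartAt (𝓡 3) m).target := (extChartAt (𝓡 3) m).map_source hx.1.2
    have h1 : DifferentiableAt ℝ ut (F x) :=
      (hutc _ hFt (by rw [hparam x hx.1.2]; exact hx.2)).differentiableAt (by simp)
    have h2 : DifferentiableAt ℝ F x :=
      (contDiffAt_chartMap hι.contMDiff hx.1.1 hx.1.2).differentiableAt (by simp)
    have h3 := fderiv_fun_comp x h1 h2
    have h4 : fderiv ℝ (fun x => ut (F x)) x = 0 := by
      have : (fun x => ut (F x)) =ᶠ[𝓝 x] fun _ => (0 : ℝ) := hx0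
      rw [this.fderiv_eq]
      simp
    rw [h4] at h3
    have h5 := congrArg (fun L => L (dchart 2 p p w)) h3
    simp only [zero_apply, ContinuousLinearMap.comp_apply] at h5
    rw [pullForm_eq hι.contMDiff hx.1.1 hx.1.2]
    simp only [hθ, sub_apply, smul_apply, smul_eq_mul, ContinuousLinearMap.comp_apply]
    rw [← h5]
    ring
  have hdF : ∀ t, fderiv ℝ F x₀ (dchart 2 p p t)
      = dchart 3 m (ι p) (mfderiv (𝓡 2) (𝓡 3) ι p t) := fun t => by
    rw [hx₀]; exact fderiv_chartMap_dchart hι.contMDiff hs hms t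
  have hDFd : DifferentiableAt ℝ (fderiv ℝ F) x₀ :=
    (hFc.fderiv_right (m := ∞) (by simp)).differentiableAt (by simp)
  have hFd : DifferentiableAt ℝ F x₀ := hFc.differentiableAt (by simp)
  have hpd : DifferentiableAt ℝ (pullForm C.α ι p) x₀ :=
    (contDiffAt_pullForm C.smooth_form hι.contMDiff ht).differentiableAt (by simp)
  have hθFd : HasFDerivAt (fun x => θ (F x)) ((fderiv ℝ θ y₀).comp (fderiv ℝ F x₀)) x₀ := by
    have h : HasFDerivAt θ (fderiv ℝ θ y₀) (F x₀) := by rw [hFx₀]; exact hθd.hasFDerivAt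
    exact h.comp x₀ hFd.hasFDerivAt
  have key : fderiv ℝ θ y₀ (dchart 3 m (ι p) (X i (ι p))) (dchart 3 m (ι p) (X j (ι p)))
      = -c * fderiv ℝ (pullForm C.α ι p) x₀ (dchart 2 p p v) (dchart 2 p p w) := by
    have h1 := (hθFd.clm_apply (hDFd.hasFDerivAt.clm_apply
      (hasFDerivAt_const (dchart 2 p p w) x₀))).congr_of_eventuallyEq (EventuallyEq.symm hres)
    have h2 := ((hpd.hasFDerivAt.clm_apply
      (hasFDerivAt_const (dchart 2 p p w) x₀)).const_mul (-c))
    have h3 := congrArg (fun L => L (dchart 2 p p v)) (h1.unique h2)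
    simp only [add_apply, smul_apply, ContinuousLinearMap.comp_apply,
      ContinuousLinearMap.flip_apply, zero_apply, map_zero, hFx₀, hθ0, hdF, hv, hw,
      smul_eq_mul, zero_add] at h3
    exact h3
  rw [← hx₀, ← key]
  -- the second derivatives
  have hξ : ∀ i, ContDiffAt ℝ ∞ (coordField m (fun q => (X i q : TangentSpace (𝓡 3) q))) y₀ :=
    fun i => by
      rw [hy₀]
      exact contDiffAt_coordField m hms ((hX.smooth i).contMDiffAt (hU.mem_nhds hpU))
  set f : M → ℝ := fieldDeriv (fun q => (X j q : TangentSpace (𝓡 3) q)) u with hf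
  set ξ := coordField m (fun q => (X j q : TangentSpace (𝓡 3) q)) with hξdef
  have hfloc : ∀ᶠ y in 𝓝 y₀, f (param 3 m y) = θ y (ξ y) := by
    have h1 : ContinuousAt (param 3 m) y₀ := (mdifferentiableAt_param m hy₀t).continuousAt
    filter_upwards [(isOpen_extChartAt_target m).mem_nhds hy₀t,
      h1.preimage_mem_nhds (hU.mem_nhds (by rw [hmm]; exact hpU))] with y hy hyU
    have hys : param 3 m y ∈ (extChartAt (𝓡 3) m).source := (extChartAt (𝓡 3) m).map_target hy
    have hyy : chart 3 m (param 3 m y) = y := (extChartAt (𝓡 3) m).right_inv hy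
    rw [hf, fieldDeriv_eq_fderiv hys ((huU _ hyU).mdifferentiableAt (by simp)), hyy]
    have h2 : formInChart C.α m y (ξ y) = 0 := by
      change C.α (param 3 m y) (dparam 3 m y (coordField m _ y)) = 0
      rw [dparam_coordField m _ hy]
      exact (X j (param 3 m y)).2
    simp only [hθ, sub_apply, smul_apply, h2, smul_zero, sub_zero]
    rfl
  have hgd : ContDiffAt ℝ ∞ (fun y => θ y (ξ y)) y₀ := hθc.clm_apply (hξ j)
  have hfd : MDifferentiableAt (𝓡 3) 𝓘(ℝ, ℝ) f (ι p) := by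
    have h1 : MDifferentiableAt (𝓡 3) 𝓘(ℝ, ℝ) ((fun y => θ y (ξ y)) ∘ chart 3 m) (ι p) := by
      refine MDifferentiableAt.comp (I' := 𝓘(ℝ, EuclideanSpace ℝ (Fin 3))) (ι p) ?_
        (mdifferentiableAt_chart m hms)
      rw [← hy₀]
      exact (hgd.differentiableAt (by simp)).mdifferentiableAt
    refine h1.congr_of_eventuallyEq ?_
    have h2 : ContinuousAt (chart 3 m) (ι p) := (mdifferentiableAt_chart m hms).continuousAt
    have h3 := h2.eventually (p := fun y => f (param 3 m y) = θ y (ξ y)) (by rw [← hy₀]; exact hfloc)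
    filter_upwards [h3, (isOpen_extChartAt_source m).mem_nhds hms] with q hq hqs
    rw [Function.comp_apply, ← hq, show param 3 m (chart 3 m q) = q from
      (extChartAt (𝓡 3) m).left_inv hqs]
  have h1 : C.hess X u (ι p) i j = fieldDeriv (fun q => (X i q : TangentSpace (𝓡 3) q)) f (ι p) :=
    rfl
  have hfloc' : (fun y => f (param 3 m y)) =ᶠ[𝓝 y₀] fun y => θ y (ξ y) := hfloc
  have hξ₀ : ∀ i, coordField m (fun q => (X i q : TangentSpace (𝓡 3) q)) y₀
      = dchart 3 m (ι p) (X i (ι p)) := fun i => by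
    rw [hy₀, coordField_chart hms]
  rw [h1, fieldDeriv_eq_fderiv hms hfd, ← hy₀, hfloc'.fderiv_eq,
    fderiv_clm_apply hθd ((hξ j).differentiableAt (by simp)), hθ0, hξ₀]
  simp only [add_apply, ContinuousLinearMap.comp_apply, ContinuousLinearMap.flip_apply, zero_apply,
    zero_add, hξ₀]

end ContactSubRiemannian

end ContactSR

/-! ### Frame coordinates at the characteristic point and the speed of a leaf -/

namespace ContactSR

/-- If `T s (y s) = R s c` with unit vectors `c`, and `T`, `R` have the same injective limit, then
`‖y s‖ → 1`. -/
theorem tendsto_norm_of_apply_eq {E F : Type*} [NormedAddCommGroup E] [NormedSpace ℝ E]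
    [FiniteDimensional ℝ E] [NormedAddCommGroup F] [NormedSpace ℝ F] [FiniteDimensional ℝ F]
    {l : Filter ℝ} {T R : ℝ → E →L[ℝ] F} {T₀ : E →L[ℝ] F} (hT : Tendsto T l (𝓝 T₀))
    (hR : Tendsto R l (𝓝 T₀)) (hinj : Function.Injective T₀) {y : ℝ → E}
    (hy : ∀ᶠ s in l, ∃ c, ‖c‖ = 1 ∧ T s (y s) = R s c) :
    Tendsto (fun s => ‖y s‖) l (𝓝 1) := by
  -- For a left inverse `P` of the limit, both `P T s` and `P R s` tend to the identity, so `‖y s‖`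
  -- is close to `‖P (T s) (y s)‖ = ‖P (R s) c‖`, which is close to `1`.
  obtain ⟨P, hP⟩ := T₀.toLinearMap.exists_leftInverse_of_injective (LinearMap.ker_eq_bot.2 hinj)
  set P' : F →L[ℝ] E := LinearMap.toContinuousLinearMap P with hP'
  have hPT : P'.comp T₀ = ContinuousLinearMap.id ℝ E := by
    ext v
    exact congrArg (fun L => L v) hP
  have hlim : ∀ {Q : ℝ → E →L[ℝ] F}, Tendsto Q l (𝓝 T₀) →
      Tendsto (fun s => ‖P'.comp (Q s) - ContinuousLinearMap.id ℝ E‖) l (𝓝 0) := fun {Q} hQ => by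
    have h1 := ((ContinuousLinearMap.compL ℝ E F E P').continuous.tendsto T₀).comp hQ
    have h2 := (h1.sub_const (ContinuousLinearMap.id ℝ E)).norm
    simpa [hPT] using h2
  set τ : ℝ → ℝ := fun s => ‖P'.comp (T s) - ContinuousLinearMap.id ℝ E‖ with hτ
  set ρ : ℝ → ℝ := fun s => ‖P'.comp (R s) - ContinuousLinearMap.id ℝ E‖ with hρ
  have hτ0 : Tendsto τ l (𝓝 0) := hlim hT
  have hρ0 : Tendsto ρ l (𝓝 0) := hlim hR
  have hest : ∀ (L : E →L[ℝ] E) v, |‖L v‖ - ‖v‖| ≤ ‖L - ContinuousLinearMap.id ℝ E‖ * ‖v‖ :=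
    fun L v => (abs_norm_sub_norm_le _ _).trans ((L - ContinuousLinearMap.id ℝ E).le_opNorm v)
  have hlow : Tendsto (fun s => (1 - ρ s) / (1 + τ s)) l (𝓝 1) := by
    simpa [Pi.div_def] using (hρ0.const_sub 1).div (hτ0.const_add 1) (by norm_num)
  have hup : Tendsto (fun s => (1 + ρ s) / (1 - τ s)) l (𝓝 1) := by
    simpa [Pi.div_def] using (hρ0.const_add 1).div (hτ0.const_sub 1) (by norm_num)
  refine tendsto_of_tendsto_of_tendsto_of_le_of_le' hlow hup ?_ ?_
  · filter_upwards [hy] with s ⟨c, hc, h⟩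
    have h1 := abs_le.1 (hest (P'.comp (T s)) (y s))
    have h2 := abs_le.1 (hest (P'.comp (R s)) c)
    rw [ContinuousLinearMap.comp_apply, h] at h1
    rw [ContinuousLinearMap.comp_apply, hc] at h2
    have h3 : 0 ≤ τ s := norm_nonneg _
    rw [div_le_iff₀ (by linarith)]
    linarith [h1.2, h2.1]
  · filter_upwards [hy, hτ0.eventually_lt_const one_pos] with s ⟨c, hc, h⟩ hlt
    have h1 := abs_le.1 (hest (P'.comp (T s)) (y s))
    have h2 := abs_le.1 (hest (P'.comp (R s)) c)
    rw [ContinuousLinearMap.comp_apply, h] at h1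
    rw [ContinuousLinearMap.comp_apply, hc] at h2
    rw [le_div_iff₀ (by linarith)]
    linarith [h1.1, h2.2]

variable {M : Type*} [TopologicalSpace M] [ChartedSpace (EuclideanSpace ℝ (Fin 3)) M]
  [IsManifold (𝓡 3) ∞ M]
  {S : Type*} [TopologicalSpace S] [ChartedSpace (EuclideanSpace ℝ (Fin 2)) S]
  [IsManifold (𝓡 2) ∞ S] {ι : S → M}

theorem tendsto_tangentBundle_iff {n : ℕ} {M : Type*} [TopologicalSpace M]
    [ChartedSpace (EuclideanSpace ℝ (Fin n)) M] [IsManifold (𝓡 n) ∞ M] {l : Filter ℝ} {f : ℝ → M}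
    {v : (s : ℝ) → TangentSpace (𝓡 n) (f s)} {p : M} {w : TangentSpace (𝓡 n) p}
    (hf : Tendsto f l (𝓝 p)) :
    Tendsto (fun s => (⟨f s, v s⟩ : TangentBundle (𝓡 n) M)) l (𝓝 ⟨p, w⟩)
      ↔ Tendsto (fun s => dchart n p (f s) (v s)) l (𝓝 (dchart n p p w)) := by
  have h1 := (trivializationAt (EuclideanSpace ℝ (Fin n)) (TangentSpace (𝓡 n)) p).tendsto_nhds_iff
    (l := l) (f := fun s => (⟨f s, v s⟩ : TangentBundle (𝓡 n) M)) (z := ⟨p, w⟩)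
    (by rw [Bundle.Trivialization.mem_source]; exact FiberBundle.mem_baseSet_trivializationAt' p)
  have h2 := trivializationAt_snd p (mem_extChartAt_source p) w
  refine h1.trans ((and_iff_right hf).trans ?_)
  rw [← h2]
  refine tendsto_congr' ?_
  filter_upwards [hf ((isOpen_extChartAt_source p).mem_nhds (mem_extChartAt_source (I := 𝓡 n) p))]
    with s hs
  exact trivializationAt_snd p hs _

namespace ContactSubRiemannian

variable {C : ContactSubRiemannian M} {p : S} {U : Set M} {X : Fin 2 → (q : M) → C.D q}
  {u : M → ℝ}

theorem IsOrthonormalFrameOn.metric_combination (hX : C.IsOrthonormalFrameOn X U) {q : M}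
    (hq : q ∈ U) (c : Fin 2 → ℝ) (i : Fin 2) : C.g q (∑ j, c j • X j q) (X i q) = c i := by
  fin_cases i <;> simp [hX.orthonormal q hq]

theorem IsOrthonormalFrameOn.linearIndependent (hX : C.IsOrthonormalFrameOn X U) {q : M}
    (hq : q ∈ U) : LinearIndependent ℝ (fun i => X i q) := by
  rw [Fintype.linearIndependent_iff]
  intro c hc i
  rw [← hX.metric_combination hq c i, hc]
  simp

theorem IsOrthonormalFrameOn.exists_coordinates (hX : C.IsOrthonormalFrameOn X U) {q : M}
    (hq : q ∈ U) (w : C.D q) : ∃ c : EuclideanSpace ℝ (Fin 2),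
      w = ∑ i, c i • X i q ∧ C.g q w w = ‖c‖ ^ 2 := by
  have hli := hX.linearIndependent hq
  set β := basisOfLinearIndependentOfCardEqFinrank hli (by rw [C.finrank_D]; rfl) with hβ
  have hw : w = ∑ i, β.repr w i • X i q := by
    conv_lhs => rw [← β.sum_repr w]
    simp [hβ]
  refine ⟨WithLp.toLp 2 fun i => β.repr w i, hw, ?_⟩
  have h1 : ∀ i, C.g q w (X i q) = β.repr w i := fun i => by
    conv_lhs => rw [hw]
    exact hX.metric_combination hq _ i
  rw [EuclideanSpace.norm_sq_eq]
  conv_lhs => rw [hw, ← hw]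
  calc C.g q w w = C.g q w (∑ i, β.repr w i • X i q) := by rw [← hw]
    _ = _ := by simp [h1, sq]

/-- Linear coordinates of the tangent plane at a characteristic point in an orthonormal frame. -/
theorem exists_frame_equiv (hp : p ∈ C.charSet ι) (hpU : ι p ∈ U)
    (hX : C.IsOrthonormalFrameOn X U) :
    ∃ V : EuclideanSpace ℝ (Fin 2) ≃L[ℝ] EuclideanSpace ℝ (Fin 2), ∀ y, ∃ t,
      V y = dchart 2 p p t ∧
      mfderiv (𝓡 2) (𝓡 3) ι p t = ∑ i, y i • (X i (ι p) : TangentSpace (𝓡 3) (ι p)) := by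
  choose t ht using fun i => exists_mfderiv_eq hp (X i (ι p))
  let T : EuclideanSpace ℝ (Fin 2) →ₗ[ℝ] TangentSpace (𝓡 2) p :=
    { toFun := fun y => ∑ i, y i • t i
      map_add' := fun y z => by simp [add_smul, Finset.sum_add_distrib]
      map_smul' := fun r y => by simp [mul_smul] }
  have hT : ∀ y, mfderiv (𝓡 2) (𝓡 3) ι p (T y)
      = ∑ i, y i • (X i (ι p) : TangentSpace (𝓡 3) (ι p)) := fun y => by
    change mfderiv (𝓡 2) (𝓡 3) ι p (∑ i, y i • t i) = _
    simp [ht]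
  let G : EuclideanSpace ℝ (Fin 2) →ₗ[ℝ] EuclideanSpace ℝ (Fin 2) :=
    (dchart 2 p p).toLinearMap.comp T
  have hG : Function.Injective G := by
    refine (dchart_injective p (mem_extChartAt_source p)).comp ?_
    refine (injective_iff_map_eq_zero T).2 fun y hy => ?_
    have h1 := hT y
    rw [hy, map_zero] at h1
    have h2 : ∑ i, y i • X i (ι p) = 0 := by
      refine Subtype.ext (Eq.trans ?_ h1.symm)
      simp
    have h3 := Fintype.linearIndependent_iff.1 (hX.linearIndependent hpU) _ h2
    ext i
    exact h3 i
  exact ⟨(LinearEquiv.ofInjectiveEndo G hG).toContinuousLinearEquiv, fun y => ⟨T y, rfl, hT y⟩⟩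

variable {N : (q : S) → C.D (ι q)}
  {Xh : (q : S) → TangentSpace (𝓡 2) q} {ε : ℝ} {ℓ : Set S} {a : EReal} {γ : ℝ → S}

omit [IsManifold (𝓡 2) ∞ S] in
theorem IsArcLength.eventually_mem (hγ : C.IsArcLength ι Xh ε ℓ p a γ) :
    ∀ᶠ s in 𝓝[>] (0 : ℝ), s ∈ openInterval a ∧ γ s ∈ (extChartAt (𝓡 2) p).source :=
  Filter.Eventually.and (openInterval_mem_nhdsGT hγ.pos)
    (hγ.start ((isOpen_extChartAt_source p).mem_nhds (mem_extChartAt_source (I := 𝓡 2) p)))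

theorem IsArcLength.tendsto_chart (hγ : C.IsArcLength ι Xh ε ℓ p a γ) :
    Tendsto (fun s => chart 2 p (γ s)) (𝓝[>] 0) (𝓝 (chart 2 p p)) :=
  (mdifferentiableAt_chart p (mem_extChartAt_source p)).continuousAt.tendsto.comp hγ.start

/-- In linear coordinates at `p` given by an orthonormal frame, the speed of an arc-length
parametrization tends to `1`. -/
theorem IsArcLength.tendsto_norm (hγ : C.IsArcLength ι Xh ε ℓ p a γ)
    (hι : Manifold.IsSmoothEmbedding (𝓡 2) (𝓡 3) ∞ ι) (hXh : C.IsUnitCharField ι Xh)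
    (hU : IsOpen U) (hpU : ι p ∈ U) (hX : C.IsOrthonormalFrameOn X U)
    {V : EuclideanSpace ℝ (Fin 2) ≃L[ℝ] EuclideanSpace ℝ (Fin 2)}
    (hV : ∀ y, ∃ t, V y = dchart 2 p p t ∧
      mfderiv (𝓡 2) (𝓡 3) ι p t = ∑ i, y i • (X i (ι p) : TangentSpace (𝓡 3) (ι p))) :
    Tendsto (fun s => ‖V.symm (ε • coordField p Xh (chart 2 p (γ s)))‖) (𝓝[>] 0) (𝓝 1) := by
  obtain ⟨m, hmdef⟩ : ∃ m, m = ι p := ⟨_, rfl⟩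
  have hs : p ∈ (extChartAt (𝓡 2) p).source := mem_extChartAt_source p
  have ht : chart 2 p p ∈ (extChartAt (𝓡 2) p).target := (extChartAt (𝓡 2) p).map_source hs
  have hms : ι p ∈ (extChartAt (𝓡 3) m).source := by rw [hmdef]; exact mem_extChartAt_source _
  have hchart : ∀ q, q ∈ (extChartAt (𝓡 2) p).source →
      chartMap ι p m (chart 2 p q) = chart 3 m (ι q) := fun q hq =>
    congrArg (fun r => chart 3 m (ι r)) ((extChartAt (𝓡 2) p).left_inv hq)
  have hpp : param 2 p (chart 2 p p) = p := (extChartAt (𝓡 2) p).left_inv hs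
  have hFc : ContDiffAt ℝ ∞ (chartMap ι p m) (chart 2 p p) :=
    contDiffAt_chartMap hι.contMDiff ht (by rw [hpp]; exact hms)
  let ξ : Fin 2 → EuclideanSpace ℝ (Fin 3) → EuclideanSpace ℝ (Fin 3) := fun i =>
    coordField m (fun q => (X i q : TangentSpace (𝓡 3) q))
  have hξ : ∀ i, ContinuousAt (ξ i) (chartMap ι p m (chart 2 p p)) := fun i => by
    rw [hchart p hs]
    exact (contDiffAt_coordField m hms
      ((hX.smooth i).contMDiffAt (hU.mem_nhds hpU))).continuousAt
  -- `R y` turns frame coordinates at `y` into vectors in the chart of `M`; orthonormality gives the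
  -- unit velocity of the leaf unit frame coordinates. At `p` it agrees with the derivative of `ι`
  -- in the coordinates `V`, so both have the limit `T₀`.
  let R : EuclideanSpace ℝ (Fin 3) → EuclideanSpace ℝ (Fin 2) →L[ℝ] EuclideanSpace ℝ (Fin 3) :=
    fun y => ∑ i, (EuclideanSpace.proj (𝕜 := ℝ) i).smulRight (ξ i y)
  have hRap : ∀ y (c : EuclideanSpace ℝ (Fin 2)), R y c = ∑ i, c i • ξ i y := fun y c => by
    simp [R]
  have hRc : ContinuousAt R (chartMap ι p m (chart 2 p p)) := by
    refine tendsto_finsetSum _ fun i _ => ?_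
    exact ((ContinuousLinearMap.smulRightL ℝ (EuclideanSpace ℝ (Fin 2)) (EuclideanSpace ℝ (Fin 3))
      (EuclideanSpace.proj (𝕜 := ℝ) i)).continuous.tendsto _).comp (hξ i)
  set T₀ := (fderiv ℝ (chartMap ι p m) (chart 2 p p)).comp V.toContinuousLinearMap with hT₀
  have hR₀ : R (chartMap ι p m (chart 2 p p)) = T₀ := by
    ext1 y
    obtain ⟨t, ht1, ht2⟩ := hV y
    rw [hRap, hT₀, ContinuousLinearMap.comp_apply, ContinuousLinearEquiv.coe_coe, ht1,
      fderiv_chartMap_dchart hι.contMDiff hs hms, ht2, map_sum]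
    refine Finset.sum_congr rfl fun i _ => ?_
    rw [map_smul, hchart p hs]
    exact congrArg _ (coordField_chart hms _)
  have hinj : Function.Injective T₀ := by
    refine (injective_iff_map_eq_zero T₀).2 fun y hy => ?_
    obtain ⟨t, ht1, ht2⟩ := hV y
    rw [hT₀, ContinuousLinearMap.comp_apply, ContinuousLinearEquiv.coe_coe, ht1,
      fderiv_chartMap_dchart hι.contMDiff hs hms] at hy
    have h1 := dchart_injective m hms (hy.trans (map_zero _).symm)
    have h2 := mfderiv_injective_of_isImmersionAt (hι.isImmersion.isImmersionAt p)
      (h1.trans (map_zero _).symm)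
    rw [h2, map_zero] at ht1
    simpa using ht1
  have hx := hγ.tendsto_chart
  have hDF : ContinuousAt (fderiv ℝ (chartMap ι p m)) (chart 2 p p) :=
    (hFc.fderiv_right (m := ∞) (by simp)).continuousAt
  have hT : Tendsto (fun s => (fderiv ℝ (chartMap ι p m) (chart 2 p (γ s))).comp
      V.toContinuousLinearMap) (𝓝[>] 0) (𝓝 T₀) :=
    (((ContinuousLinearMap.compL ℝ (EuclideanSpace ℝ (Fin 2)) (EuclideanSpace ℝ (Fin 2))
      (EuclideanSpace ℝ (Fin 3))).flip V.toContinuousLinearMap).continuous.tendsto _).comp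
      (hDF.tendsto.comp hx)
  have hR : Tendsto (fun s => R (chartMap ι p m (chart 2 p (γ s)))) (𝓝[>] 0) (𝓝 T₀) := by
    rw [← hR₀]
    exact hRc.tendsto.comp (hFc.continuousAt.tendsto.comp hx)
  refine tendsto_norm_of_apply_eq hT hR hinj ?_
  have hιs : Tendsto (fun s => ι (γ s)) (𝓝[>] 0) (𝓝 (ι p)) :=
    (hι.contMDiff.continuous.tendsto p).comp hγ.start
  filter_upwards [hγ.eventually_mem, hιs (hU.mem_nhds hpU),
    hιs ((isOpen_extChartAt_source m).mem_nhds hms)] with s hsa hsU hsm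
  obtain ⟨hmem, hunit⟩ := hXh.unit _ (hγ.notMem_charSet hsa.1)
  obtain ⟨c, hc, hcn⟩ := hX.exists_coordinates hsU (C.pushD ι (γ s) ⟨Xh (γ s), hmem⟩)
  rw [hunit] at hcn
  have hcn1 : ‖c‖ = 1 := by nlinarith [norm_nonneg c]
  refine ⟨ε • c, ?_, ?_⟩
  · rw [norm_smul, hcn1]
    rcases hγ.sign with h | h <;> simp [h]
  · have hc' : mfderiv (𝓡 2) (𝓡 3) ι (γ s) (Xh (γ s))
        = ∑ i, c i • (X i (ι (γ s)) : TangentSpace (𝓡 3) (ι (γ s))) := by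
      have := congrArg Subtype.val hc
      refine Eq.trans this ?_
      simp
    rw [ContinuousLinearMap.comp_apply, ContinuousLinearEquiv.coe_coe, V.apply_symm_apply,
      map_smul, map_smul, coordField_chart hsa.2, fderiv_chartMap_dchart hι.contMDiff hsa.2 hsm,
      hc', hRap, map_sum]
    congr 1
    refine Finset.sum_congr rfl fun i _ => ?_
    rw [map_smul, hchart _ hsa.2]
    exact congrArg _ (coordField_chart hsm (fun q => (X i q : TangentSpace (𝓡 3) q))).symm

/-- The drift coefficient in terms of the pulled back contact form, without a choice of a transverse
vector. -/
theorem IsArcLength.driftCoeff_mul (hγ : C.IsArcLength ι Xh ε ℓ p a γ)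
    (hι : Manifold.IsSmoothEmbedding (𝓡 2) (𝓡 3) ∞ ι)
    (hN : C.IsHorizontalUnitNormal ι N) (hXh : C.IsUnitCharField ι Xh) {s : ℝ}
    (hs : s ∈ openInterval a) {c : S} (hc : γ s ∈ (extChartAt (𝓡 2) c).source)
    (w : EuclideanSpace ℝ (Fin 2)) :
    C.driftCoeff ι N Xh ε γ s * pullForm C.α ι c (chart 2 c (γ s)) w
      = fderiv ℝ (pullForm C.α ι c) (chart 2 c (γ s))
          (ε • coordField c Xh (chart 2 c (γ s))) w
        - fderiv ℝ (pullForm C.α ι c) (chart 2 c (γ s)) w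
          (ε • coordField c Xh (chart 2 c (γ s))) := by
  have h1 : ∀ w, pullForm C.α ι c (chart 2 c (γ s)) w ≠ 0 →
      C.driftCoeff ι N Xh ε γ s * pullForm C.α ι c (chart 2 c (γ s)) w
      = fderiv ℝ (pullForm C.α ι c) (chart 2 c (γ s))
          (ε • coordField c Xh (chart 2 c (γ s))) w
        - fderiv ℝ (pullForm C.α ι c) (chart 2 c (γ s)) w
          (ε • coordField c Xh (chart 2 c (γ s))) := fun w hw => by
    rw [hγ.driftCoeff_eq hι hN hXh hs hc hw, div_mul_cancel₀ _ hw]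
    simp only [map_smul, smul_apply, smul_eq_mul]
    ring
  by_cases hw : pullForm C.α ι c (chart 2 c (γ s)) w = 0
  · have ht : chart 2 c (γ s) ∈ (extChartAt (𝓡 2) c).target :=
      (extChartAt (𝓡 2) c).map_source hc
    have hne : pullForm C.α ι c (chart 2 c (γ s)) ≠ 0 := (pullForm_ne_zero_iff hι ht).2 (by
      rw [show param 2 c (chart 2 c (γ s)) = γ s from (extChartAt (𝓡 2) c).left_inv hc]
      exact hγ.notMem_charSet hs)
    obtain ⟨w', hw'⟩ : ∃ w', pullForm C.α ι c (chart 2 c (γ s)) w' ≠ 0 := by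
      by_contra! h
      exact hne (by ext v; exact h v)
    -- For `w` in the kernel of the form, the identity is the difference of those for the transverse
    -- vectors `w' + w` and `w'`.
    have h2 := h1 (w' + w) (by rw [map_add, hw, add_zero]; exact hw')
    have h3 := h1 w' hw'
    simp only [map_add, add_apply] at h2
    linear_combination h2 - h3
  · exact h1 w hw

/-- The entries of `Hess u ∘ J` in an orthonormal frame. -/
theorem exists_hessJ_eq {q : M} (hq : q ∈ U) (hX : C.IsOrthonormalFrameOn X U) :
    ∃ δ : ℝ, δ * δ = 1 ∧ ∀ i,
      C.hessJ X u q 0 i = -δ * C.hess X u q i 1 ∧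
      C.hessJ X u q 1 i = δ * C.hess X u q i 0 := by
  -- The sign `δ` records whether the frame agrees with the orientation of `D` given by `dα`.
  refine ⟨C.dα q (X 0 q) (X 1 q), ?_, fun i => ?_⟩
  · have h := C.normalized q (X 0 q) (X 1 q) (by simp [hX.orthonormal _ hq])
      (by simp [hX.orthonormal _ hq]) (by simp [hX.orthonormal _ hq])
    rw [← abs_mul_abs_self]
    simp only [dα, h, mul_one]
  · simp only [hessJ, Matrix.transpose_apply, Matrix.mul_apply, Fin.sum_univ_two, jMatrix,
      Matrix.of_apply, dα_self, C.dα_swap q (X 1 q) (X 0 q)]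
    constructor <;> ring

end ContactSubRiemannian

end ContactSR

/-! ### Leaves as singular curves -/

namespace ContactSR

variable {M : Type*} [TopologicalSpace M] [ChartedSpace (EuclideanSpace ℝ (Fin 3)) M]
  [IsManifold (𝓡 3) ∞ M]
  {S : Type*} [TopologicalSpace S] [ChartedSpace (EuclideanSpace ℝ (Fin 2)) S]
  [IsManifold (𝓡 2) ∞ S] {ι : S → M}

namespace ContactSubRiemannian

variable {C : ContactSubRiemannian M} {p : S} {U : Set M} {X : Fin 2 → (q : M) → C.D q}
  {u : M → ℝ} {N : (q : S) → C.D (ι q)}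
  {Xh : (q : S) → TangentSpace (𝓡 2) q} {ε : ℝ} {ℓ : Set S} {a : EReal} {γ : ℝ → S}
  {V : EuclideanSpace ℝ (Fin 2) ≃L[ℝ] EuclideanSpace ℝ (Fin 2)}

theorem IsArcLength.exists_isSingularCurve (hγ : C.IsArcLength ι Xh ε ℓ p a γ)
    (hι : Manifold.IsSmoothEmbedding (𝓡 2) (𝓡 3) ∞ ι) (hN : C.IsHorizontalUnitNormal ι N)
    (hXh : C.IsUnitCharField ι Xh) (hp : p ∈ C.charSet ι) (hU : IsOpen U) (hpU : ι p ∈ U)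
    (hX : C.IsOrthonormalFrameOn X U) (hu : IsLocalDefiningFun ι U u)
    (htr : (C.hessJ X u (ι p)).trace = 1)
    (hV : ∀ y, ∃ t, V y = dchart 2 p p t ∧
      mfderiv (𝓡 2) (𝓡 3) ι p t = ∑ i, y i • (X i (ι p) : TangentSpace (𝓡 3) (ι p)))
    {B : EuclideanSpace ℝ (Fin 2) →L[ℝ] EuclideanSpace ℝ (Fin 2)}
    (hB : ∀ x i, B x i = ∑ j, C.hessJ X u (ι p) i j * x j) :
    ∃ z k K, IsSingularCurve B z (fun s => V.symm (ε • coordField p Xh (chart 2 p (γ s)))) k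
      (C.driftCoeff ι N Xh ε γ) K := by
  obtain ⟨c, hc, hH⟩ := exists_hess_eq hι hp hU hpU hX hu
  obtain ⟨δ, hδ, hJ⟩ := exists_hessJ_eq (u := u) hpU hX
  have hs : p ∈ (extChartAt (𝓡 2) p).source := mem_extChartAt_source p
  have ht : chart 2 p p ∈ (extChartAt (𝓡 2) p).target := (extChartAt (𝓡 2) p).map_source hs
  have hpp : param 2 p (chart 2 p p) = p := (extChartAt (𝓡 2) p).left_inv hs
  have hA0 : pullForm C.α ι p (chart 2 p p) = 0 := by
    by_contra h
    have h1 := (pullForm_ne_zero_iff hι ht).1 h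
    rw [hpp] at h1
    exact h1 hp
  have hVe : ∀ i, ∃ t, V (EuclideanSpace.single i 1) = dchart 2 p p t ∧
      mfderiv (𝓡 2) (𝓡 3) ι p t = X i (ι p) := fun i => by
    obtain ⟨t, ht1, ht2⟩ := hV (EuclideanSpace.single i 1)
    refine ⟨t, ht1, ht2.trans ?_⟩
    fin_cases i <;> simp
  have hHV : ∀ i j, C.hess X u (ι p) i j = -c * fderiv ℝ (pullForm C.α ι p) (chart 2 p p)
      (V (EuclideanSpace.single i 1)) (V (EuclideanSpace.single j 1)) := fun i j => by
    obtain ⟨v, hv1, hv2⟩ := hVe i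
    obtain ⟨w, hw1, hw2⟩ := hVe j
    rw [hv1, hw1]
    exact hH i j v w hv2 hw2
  -- The trace of `Hess u ∘ J` is `δ (H 1 0 - H 0 1)`; it equals `1` and `δ² = 1`.
  have htrH : C.hess X u (ι p) 1 0 - C.hess X u (ι p) 0 1 = δ := by
    rw [Matrix.trace_fin_two, (hJ 0).1, (hJ 1).2] at htr
    linear_combination (-(C.hess X u (ι p) 1 0 - C.hess X u (ι p) 0 1)) * hδ + δ * htr
  refine ⟨_, isSingularCurve_of_form (contDiffAt_pullForm C.smooth_form hι.contMDiff ht) hA0 V hc hδ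
    hHV htrH (x := fun s => chart 2 p (γ s)) ?_ ?_ ?_ ?_ hγ.tendsto_chart ?_ ?_ ?_
    (hγ.tendsto_norm hι hXh hU hpU hX hV)⟩
  · intro y
    rw [hB, Fin.sum_univ_two, (hJ 0).1, (hJ 1).1]
    ring
  · intro y
    rw [hB, Fin.sum_univ_two, (hJ 0).2, (hJ 1).2]
    ring
  · filter_upwards [hγ.eventually_mem] with s h
    exact hγ.hasDerivAt_chart h.1 h.2
  · filter_upwards [hγ.eventually_mem] with s h
    have h1 : ContinuousAt (fun t => coordField p Xh (chart 2 p (γ t))) s :=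
      ContinuousAt.comp (g := coordField p Xh)
        (contDiffAt_coordField_charField hι hXh h.2 (hγ.notMem_charSet h.1)).continuousAt
        (hγ.hasDerivAt_chart h.1 h.2).continuousAt
    exact h1.const_smul ε
  · filter_upwards [hγ.eventually_mem] with s h
    rw [map_smul, pullForm_coordField hXh ((extChartAt (𝓡 2) p).map_source h.2), smul_zero]
    rw [show param 2 p (chart 2 p (γ s)) = γ s from (extChartAt (𝓡 2) p).left_inv h.2]
    exact hγ.notMem_charSet h.1
  · filter_upwards [hγ.eventually_mem] with s h
    refine (pullForm_ne_zero_iff hι ((extChartAt (𝓡 2) p).map_source h.2)).2 ?_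
    rw [show param 2 p (chart 2 p (γ s)) = γ s from (extChartAt (𝓡 2) p).left_inv h.2]
    exact hγ.notMem_charSet h.1
  · filter_upwards [hγ.eventually_mem] with s h
    exact hγ.driftCoeff_mul hι hN hXh h.1 h.2

/-- Convergence in the tangent bundle becomes convergence of coordinate velocities because the base
point converges. Injectivity of the derivative of `ι` identifies the limit vector with the one whose
frame coordinates form the eigenvector. -/
theorem IsArcLength.entersTangentTo_iff (hγ : C.IsArcLength ι Xh ε ℓ p a γ)
    (hι : Manifold.IsSmoothEmbedding (𝓡 2) (𝓡 3) ∞ ι)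
    (hV : ∀ y, ∃ t, V y = dchart 2 p p t ∧
      mfderiv (𝓡 2) (𝓡 3) ι p t = ∑ i, y i • (X i (ι p) : TangentSpace (𝓡 3) (ι p)))
    {B : EuclideanSpace ℝ (Fin 2) →L[ℝ] EuclideanSpace ℝ (Fin 2)}
    (hB : ∀ x i, B x i = ∑ j, C.hessJ X u (ι p) i j * x j) (lam : ℝ) :
    C.EntersTangentTo ι Xh ε γ p X u lam ↔ ∃ w, w ≠ 0 ∧ B w = lam • w ∧
      Tendsto (fun s => V.symm (ε • coordField p Xh (chart 2 p (γ s)))) (𝓝[>] 0) (𝓝 w) := by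
  have hvec : ∀ w : EuclideanSpace ℝ (Fin 2), (w ≠ 0 ∧ B w = lam • w) ↔
      Module.End.HasEigenvector (Matrix.toLin' (C.hessJ X u (ι p))) lam (fun i => w i) := by
    intro w
    rw [Module.End.hasEigenvector_iff, Module.End.mem_eigenspace_iff, and_comm]
    refine and_congr ?_ (not_congr ?_)
    · constructor
      · intro h
        ext i
        have := congrArg (fun v : EuclideanSpace ℝ (Fin 2) => v i) h
        simp only [hB] at this
        exact this
      · intro h
        ext i
        rw [hB]
        exact congrFun h i
    · constructor
      · rintro rfl
        rfl
      · intro h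
        ext i
        exact congrFun h i
  have hlim : ∀ w : TangentSpace (𝓡 2) p,
      Tendsto (fun s => (⟨γ s, ε • Xh (γ s)⟩ : TangentBundle (𝓡 2) S)) (𝓝[>] 0)
        (𝓝 (⟨p, w⟩ : TangentBundle (𝓡 2) S)) ↔
      Tendsto (fun s => V.symm (ε • coordField p Xh (chart 2 p (γ s)))) (𝓝[>] 0)
        (𝓝 (V.symm (dchart 2 p p w))) := by
    intro w
    have h1 : Tendsto (fun s => dchart 2 p (γ s) (ε • Xh (γ s))) (𝓝[>] 0) (𝓝 (dchart 2 p p w)) ↔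
        Tendsto (fun s => ε • coordField p Xh (chart 2 p (γ s))) (𝓝[>] 0)
          (𝓝 (dchart 2 p p w)) := by
      refine tendsto_congr' ?_
      filter_upwards [hγ.eventually_mem] with s hs
      rw [map_smul, coordField_chart hs.2]
    rw [tendsto_tangentBundle_iff hγ.start, h1]
    exact V.symm.toHomeomorph.isInducing.tendsto_nhds_iff
  constructor
  · rintro ⟨w, c, hw, hwc, hc⟩
    obtain ⟨t, ht1, ht2⟩ := hV (WithLp.toLp 2 c)
    have h1 : t = w :=
      mfderiv_injective_of_isImmersionAt (hι.isImmersion.isImmersionAt p) (ht2.trans hwc.symm)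
    obtain ⟨h2, h3⟩ := (hvec (WithLp.toLp 2 c)).2 hc
    refine ⟨WithLp.toLp 2 c, h2, h3, ?_⟩
    rw [← V.symm_apply_apply (WithLp.toLp 2 c), ht1, h1]
    exact (hlim w).1 hw
  · rintro ⟨y, hy0, hy, hlimy⟩
    obtain ⟨t, ht1, ht2⟩ := hV y
    refine ⟨t, fun i => y i, (hlim t).2 ?_, ht2, (hvec y).1 ⟨hy0, hy⟩⟩
    rw [← ht1, V.symm_apply_apply]
    exact hlimy

end ContactSubRiemannian

end ContactSR

end

theorem lemma3
    {M : Type*} [TopologicalSpace M] [T2Space M]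
    [ChartedSpace (EuclideanSpace ℝ (Fin 3)) M] [IsManifold (𝓡 3) ∞ M]
    {S : Type*} [TopologicalSpace S]
    [ChartedSpace (EuclideanSpace ℝ (Fin 2)) S] [IsManifold (𝓡 2) ∞ S]
    (C : ContactSR.ContactSubRiemannian M)
    (ι : S → M) (hι : Manifold.IsSmoothEmbedding (𝓡 2) (𝓡 3) ∞ ι)
    (N : (q : S) → C.D (ι q)) (hN : C.IsHorizontalUnitNormal ι N)
    (Xh : (q : S) → TangentSpace (𝓡 2) q) (hXh : C.IsUnitCharField ι Xh)
    (p : S) (hp : p ∈ C.charSet ι)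
    (U : Set M) (hU : IsOpen U) (hpU : ι p ∈ U)
    (X : Fin 2 → (q : M) → C.D q) (hX : C.IsOrthonormalFrameOn X U)
    (u : M → ℝ) (hu : ContactSR.IsLocalDefiningFun ι U u)
    (hnorm : (C.hessJ X u (ι p)).trace = 1)
    (hK : C.charCurvature X u (ι p) ≠ -1)
    (ℓ : Set S) (a : EReal) (γ : ℝ → S) (ε : ℝ) (hγ : C.IsArcLength ι Xh ε ℓ p a γ) :
    ContactSR.EssSelfAdjointAtZero a (ContactSR.potential (C.driftCoeff ι N Xh ε γ)) ↔
      ContactSR.AllEigenvaluesReal (C.hessJ X u (ι p)) ∧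
      ∃ lam ∈ Set.Icc (-1 : ℝ) (1 / 3), C.EntersTangentTo ι Xh ε γ p X u lam := by
  obtain ⟨V, hV⟩ := ContactSR.ContactSubRiemannian.exists_frame_equiv hp hpU hX
  set A := C.hessJ X u (ι p) with hA
  set B := LinearMap.toContinuousLinearMap (Matrix.toEuclideanLin A) with hBdef
  have hB : ∀ x i, B x i = ∑ j, A i j * x j := fun x i => rfl
  -- `J` has determinant `δ² = 1`, so `Hess u ∘ J` and `Hess u` have equal determinants, and a zero
  -- determinant would give curvature `-1`.
  have hdet : A.det ≠ 0 := by
    obtain ⟨δ, hδ, hJ⟩ := ContactSR.ContactSubRiemannian.exists_hessJ_eq (u := u) hpU hX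
    have h1 : A.det = (C.hess X u (ι p)).det := by
      rw [Matrix.det_fin_two, Matrix.det_fin_two, hA, (hJ 0).1, (hJ 1).1, (hJ 0).2, (hJ 1).2]
      linear_combination (C.hess X u (ι p) 0 0 * C.hess X u (ι p) 1 1
        - C.hess X u (ι p) 0 1 * C.hess X u (ι p) 1 0) * hδ
    intro h
    refine hK ?_
    rw [ContactSR.ContactSubRiemannian.charCurvature, ← h1, h, zero_div, add_zero]
  obtain ⟨z, k, K, hcurve⟩ := hγ.exists_isSingularCurve hι hN hXh hp hU hpU hX hu hnorm hV hB
  rw [hcurve.essSelfAdjointAtZero_iff hB hnorm hdet hγ.pos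
    (fun s hs => hγ.differentiableAt_driftCoeff hι hN hXh hs)]
  simp only [← hγ.entersTangentTo_iff hι hV hB]
  -- Reality of the eigenvalues is automatic: one real eigenvalue and real trace make the other one
  -- real.
  refine ⟨fun h => ⟨?_, h⟩, fun h => h.2⟩
  obtain ⟨lam, -, w, c, -, -, hc⟩ := h
  exact ContactSR.allEigenvaluesReal_of_hasEigenvector hnorm hc
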